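/- Graphs are finite and undirected, without multiple edges, and loops are allowed (both in $H$ and in the input graphs). A homomorphism from $G$ to $H$ is a map $\sigma\colon V(G)\to V(H)$ such that $\sigma(u)\sigma(v)\in E(H)$ for every $uv\in E(G)$. It is *vertex surjective* if $\sigma(V(G))=V(H)$, and it is a *compaction* if it is vertex surjective and every non-loop edge of $H$ is the image of an edge of $G$. For a prime $p$ and a fixed graph $H$ let $\#_p\mathrm{Hom}(H)$, $\#_p\mathrm{VertSurj}(H)$ and $\#_p\mathrm{Comp}(H)$ be the problems of computing, for an input graph $G$, the number modulo $p$ of homomorphisms, of vertex surjective homomorphisms, and of compactions from $G$ to $H$, respectively. $\#_p\mathsf P$ is the class of functions $x\mapsto f(x)\bmod p$ with $f\in\#\mathsf P$, and hardness is with respect to polynomial-time Turing reductions. Complete bipartite graphs have no loops, and a single vertex without a loop counts as a complete bipartite graph and as an irreflexive star; a reflexive complete graph has all edges and all loops. For an automorphism $\varrho$ of $H$ let $H^{\varrho}$ be the subgraph of $H$ induced by the fixed points of $\varrho$. The *order $p$ reduced form* $H^{*p}$ of $H$ is the graph without automorphisms of order $p$ (unique up to isomorphism) that is obtained from $H$ by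 repeatedly replacing the current graph $F$ by $F^{\varrho}$ for some automorphism $\varrho$ of $F$ of order $p$. **Conjecture.** For every prime $p$ and every graph $H$: if every connected component of $H^{*p}$ is complete bipartite or reflexive complete, then $\#_p\mathrm{Hom}(H)$ is solvable in polynomial time; otherwise $\#_p\mathrm{Hom}(H)$ is $\#_p\mathsf P$-complete. **Corollary.** Let $p$ be a prime and $H$ a graph. 1. $\#_p\mathrm{VertSurj}(H)$ is solvable in polynomial time if $H$ has an automorphism of order $p$, or if every connected component of $H$ is a complete bipartite graph or a reflexive complete graph. 2. $\#_p\mathrm{Comp}(H)$ is solvable in polynomial time if $H$ has an automorphism of order $p$, or if every connected component of $H$ is an irreflexive star or a reflexive complete graph on at most two vertices. 3. Assume the Conjecture. Then $\#_p\mathrm{VertSurj}(H)$ is $\#_p\mathsf P$-hard in every case not covered by (1), and $\#_p\mathrm{Comp}(H)$ is $\#_p\mathsf P$-hard in every case not covered by (2). -/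

import Mathlib

/-! ### Graphs with loops -/

/-- An undirected graph on the vertex set `V`, without multiple edges, in which loops are allowed. -/
@[ext]
structure LoopGraph (V : Type) where
  /-- The edge relation; `Adj v v` says that there is a loop at `v`. -/
  Adj : V → V → Prop
  symm : ∀ u v, Adj u v → Adj v u

namespace LoopGraph

/-- Graph homomorphisms from `G` to `H`: maps on vertices that preserve edges. -/
abbrev Hom {V W : Type} (G : LoopGraph V) (H : LoopGraph W) : Type := G.Adj →r H.Adj

/-- Graph isomorphisms: bijections on vertices that preserve edges in both directions. -/
abbrev Iso {V W : Type} (G : LoopGraph V) (H : LoopGraph W) : Type := G.Adj ≃r H.Adj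

/-- The automorphism group of `H`. -/
abbrev Aut {V : Type} (H : LoopGraph V) : Type := H.Adj ≃r H.Adj

/-- `H` has an automorphism of order exactly `p`. -/
def HasAutOfOrder {V : Type} (H : LoopGraph V) (p : ℕ) : Prop :=
  ∃ ρ : H.Aut, orderOf ρ = p

/-- The subgraph of `H` induced by the vertex set `S`. -/
def induce {V : Type} (H : LoopGraph V) (S : Set V) : LoopGraph S where
  Adj u v := H.Adj u v
  symm u v h := H.symm u v h

/-- The vertex set of the connected component of `v`. -/
def component {V : Type} (H : LoopGraph V) (v : V) : Set V :=
  {w | Relation.ReflTransGen H.Adj v w}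

/-- A complete bipartite graph `K_{a,b}`, irreflexive by definition. One of the two parts may be
empty, so that a single vertex without a loop is complete bipartite (and it is the only connected
graph for which a part is empty). -/
def IsCompleteBipartite {V : Type} (H : LoopGraph V) : Prop :=
  ∃ L : Set V, ∀ u v, H.Adj u v ↔ ((u ∈ L ∧ v ∉ L) ∨ (u ∉ L ∧ v ∈ L))

/-- A reflexive complete graph: all edges and all loops are present. -/
def IsReflexiveComplete {V : Type} (H : LoopGraph V) : Prop :=
  ∀ u v, H.Adj u v

/-- An irreflexive star `K_{1,b}`, `b ≥ 0`: some centre `c` is joined to all other vertices, and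
there are no other edges and no loops. -/
def IsStar {V : Type} (H : LoopGraph V) : Prop :=
  ∃ c : V, ∀ u v, H.Adj u v ↔ ((u = c ∧ v ≠ c) ∨ (u ≠ c ∧ v = c))

/-- Every connected component of `H` is complete bipartite or reflexive complete. -/
def ComponentsBicliqueOrReflexive {V : Type} (H : LoopGraph V) : Prop :=
  ∀ v : V, (H.induce (H.component v)).IsCompleteBipartite ∨
    (H.induce (H.component v)).IsReflexiveComplete

/-- Every connected component of `H` is an irreflexive star or a reflexive complete graph with at
most two vertices. -/
def ComponentsStarOrSmallReflexive {V : Type} (H : LoopGraph V) : Prop :=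
  ∀ v : V, (H.induce (H.component v)).IsStar ∨
    ((H.induce (H.component v)).IsReflexiveComplete ∧ Nat.card (H.component v) ≤ 2)

/-- `H` can be transformed into (a graph isomorphic to) `H'` by repeatedly choosing an automorphism
`ρ` of order `p` of the current graph and passing to the subgraph induced by the fixed points
of `ρ`. -/
inductive ReducesTo (p : ℕ) : ∀ {V W : Type}, LoopGraph V → LoopGraph W → Prop
  | iso {V W : Type} {H : LoopGraph V} {H' : LoopGraph W} (e : H.Iso H') : ReducesTo p H H'
  | step {V W : Type} {H : LoopGraph V} {H' : LoopGraph W} (ρ : H.Aut) (hρ : orderOf ρ = p)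
      (h : ReducesTo p (H.induce {v | ρ v = v}) H') : ReducesTo p H H'

/-- `H'` is an order `p` reduced form of `H`. -/
def IsReducedForm (p : ℕ) {V W : Type} (H : LoopGraph V) (H' : LoopGraph W) : Prop :=
  ReducesTo p H H' ∧ ¬ H'.HasAutOfOrder p

/-- The number of homomorphisms from `G` to `H`. -/
noncomputable def numHom {V W : Type} (G : LoopGraph V) (H : LoopGraph W) : ℕ :=
  Nat.card (G.Hom H)

/-- The number of homomorphisms from `G` to `H` that are surjective on vertices. -/
noncomputable def numVertSurj {V W : Type} (G : LoopGraph V) (H : LoopGraph W) : ℕ :=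
  Nat.card {σ : G.Hom H // Function.Surjective σ}

/-- The number of compactions from `G` to `H`: vertex surjective homomorphisms for which every
non-loop edge of `H` is the image of an edge of `G`. -/
noncomputable def numCompaction {V W : Type} (G : LoopGraph V) (H : LoopGraph W) : ℕ :=
  Nat.card {σ : G.Hom H // Function.Surjective σ ∧
    ∀ u v, H.Adj u v → u ≠ v → ∃ a b, G.Adj a b ∧ σ a = u ∧ σ b = v}

/-! ### Graphs as inputs: binary strings -/

/-- The number of vertices of the graph described by the string `w`: the number of ones in front of
the first zero. -/
def codeSize (w : List Bool) : ℕ := (w.takeWhile id).length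

/-- The graph described by the string `w = 1ⁿ 0 b₀ b₁ b₂ …`. Its vertex set is `Fin n`, and the bits
`b_{i n + j}` (with `i, j < n`) are the adjacency matrix in row-major order. Every string is read as
a graph: missing bits count as zero, additional bits are ignored, and two vertices are adjacent if
one of the two corresponding bits is one. -/
def ofCode (w : List Bool) : LoopGraph (Fin (codeSize w)) where
  Adj i j :=
    (w.drop (codeSize w + 1)).getD (i * codeSize w + j) false = true ∨
    (w.drop (codeSize w + 1)).getD (j * codeSize w + i) false = true
  symm _ _ h := h.symm

/-- The code of a graph on `Fin n` by its adjacency matrix, of length `n + 1 + n * n`. -/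
noncomputable def code {n : ℕ} (G : LoopGraph (Fin n)) : List Bool :=
  List.replicate n true ++ false ::
    List.ofFn (fun k : Fin (n * n) => by
      classical exact decide (G.Adj k.divNat k.modNat))

theorem length_code {n : ℕ} (G : LoopGraph (Fin n)) : G.code.length = n + 1 + n * n := by
  simp only [code, List.length_append, List.length_replicate, List.length_cons, List.length_ofFn]
  ring

theorem codeSize_code {n : ℕ} (G : LoopGraph (Fin n)) : codeSize G.code = n := by
  have h : ∀ (m : ℕ) (l : List Bool), codeSize (List.replicate m true ++ false :: l) = m := by
    intro m l
    induction m with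
    | zero => simp [codeSize]
    | succ m ih => simp_all [codeSize, List.replicate_succ]
  exact h _ _

/-- Every graph on `Fin n` is recovered from its code. -/
theorem ofCode_code {n : ℕ} (G : LoopGraph (Fin n)) (i j : Fin (codeSize G.code)) :
    (ofCode G.code).Adj i j ↔
      G.Adj (Fin.cast G.codeSize_code i) (Fin.cast G.codeSize_code j) := by
  classical
  have key : ∀ a b : ℕ, ∀ (ha : a < n) (hb : b < n),
      (G.code.drop (n + 1)).getD (a * n + b) false = decide (G.Adj ⟨a, ha⟩ ⟨b, hb⟩) := by
    intro a b ha hb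
    have hn : 0 < n := by omega
    have hlt : a * n + b < n * n := by nlinarith
    have hd : G.code.drop (n + 1) =
        List.ofFn (fun k : Fin (n * n) => decide (G.Adj k.divNat k.modNat)) := by
      have e : List.drop (n + 1) (List.replicate n true) = [] :=
        List.drop_eq_nil_of_le (by simp)
      simp only [code, List.drop_append, e, List.length_replicate, Nat.add_sub_cancel_left,
        List.drop_succ_cons, List.drop_zero, List.nil_append]
    rw [hd, List.getD_eq_getElem _ _ (by simpa using hlt), List.getElem_ofFn]
    have h1 : (a * n + b) / n = a := by
      rw [mul_comm, Nat.mul_add_div hn, Nat.div_eq_of_lt hb, add_zero]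
    have h2 : (a * n + b) % n = b := by
      rw [mul_comm, Nat.mul_add_mod, Nat.mod_eq_of_lt hb]
    have e1 : Fin.divNat (⟨a * n + b, hlt⟩ : Fin (n * n)) = ⟨a, ha⟩ := Fin.ext h1
    have e2 : Fin.modNat (⟨a * n + b, hlt⟩ : Fin (n * n)) = ⟨b, hb⟩ := Fin.ext h2
    simp only [e1, e2]
  have hi : (i : ℕ) < n := lt_of_lt_of_eq i.2 G.codeSize_code
  have hj : (j : ℕ) < n := lt_of_lt_of_eq j.2 G.codeSize_code
  have k1 := key i j hi hj
  have k2 := key j i hj hi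
  simp only [ofCode, G.codeSize_code, k1, k2, decide_eq_true_eq]
  exact ⟨fun h => h.elim id (G.symm _ _), Or.inl⟩

end LoopGraph

/-! ### Complexity of functions from binary strings to natural numbers -/

open Turing Computability in
/-- The function `f` is computable in polynomial time by a Turing machine: the input is the binary
string itself, the output is written in binary. -/
def PolyTime (f : List Bool → ℕ) : Prop :=
  Nonempty (TM2ComputableInPolyTime (id : List Bool → List Bool) encodeNat f)

/-- The pair `(x, y)` of binary strings as the string `x # y` with a separator `#`. -/
def encodePair (w : List Bool × List Bool) : List (Option Bool) :=
  w.1.map some ++ none :: w.2.map some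

open Turing Computability in
/-- A relation on binary strings that is decidable in polynomial time. -/
def PolyTimeRel (R : List Bool × List Bool → Bool) : Prop :=
  Nonempty (TM2ComputableInPolyTime encodePair encodeBool R)

/-- The class `#P`: functions that count, for an input `x`, the witnesses `y` of polynomial length
`q(|x|)` that are accepted by a polynomial time verifier. -/
def SharpP (f : List Bool → ℕ) : Prop :=
  ∃ (q : Polynomial ℕ) (R : List Bool × List Bool → Bool), PolyTimeRel R ∧
    ∀ x, f x = Nat.card {y : List Bool // y.length = q.eval x.length ∧ R (x, y) = true}

/-- The class `#ₚP`: functions of the form `f mod p` with `f` in `#P`. -/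
def SharpModP (p : ℕ) (g : List Bool → ℕ) : Prop :=
  ∃ f : List Bool → ℕ, SharpP f ∧ ∀ x, g x = f x % p

/-- An oracle Turing machine over the binary alphabet: a (multi-stack) Turing machine with a query
stack, an answer stack and query states. In a query state `l` with `ask l = some l'` the machine
consults the oracle and continues in state `l'`. -/
structure OracleTM extends Turing.FinTM2 where
  inputAlphabet : Γ k₀ ≃ Bool
  outputAlphabet : Γ k₁ ≃ Bool
  /-- the query stack -/
  kq : K
  /-- the answer stack -/
  ka : K
  queryAlphabet : Γ kq ≃ Bool
  answerAlphabet : Γ ka ≃ Bool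
  /-- the query states, each with the state in which the computation resumes -/
  ask : Λ → Option Λ

namespace OracleTM

/-- One step of the machine with the oracle `O`. In a query state, the content `q` of the query stack
is erased and the content of the answer stack is replaced by `O q`, in a single step. In all other
states the machine executes its program. -/
def step (M : OracleTM) (O : List Bool → List Bool) (c : M.Cfg) : Option M.Cfg :=
  match c.l with
  | none => none
  | some l =>
    match M.ask l with
    | none => M.toFinTM2.step c
    | some l' =>
      some
        { l := some l'
          var := c.var
          stk := Function.update (Function.update c.stk M.kq []) M.ka
            ((O ((c.stk M.kq).map M.queryAlphabet)).map M.answerAlphabet.symm) }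

/-- With the oracle `O`, started on the input `x`, the machine halts with the output `y` after at
most `t` steps. -/
def OutputsInTime (M : OracleTM) (O : List Bool → List Bool) (x y : List Bool) (t : ℕ) : Prop :=
  Nonempty (StateTransition.EvalsToInTime (M.step O)
    (Turing.initList M.toFinTM2 (x.map M.inputAlphabet.symm))
    (some (Turing.haltList M.toFinTM2 (y.map M.outputAlphabet.symm))) t)

end OracleTM

open Computability in
/-- Polynomial time Turing reductions: `f` is computable in polynomial time by an oracle machine
with an oracle for `g`. -/
def TuringReduces (f g : List Bool → ℕ) : Prop :=
  ∃ (M : OracleTM) (q : Polynomial ℕ), ∀ x,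
    M.OutputsInTime (fun w => encodeNat (g w)) x (encodeNat (f x)) (q.eval x.length)

/-- `#ₚP`-hardness under polynomial time Turing reductions. -/
def SharpModPHard (p : ℕ) (g : List Bool → ℕ) : Prop :=
  ∀ f, SharpModP p f → TuringReduces f g

/-- `#ₚP`-completeness. -/
def SharpModPComplete (p : ℕ) (g : List Bool → ℕ) : Prop :=
  SharpModP p g ∧ SharpModPHard p g

/-! ### The computational problems and the conjecture -/

/-- The problem of computing, for an input graph `G`, the number of homomorphisms from `G` to `H`
modulo `p`. -/
noncomputable def homsProblem {V : Type} (H : LoopGraph V) (p : ℕ) : List Bool → ℕ :=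
  fun w => (LoopGraph.ofCode w).numHom H % p

/-- The problem of computing, for an input graph `G`, the number of vertex surjective homomorphisms
from `G` to `H` modulo `p`. -/
noncomputable def vertSurjProblem {V : Type} (H : LoopGraph V) (p : ℕ) : List Bool → ℕ :=
  fun w => (LoopGraph.ofCode w).numVertSurj H % p

/-- The problem of computing, for an input graph `G`, the number of compactions from `G` to `H`
modulo `p`. -/
noncomputable def compactionProblem {V : Type} (H : LoopGraph V) (p : ℕ) : List Bool → ℕ :=
  fun w => (LoopGraph.ofCode w).numCompaction H % p

/-- The conjectured dichotomy for counting homomorphisms modulo a prime `p` (due to Faben and Jerrum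
for `p = 2`): let `H'` be the order `p` reduced form of the finite graph `H`. If all components of
`H'` are complete bipartite or reflexive complete, then counting homomorphisms to `H` modulo `p` is
solvable in polynomial time; otherwise it is `#ₚP`-complete. -/
def FabenJerrumConjecture : Prop :=
  ∀ p : ℕ, p.Prime → ∀ (V : Type) [Finite V] (H : LoopGraph V) (W : Type) (H' : LoopGraph W),
    LoopGraph.IsReducedForm p H H' →
      (H'.ComponentsBicliqueOrReflexive → PolyTime (homsProblem H p)) ∧
      (¬ H'.ComponentsBicliqueOrReflexive → SharpModPComplete p (homsProblem H p))

/-! Hardness. If `H` has no automorphism of order `p`, then |Aut H| is invertible modulo `p` by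
Cauchy's theorem. Consider the pairs of a homomorphism from `G` to `H` and an injective homomorphism
from `H` to `H` whose images together cover `H` (its vertices, or its vertices and non-loop edges).
The second map is an automorphism and covers everything alone, so there are hom(G, H)·|Aut H| such
pairs. Inclusion–exclusion over the pairs of vertices that the second map identifies turns this
number into a signed sum of numbers of surjections, or compactions, from G + H/E to `H`, where E is
a set of pairs to be identified (`card_aut_mul_numHom`). Hence hom(G, H) modulo `p` is a fixed
linear combination of oracle values. As `H` is its own reduced form, the conjecture makes hom(·, H)
hard unless all components are bicliques or reflexive complete.

This leaves, for compactions, the graphs with such components that are not all stars or small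
reflexive cliques. All these graphs are rectangular: the ends of a walk of length three are
adjacent. There is a non-loop edge uv whose ends are still joined by a walk of length three in H -
uv (`exists_deleteEdge_walk`). The same count with H - uv as the source of the second map gives |Aut
H|·(hom(G, H) - hom(G, H - uv)): an injective map from H - uv to `H` is again an automorphism of
`H`, and the first map has to supply the one edge that is missing (`card_image_union_deleteEdge`).
So hom(·, H - uv) reduces to compactions. It is hard, because H - uv is not rectangular and has no
automorphism of order `p`.

Tractability. An automorphism of order `p` acts on surjections and on compactions without fixed
points, so their number is 0 modulo `p`. In the other cases inclusion–exclusion over the vertices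
and edges that are missed gives a signed sum of numbers of homomorphisms with restricted image to
rectangular graphs. For these, fix the image of a root in each component of `G`: the admissible
images of any other vertex depend only on the parities of the walks from the root, and the vertices
can be mapped independently (`forall_mem_allowed_iff`).

Complexity. Turing machines are handled through two layers. Array programs work on an adjacency
matrix with nested index loops and have polynomial cost by construction; they compile to structured
stack programs, which compile to machines. A reduction is obtained by replacing each oracle state of
a given machine by such a program that queries the new oracle; this stays polynomial since all
answers are bounded residues. -/

open Turing

/-! ### Structured stack programs -/

/-- Structured programs over a family of stacks `k : K` with alphabets `Γ k` and a register of
type `ρ`. A `loop` pops the stack `k` until it is empty and runs its body after each pop. -/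
inductive StackProg {K : Type} (Γ : K → Type) (ρ : Type) : Type
  | push (k : K) (f : ρ → Γ k)
  | pop (k : K) (f : ρ → Option (Γ k) → ρ)
  | load (f : ρ → ρ)
  | ask
  | seq (P Q : StackProg Γ ρ)
  | ite (c : ρ → Bool) (P Q : StackProg Γ ρ)
  | loop (k : K) (f : ρ → Γ k → ρ) (P : StackProg Γ ρ)

namespace StackProg

variable {K : Type} [DecidableEq K] {Γ : K → Type} {ρ : Type}

/-- `Run A P v S v' S' t`: started with register `v` and stacks `S`, the program `P` ends after `t`
steps with register `v'` and stacks `S'`. The instruction `ask` acts on the stacks by `A`. -/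
inductive Run (A : (∀ k, List (Γ k)) → ∀ k, List (Γ k)) :
    StackProg Γ ρ → ρ → (∀ k, List (Γ k)) → ρ → (∀ k, List (Γ k)) → ℕ → Prop
  | push (k f v S) : Run A (push k f) v S v (Function.update S k (f v :: S k)) 1
  | pop (k f v S) : Run A (pop k f) v S (f v (S k).head?) (Function.update S k (S k).tail) 1
  | load (f v S) : Run A (load f) v S (f v) S 1
  | ask (v S) : Run A ask v S v (A S) 1
  | seq {P Q v S v₁ S₁ v₂ S₂ t₁ t₂} (h₁ : Run A P v S v₁ S₁ t₁) (h₂ : Run A Q v₁ S₁ v₂ S₂ t₂) :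
      Run A (seq P Q) v S v₂ S₂ (t₁ + t₂)
  | ite_true {c P Q v S v₁ S₁ t} (hc : c v = true) (h : Run A P v S v₁ S₁ t) :
      Run A (ite c P Q) v S v₁ S₁ (t + 1)
  | ite_false {c P Q v S v₁ S₁ t} (hc : c v = false) (h : Run A Q v S v₁ S₁ t) :
      Run A (ite c P Q) v S v₁ S₁ (t + 1)
  | loop_nil {k f P v S} (h : S k = []) : Run A (loop k f P) v S v S 1
  | loop_cons {k f P v S a l v₁ S₁ v₂ S₂ t₁ t₂} (h : S k = a :: l)
      (h₁ : Run A P (f v a) (Function.update S k l) v₁ S₁ t₁)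
      (h₂ : Run A (loop k f P) v₁ S₁ v₂ S₂ t₂) : Run A (loop k f P) v S v₂ S₂ (t₁ + t₂ + 1)

/-- The positions of a program. -/
def Label : StackProg Γ ρ → Type
  | push _ _ => Unit
  | pop _ _ => Unit
  | load _ => Unit
  | ask => Unit
  | seq P Q => P.Label ⊕ Q.Label
  | ite _ P Q => Option (P.Label ⊕ Q.Label)
  | loop _ _ P => Option P.Label

/-- A program has finitely many positions. -/
instance fintypeLabel : (P : StackProg Γ ρ) → Fintype P.Label
  | push _ _ => inferInstanceAs (Fintype Unit)
  | pop _ _ => inferInstanceAs (Fintype Unit)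
  | load _ => inferInstanceAs (Fintype Unit)
  | ask => inferInstanceAs (Fintype Unit)
  | seq P Q =>
    letI := fintypeLabel P
    letI := fintypeLabel Q
    inferInstanceAs (Fintype (P.Label ⊕ Q.Label))
  | ite _ P Q =>
    letI := fintypeLabel P
    letI := fintypeLabel Q
    inferInstanceAs (Fintype (Option (P.Label ⊕ Q.Label)))
  | loop _ _ P =>
    letI := fintypeLabel P
    inferInstanceAs (Fintype (Option P.Label))

/-- The first position of a program. -/
def entry : (P : StackProg Γ ρ) → P.Label
  | push _ _ => ()
  | pop _ _ => ()
  | load _ => ()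
  | ask => ()
  | seq P _ => Sum.inl P.entry
  | ite _ _ _ => none
  | loop _ _ _ => none

/-- The machine instruction at a position of a program whose positions are embedded by `e` into the
labels of a machine: either a statement, or an oracle query that is followed by a jump. The program
continues at `ex` when it ends. -/
def instr (σ : Type) {Λ : Type} : (P : StackProg Γ ρ) → (P.Label → Λ) → Λ → P.Label →
    TM2.Stmt Γ Λ (σ × Bool × ρ) ⊕ Λ
  | push k f, _, ex, _ => .inl (.push k (fun s => f s.2.2) (.goto fun _ => ex))
  | pop k f, _, ex, _ => .inl (.pop k (fun s o => (s.1, s.2.1, f s.2.2 o)) (.goto fun _ => ex))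
  | load f, _, ex, _ => .inl (.load (fun s => (s.1, s.2.1, f s.2.2)) (.goto fun _ => ex))
  | ask, _, ex, _ => .inr ex
  | seq P Q, e, _, .inl x => P.instr σ (fun y => e (.inl y)) (e (.inr Q.entry)) x
  | seq _ Q, e, ex, .inr x => Q.instr σ (fun y => e (.inr y)) ex x
  | ite c P Q, e, _, none => .inl (.branch (fun s => c s.2.2)
      (.goto fun _ => e (some (.inl P.entry))) (.goto fun _ => e (some (.inr Q.entry))))
  | ite _ P _, e, ex, some (.inl x) => P.instr σ (fun y => e (some (.inl y))) ex x
  | ite _ _ Q, e, ex, some (.inr x) => Q.instr σ (fun y => e (some (.inr y))) ex x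
  -- A statement can branch on the register only, so the pop records in the Boolean whether the
  -- stack was nonempty. The flag is reset before the body is entered and is already false on exit;
  -- between instructions it is always false.
  | loop k f P, e, ex, none => .inl (.pop k
      (fun s o => (s.1, o.isSome, o.elim s.2.2 (f s.2.2)))
      (.branch (fun s => s.2.1)
        (.load (fun s => (s.1, false, s.2.2)) (.goto fun _ => e (some P.entry)))
        (.goto fun _ => ex)))
  | loop _ _ P, e, _, some x => P.instr σ (fun y => e (some y)) (e none) x

/-- The step function `step` executes the instructions of `P`. -/
def Implements {σ Λ : Type} (step : TM2.Cfg Γ Λ (σ × Bool × ρ) → Option (TM2.Cfg Γ Λ (σ × Bool × ρ)))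
    (A : (∀ k, List (Γ k)) → ∀ k, List (Γ k)) (P : StackProg Γ ρ) (e : P.Label → Λ) (ex : Λ) :
    Prop :=
  ∀ x v S, step ⟨some (e x), v, S⟩ =
    some ((P.instr σ e ex x).elim (fun q => TM2.stepAux q v S) fun l => ⟨some l, v, A S⟩)

/-- Each position carries one statement that ends in a jump, so the time of a run is the exact
number of machine steps. The exit label varies in the induction: the first part of a sequence leaves
to the entry of the second, the body of a loop to the head of the loop. -/
theorem Run.iterate {σ Λ : Type}
    {step : TM2.Cfg Γ Λ (σ × Bool × ρ) → Option (TM2.Cfg Γ Λ (σ × Bool × ρ))}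
    {A : (∀ k, List (Γ k)) → ∀ k, List (Γ k)} {P : StackProg Γ ρ} {v v' S S' t}
    (h : Run A P v S v' S' t) (e : P.Label → Λ) (ex : Λ) (hP : Implements step A P e ex) (u : σ) :
    (flip bind step)^[t] (some ⟨some (e P.entry), (u, false, v), S⟩) =
      some ⟨some ex, (u, false, v'), S'⟩ := by
  induction h generalizing ex with
  | push k f v S => exact hP () _ _
  | pop k f v S => exact hP () _ _
  | load f v S => exact hP () _ _
  | ask v S => exact hP () _ _
  | @seq P Q v S v₁ S₁ v₂ S₂ t₁ t₂ h₁ h₂ ih₁ ih₂ =>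
    rw [add_comm, Function.iterate_add_apply]
    have := ih₁ (fun y => e (.inl y)) (e (.inr Q.entry)) (fun x => hP (.inl x))
    rw [show e (entry (StackProg.seq P Q)) = e (.inl P.entry) from rfl, this]
    exact ih₂ (fun y => e (.inr y)) ex (fun x => hP (.inr x))
  | @ite_true c P Q v S v₁ S₁ t hc h ih =>
    rw [Function.iterate_succ_apply]
    have := hP none (u, false, v) S
    simp only [instr, Sum.elim_inl, TM2.stepAux, hc, cond_true] at this
    refine Eq.trans (congrArg _ this) ?_
    exact ih (fun y => e (some (.inl y))) ex (fun x => hP (some (.inl x)))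
  | @ite_false c P Q v S v₁ S₁ t hc h ih =>
    rw [Function.iterate_succ_apply]
    have := hP none (u, false, v) S
    simp only [instr, Sum.elim_inl, TM2.stepAux, hc, cond_false] at this
    refine Eq.trans (congrArg _ this) ?_
    exact ih (fun y => e (some (.inr y))) ex (fun x => hP (some (.inr x)))
  | @loop_nil k f P v S h =>
    have := hP none (u, false, v) S
    simp only [instr, Sum.elim_inl, TM2.stepAux, h, List.head?_nil, List.tail_nil,
      Option.isSome_none, cond_false, Option.elim_none] at this
    rw [show Function.update S k [] = S by rw [← h, Function.update_eq_self]] at this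
    exact this
  | @loop_cons k f P v S a l v₁ S₁ v₂ S₂ t₁ t₂ h h₁ h₂ ih₁ ih₂ =>
    rw [Function.iterate_succ_apply]
    have := hP none (u, false, v) S
    simp only [instr, Sum.elim_inl, TM2.stepAux, h, List.head?_cons, List.tail_cons,
      Option.isSome_some, cond_true, Option.elim_some] at this
    refine Eq.trans (congrArg _ this) ?_
    rw [add_comm t₁, Function.iterate_add_apply]
    rw [ih₁ (fun y => e (some y)) (e none) (fun x => hP (some x))]
    exact ih₂ e ex hP

/-- The program `P` runs from register `v` and stacks `S` to register `v'` and stacks `S'` in at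
most `t` steps. -/
def RunLE (A : (∀ k, List (Γ k)) → ∀ k, List (Γ k)) (P : StackProg Γ ρ) (v : ρ)
    (S : ∀ k, List (Γ k)) (v' : ρ) (S' : ∀ k, List (Γ k)) (t : ℕ) : Prop :=
  ∃ t' ≤ t, Run A P v S v' S' t'

namespace RunLE

variable {A : (∀ k, List (Γ k)) → ∀ k, List (Γ k)} {P Q : StackProg Γ ρ} {v v₁ v₂ : ρ}
  {S S₁ S₂ : ∀ k, List (Γ k)} {t t₁ t₂ : ℕ}

theorem mono (h : RunLE A P v S v₁ S₁ t₁) (ht : t₁ ≤ t) : RunLE A P v S v₁ S₁ t :=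
  let ⟨t', ht', h'⟩ := h
  ⟨t', ht'.trans ht, h'⟩

theorem of_eq (h : RunLE A P v S v₁ S₁ t₁) (hv : v₁ = v₂) (hS : S₁ = S₂) (ht : t₁ ≤ t) :
    RunLE A P v S v₂ S₂ t :=
  hv ▸ hS ▸ h.mono ht

theorem push (k : K) (f : ρ → Γ k) (h : S₁ = Function.update S k (f v :: S k)) :
    RunLE A (.push k f) v S v S₁ 1 :=
  h ▸ ⟨1, le_rfl, .push ..⟩

theorem pop (k : K) (f : ρ → Option (Γ k) → ρ) (hv : v₁ = f v (S k).head?)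
    (h : S₁ = Function.update S k (S k).tail) : RunLE A (.pop k f) v S v₁ S₁ 1 :=
  h ▸ hv ▸ ⟨1, le_rfl, .pop ..⟩

theorem load (f : ρ → ρ) : RunLE A (.load f) v S (f v) S 1 :=
  ⟨1, le_rfl, .load ..⟩

theorem ask : RunLE A (.ask : StackProg Γ ρ) v S v (A S) 1 :=
  ⟨1, le_rfl, .ask ..⟩

theorem seq (h₁ : RunLE A P v S v₁ S₁ t₁) (h₂ : RunLE A Q v₁ S₁ v₂ S₂ t₂) :
    RunLE A (.seq P Q) v S v₂ S₂ (t₁ + t₂) :=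
  let ⟨t₁', ht₁, h₁'⟩ := h₁
  let ⟨t₂', ht₂, h₂'⟩ := h₂
  ⟨t₁' + t₂', add_le_add ht₁ ht₂, h₁'.seq h₂'⟩

theorem ite_true {c : ρ → Bool} (hc : c v = true) (h : RunLE A P v S v₁ S₁ t) :
    RunLE A (.ite c P Q) v S v₁ S₁ (t + 1) :=
  let ⟨t', ht', h'⟩ := h
  ⟨t' + 1, by omega, h'.ite_true hc⟩

theorem ite_false {c : ρ → Bool} (hc : c v = false) (h : RunLE A Q v S v₁ S₁ t) :
    RunLE A (.ite c P Q) v S v₁ S₁ (t + 1) :=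
  let ⟨t', ht', h'⟩ := h
  ⟨t' + 1, by omega, h'.ite_false hc⟩

theorem loop_nil {k : K} {f : ρ → Γ k → ρ} (h : S k = []) :
    RunLE A (.loop k f P) v S v S 1 :=
  ⟨1, le_rfl, .loop_nil h⟩

theorem loop_cons {k : K} {f : ρ → Γ k → ρ} {a : Γ k} {l : List (Γ k)} (h : S k = a :: l)
    (h₁ : RunLE A P (f v a) (Function.update S k l) v₁ S₁ t₁)
    (h₂ : RunLE A (.loop k f P) v₁ S₁ v₂ S₂ t₂) :
    RunLE A (.loop k f P) v S v₂ S₂ (t₁ + t₂ + 1) :=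
  let ⟨t₁', ht₁, h₁'⟩ := h₁
  let ⟨t₂', ht₂, h₂'⟩ := h₂
  ⟨t₁' + t₂' + 1, by omega, .loop_cons h h₁' h₂'⟩

/-- A loop over a stack with content `l`, whose state after `i` rounds is `V i`, `U i`, with
`U i k = l.drop i`. -/
theorem loop {k : K} {f : ρ → Γ k → ρ} (l : List (Γ k)) (V : ℕ → ρ) (U : ℕ → ∀ k, List (Γ k))
    (hU : ∀ i ≤ l.length, U i k = l.drop i)
    (hb : ∀ i (hi : i < l.length), RunLE A P (f (V i) l[i])
      (Function.update (U i) k (l.drop (i + 1))) (V (i + 1)) (U (i + 1)) t) :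
    RunLE A (.loop k f P) (V 0) (U 0) (V l.length) (U l.length) (l.length * (t + 1) + 1) := by
  have key : ∀ j i, i + j = l.length →
      RunLE A (.loop k f P) (V i) (U i) (V l.length) (U l.length) (j * (t + 1) + 1) := by
    intro j
    induction j with
    | zero =>
      intro i hi
      obtain rfl : i = l.length := by omega
      refine (loop_nil ?_).mono (by omega)
      rw [hU _ le_rfl, List.drop_length]
    | succ j ih =>
      intro i hi
      have hlt : i < l.length := by omega
      refine (loop_cons (a := l[i]) (l := l.drop (i + 1)) ?_ (hb i hlt)
        (ih (i + 1) (by omega))).mono ?_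
      · rw [hU _ hlt.le, List.drop_eq_getElem_cons hlt]
      · rw [Nat.succ_mul]; omega
  exact key l.length 0 (by omega)

end RunLE

end StackProg

/-! ### Array programs -/

/-- The counters of the array machine: the size `nn`, two temporary counters, and two counters for
each of five index variables. -/
inductive Counter
  | nn | nt | ta
  | lo (i : Fin 5)
  | hi (i : Fin 5)
  deriving DecidableEq, Fintype

/-- The stacks of the array machine: two stacks for the cells, and the counters. -/
inductive Aux
  | x | xb
  | cnt (c : Counter)
  deriving DecidableEq, Fintype

/-- The alphabets of the array machine with cells of type `α`. -/
abbrev Aux.alphabet (α : Type) : Aux → Type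
  | x => α
  | xb => α
  | cnt _ => Unit

/-- The memory of the array machine. -/
@[ext]
structure Mem (α : Type) where
  /-- the cells ahead -/
  x : List α
  /-- the cells passed, in reverse order -/
  xb : List α
  /-- the values of the counters -/
  cnt : Counter → ℕ

/-- The alphabets of the array machine inside of a host machine with alphabets `Γ`. -/
abbrev HostAlphabet {K : Type} (Γ : K → Type) (α : Type) : K ⊕ Aux → Type
  | .inl k => Γ k
  | .inr a => a.alphabet α

namespace Mem

variable {K : Type} {Γ : K → Type} {α : Type}

/-- The stacks that represent the memory `m` and the stacks `h` of the host. -/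
def stk (h : ∀ k, List (Γ k)) (m : Mem α) : ∀ k, List (HostAlphabet Γ α k)
  | .inl k => h k
  | .inr .x => m.x
  | .inr .xb => m.xb
  | .inr (.cnt c) => List.replicate (m.cnt c) ()

/-- The memory `m` with `k` cells moved from `x` to `xb`. -/
def shift (m : Mem α) (k : ℕ) : Mem α :=
  { m with x := m.x.drop k, xb := (m.x.take k).reverse ++ m.xb }

/-- The memory `m` with the counter `c` set to `k`. -/
def set (m : Mem α) (c : Counter) (k : ℕ) : Mem α :=
  { m with cnt := Function.update m.cnt c k }

variable (h : ∀ k, List (Γ k)) (m : Mem α)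

@[simp] theorem stk_inl (k : K) : m.stk h (.inl k) = h k := rfl
@[simp] theorem stk_x : m.stk h (.inr .x) = m.x := rfl
@[simp] theorem stk_xb : m.stk h (.inr .xb) = m.xb := rfl
@[simp] theorem stk_cnt (c : Counter) :
    m.stk h (.inr (.cnt c)) = List.replicate (m.cnt c) () := rfl

variable [DecidableEq K]

@[simp] theorem update_inl (k : K) (l : List (Γ k)) :
    Function.update (m.stk h) (.inl k) l = m.stk (Function.update h k l) := by
  funext k'
  rcases k' with k' | (_ | _ | c)
  · by_cases hk : k' = k
    · subst hk; simp
    · rw [Function.update_of_ne (by simpa using hk)]; simp [hk]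
  all_goals rw [Function.update_of_ne (by simp)]; rfl

@[simp] theorem update_x (l : List α) :
    Function.update (m.stk h) (.inr .x) l = ({ m with x := l } : Mem α).stk h := by
  funext k'
  rcases k' with k' | (_ | _ | c)
  · rfl
  · rw [Function.update_self]; rfl
  all_goals rw [Function.update_of_ne (by simp)]; rfl

@[simp] theorem update_xb (l : List α) :
    Function.update (m.stk h) (.inr .xb) l = ({ m with xb := l } : Mem α).stk h := by
  funext k'
  rcases k' with k' | (_ | _ | c)
  · rfl
  · rw [Function.update_of_ne (by simp)]; rfl
  · rw [Function.update_self]; rfl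
  · rw [Function.update_of_ne (by simp)]; rfl

theorem update_cnt (c : Counter) (k : ℕ) (l : List Unit) (hl : l = List.replicate k ()) :
    Function.update (m.stk h) (.inr (.cnt c)) l = (m.set c k).stk h := by
  subst hl
  funext k'
  rcases k' with k' | (_ | _ | c')
  · rfl
  · rw [Function.update_of_ne (by simp)]; rfl
  · rw [Function.update_of_ne (by simp)]; rfl
  · by_cases hc : c' = c
    · subst hc; rw [Function.update_self]; simp [set]
    · rw [Function.update_of_ne (by simpa using hc)]; simp [set, hc]

@[simp] theorem set_x (c k) : (m.set c k).x = m.x := rfl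
@[simp] theorem set_xb (c k) : (m.set c k).xb = m.xb := rfl
theorem set_cnt (c k c') : (m.set c k).cnt c' = if c' = c then k else m.cnt c' := by
  simp [set, Function.update_apply]
@[simp] theorem set_cnt_self (c k) : (m.set c k).cnt c = k := by simp [set]
@[simp] theorem shift_cnt (k) : (m.shift k).cnt = m.cnt := rfl
theorem set_comm {c c' : Counter} (hc : c ≠ c') (k k' : ℕ) :
    (m.set c k).set c' k' = (m.set c' k').set c k := by
  refine Mem.ext rfl rfl ?_
  funext d
  by_cases h₁ : d = c <;> by_cases h₂ : d = c' <;> simp_all [set]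
@[simp] theorem set_set (c k k') : (m.set c k).set c k' = m.set c k' := by
  simp [set]
theorem set_eq_self (c k) (hk : m.cnt c = k) : m.set c k = m := by
  subst hk; simp [set]
@[simp] theorem set_shift (c k j) : (m.set c k).shift j = (m.shift j).set c k := rfl
@[simp] theorem shift_shift (j k : ℕ) : (m.shift j).shift k = m.shift (j + k) := by
  simp [shift, List.take_add]
@[simp] theorem shift_zero : m.shift 0 = m := by simp [shift]

end Mem

namespace StackProg

variable {K : Type} [DecidableEq K] {Γ : K → Type} {σ α : Type}
  {A : (∀ k, List (HostAlphabet Γ α k)) → ∀ k, List (HostAlphabet Γ α k)}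

/-- The program that does nothing. -/
def skip {K : Type} {Γ : K → Type} {ρ : Type} : StackProg Γ ρ := load id

theorem runLE_skip {K : Type} [DecidableEq K] {Γ : K → Type} {ρ : Type}
    {A : (∀ k, List (Γ k)) → ∀ k, List (Γ k)} {v : ρ} {S} : RunLE A skip v S v S 1 :=
  RunLE.load id

/-- A loop over the counter `c`. -/
def loopCnt (c : Counter) (P : StackProg (HostAlphabet Γ α) (σ × Option α)) :
    StackProg (HostAlphabet Γ α) (σ × Option α) :=
  loop (.inr (.cnt c)) (fun v _ => v) P

/-- The `Option α` in the register is a buffer for a cell on its way between two stacks; it is empty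
before and after each program. The body starts after the decrement, hence the counter value `n - (i
+ 1)`. -/
theorem runLE_loopCnt {c : Counter} {P : StackProg (HostAlphabet Γ α) (σ × Option α)} {t : ℕ}
    (n : ℕ) (V : ℕ → σ) (H : ℕ → ∀ k, List (Γ k)) (M : ℕ → Mem α)
    (hM : ∀ i ≤ n, (M i).cnt c = n - i)
    (hb : ∀ i < n, RunLE A P (V i, none) (((M i).set c (n - (i + 1))).stk (H i))
      (V (i + 1), none) ((M (i + 1)).stk (H (i + 1))) t) :
    RunLE A (loopCnt c P) (V 0, none) ((M 0).stk (H 0)) (V n, none) ((M n).stk (H n))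
      (n * (t + 1) + 1) := by
  have := RunLE.loop (A := A) (k := .inr (.cnt c)) (f := fun (v : σ × Option α) _ => v) (P := P)
    (t := t) (List.replicate n ()) (fun i => (V i, none)) (fun i => (M i).stk (H i)) ?_ ?_
  · simpa [StackProg.loopCnt] using this
  · intro i hi
    rw [List.length_replicate] at hi
    simp [hM i hi]
  · intro i hi
    rw [List.length_replicate] at hi
    have h := hb i hi
    rw [← Mem.update_cnt (H i) (M i) c _ ((List.replicate n ()).drop (i + 1)) (by simp)] at h
    exact h

theorem runLE_pushCnt (c : Counter) {v : σ × Option α} {h : ∀ k, List (Γ k)} {m : Mem α} :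
    RunLE A (push (.inr (.cnt c)) fun _ => ()) v (m.stk h) v ((m.set c (m.cnt c + 1)).stk h) 1 := by
  refine RunLE.push _ _ ?_
  rw [Mem.update_cnt (k := m.cnt c + 1)]
  simp [List.replicate_succ]

/-- Set the counter `c` to zero. -/
def clearCnt (c : Counter) : StackProg (HostAlphabet Γ α) (σ × Option α) := loopCnt c skip

theorem runLE_clearCnt (c : Counter) {v : σ} {h : ∀ k, List (Γ k)} {m : Mem α} :
    RunLE A (clearCnt c) (v, none) (m.stk h) (v, none) ((m.set c 0).stk h) (m.cnt c * 2 + 1) := by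
  have := runLE_loopCnt (A := A) (c := c) (P := skip) (t := 1) (m.cnt c) (fun _ => v) (fun _ => h)
    (fun i => m.set c (m.cnt c - i)) (by simp) (fun i _ => by simpa using runLE_skip)
  rw [Nat.sub_zero, Mem.set_eq_self _ _ _ rfl, Nat.sub_self] at this
  exact this

/-- Add the counter `c` to the counter `c'`, and set `c` to zero. -/
def moveCnt (c c' : Counter) : StackProg (HostAlphabet Γ α) (σ × Option α) :=
  loopCnt c (push (.inr (.cnt c')) fun _ => ())

theorem runLE_moveCnt {c c' : Counter} (hc : c ≠ c') {v : σ} {h : ∀ k, List (Γ k)} {m : Mem α} :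
    RunLE A (moveCnt c c') (v, none) (m.stk h) (v, none)
      (((m.set c 0).set c' (m.cnt c' + m.cnt c)).stk h) (m.cnt c * 2 + 1) := by
  have := runLE_loopCnt (A := A) (c := c) (P := push (.inr (.cnt c')) fun _ => ()) (t := 1)
    (m.cnt c) (fun _ => v) (fun _ => h)
    (fun i => (m.set c (m.cnt c - i)).set c' (m.cnt c' + i)) ?_ ?_
  · rw [Nat.sub_zero, Mem.set_eq_self _ c _ rfl, Nat.sub_self, Nat.add_zero, Mem.set_eq_self _ c' _ rfl] at this
    exact this
  · intro i _
    simp [Mem.set_cnt, hc]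
  · intro i _
    have := runLE_pushCnt (A := A) c' (v := (v, none)) (h := h)
      (m := (m.set c (m.cnt c - (i + 1))).set c' (m.cnt c' + i))
    rw [Mem.set_cnt_self, Mem.set_set, add_assoc] at this
    rw [Mem.set_comm _ hc.symm, Mem.set_set]
    exact this

variable [Inhabited α]

/-- Move a cell from `x` to `xb`. -/
def moveCell : StackProg (HostAlphabet Γ α) (σ × Option α) :=
  seq (pop (.inr .x) (fun v o => (v.1, o)))
    (ite (fun v => v.2.isSome)
      (seq (push (.inr .xb) fun v => (v.2.getD default : α)) (load fun v => (v.1, none))) skip)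

theorem runLE_moveCell {v : σ} {h : ∀ k, List (Γ k)} {m : Mem α} :
    RunLE A moveCell (v, none) (m.stk h) (v, none) ((m.shift 1).stk h) 4 := by
  refine RunLE.seq (t₁ := 1) (t₂ := 3) (RunLE.pop _ _ rfl rfl) ?_
  rcases hx : m.x with _ | ⟨a, l⟩
  · refine (RunLE.ite_false (t := 1) (by simp [hx]) ?_).mono (by omega)
    refine runLE_skip.of_eq (by simp [hx]) (by simp [hx, Mem.shift]) le_rfl
  · refine (RunLE.ite_true (t := 2) (by simp [hx]) ?_).mono (by omega)
    refine RunLE.seq (RunLE.push _ _ rfl) ?_ (t₁ := 1) (t₂ := 1)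
    exact (RunLE.load _).of_eq rfl (by simp [hx, Mem.shift]) le_rfl

/-- Move all cells back from `xb` to `x`. -/
def rewind : StackProg (HostAlphabet Γ α) (σ × Option α) :=
  loop (.inr .xb) (fun v a => (v.1, some a))
    (seq (push (.inr .x) fun v => (v.2.getD default : α)) (load fun v => (v.1, none)))

theorem runLE_rewind {v : σ} {h : ∀ k, List (Γ k)} {m : Mem α} :
    RunLE A rewind (v, none) (m.stk h) (v, none)
      (({ m with x := m.xb.reverse ++ m.x, xb := [] } : Mem α).stk h) (m.xb.length * 3 + 1) := by
  have := RunLE.loop (A := A) (k := .inr .xb) (f := fun (v : σ × Option α) a => (v.1, some a))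
    (P := seq (push (.inr .x) fun v => (v.2.getD default : α)) (load fun v => (v.1, none)))
    (t := 2) m.xb (fun _ => (v, none))
    (fun i => ({ m with x := (m.xb.take i).reverse ++ m.x, xb := m.xb.drop i } : Mem α).stk h)
    (by simp) ?_
  · simpa [rewind] using this
  · intro i hi
    refine (RunLE.push _ _ rfl).seq ((RunLE.load _).of_eq rfl ?_ le_rfl)
    rw [Mem.update_xb, Mem.update_x, Mem.stk_x]
    refine congrArg _ (Mem.ext ?_ rfl rfl)
    change m.xb[i] :: ((m.xb.take i).reverse ++ m.x) = (m.xb.take (i + 1)).reverse ++ m.x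
    rw [List.take_succ_eq_append_getElem hi, List.reverse_append]
    rfl

/-- Move as many cells from `x` to `xb` as the counter `c` says. -/
def skipCells (c t : Counter) : StackProg (HostAlphabet Γ α) (σ × Option α) :=
  seq (loopCnt c (seq moveCell (push (.inr (.cnt t)) fun _ => ()))) (moveCnt t c)

/-- The loop consumes `c`, so it counts its rounds in `d`, from which `c` is restored; for this `d`
has to be zero at the start. -/
theorem runLE_skipCells {c d : Counter} (hcd : c ≠ d) {v : σ} {h : ∀ k, List (Γ k)} {m : Mem α}
    (hd : m.cnt d = 0) : RunLE A (skipCells c d) (v, none) (m.stk h) (v, none)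
      ((m.shift (m.cnt c)).stk h) (m.cnt c * 8 + 2) := by
  have h₁ := runLE_loopCnt (A := A) (c := c)
    (P := seq moveCell (push (.inr (.cnt d)) fun _ => ())) (t := 5)
    (m.cnt c) (fun _ => v) (fun _ => h)
    (fun i => ((m.shift i).set c (m.cnt c - i)).set d i) ?_ ?_
  · have h₂ := runLE_moveCnt (A := A) hcd.symm (v := v) (h := h)
      (m := ((m.shift (m.cnt c)).set c 0).set d (m.cnt c))
    rw [Nat.sub_zero, Mem.shift_zero, Mem.set_eq_self _ c _ rfl, Mem.set_eq_self _ d _ hd,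
      Nat.sub_self] at h₁
    refine (h₁.seq h₂).of_eq rfl (congrArg _ ?_) ?_
    · refine Mem.ext rfl rfl (funext fun e => ?_)
      by_cases h₁ : e = c <;> by_cases h₂ : e = d <;> simp_all [Mem.set_cnt]
    · simp; omega
  · intro i _
    simp [Mem.set_cnt, hcd]
  · intro i _
    refine (RunLE.seq runLE_moveCell (runLE_pushCnt _)).of_eq rfl (congrArg _ ?_) le_rfl
    rw [Mem.set_comm _ hcd.symm, Mem.set_set]
    simp

end StackProg

/-- Programs that work on an `n × n` array of cells of type `α`, with five index variables that
range over `0, …, n - 1`, a register of type `σ` and an output string. -/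
inductive ArrayProg (σ α : Type) : Type
  | upd (i j : Fin 5) (f : σ → α → σ × α)
  | load (f : σ → σ)
  | emit (f : σ → Bool)
  | seq (P Q : ArrayProg σ α)
  | ite (c : σ → Bool) (P Q : ArrayProg σ α)
  | all (i : Fin 5) (P : ArrayProg σ α)

namespace ArrayProg

variable {σ α : Type}

/-- The semantics of array programs. A state consists of the register, the cells in row-major order,
and the output, with the symbol emitted last in front. -/
def den (n : ℕ) : ArrayProg σ α → (Fin 5 → ℕ) → σ × List α × List Bool → σ × List α × List Bool
  | upd i j f, u, s => (s.2.1[u i * n + u j]?).elim s fun a =>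
      ((f s.1 a).1, s.2.1.set (u i * n + u j) (f s.1 a).2, s.2.2)
  | load f, _, s => (f s.1, s.2)
  | emit f, _, s => (s.1, s.2.1, f s.1 :: s.2.2)
  | seq P Q, u, s => Q.den n u (P.den n u s)
  | ite c P Q, u, s => if c s.1 then P.den n u s else Q.den n u s
  | all i P, u, s => (List.range n).foldl (fun s k => P.den n (Function.update u i k) s) s

theorem length_den (n : ℕ) (P : ArrayProg σ α) (u : Fin 5 → ℕ) (s : σ × List α × List Bool) :
    (P.den n u s).2.1.length = s.2.1.length := by
  induction P generalizing u s with
  | upd i j f =>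
    rw [den]
    cases s.2.1[u i * n + u j]? <;> simp
  | load f => rfl
  | emit f => rfl
  | seq P Q hP hQ => rw [den, hQ, hP]
  | ite c P Q hP hQ => rw [den]; split_ifs <;> simp [hP, hQ]
  | all i P hP =>
    rw [den]
    induction List.range n generalizing s with
    | nil => rfl
    | cons k l ih => rw [List.foldl_cons, ih, hP]

/-- No index variable is used for two nested loops; the variables in `act` are in use. -/
def WF : ArrayProg σ α → Set (Fin 5) → Prop
  | upd _ _ _, _ => True
  | load _, _ => True
  | emit _, _ => True
  | seq P Q, act => P.WF act ∧ Q.WF act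
  | ite _ P Q, act => P.WF act ∧ Q.WF act
  | all i P, act => i ∉ act ∧ P.WF (insert i act)

/-- A bound for the running time. -/
noncomputable def cost : ArrayProg σ α → Polynomial ℕ
  | upd _ _ _ => 20 * (Polynomial.X + 1) ^ 2
  | load _ => 1
  | emit _ => 1
  | seq P Q => P.cost + Q.cost
  | ite _ P Q => P.cost + Q.cost + 1
  | all _ P => Polynomial.X * (P.cost + 9) + 4

variable [Inhabited α] {K : Type} [DecidableEq K] {Γ : K → Type}

open StackProg Counter

/-- The program that applies `f` to the first cell of `x`. -/
def updTop (f : σ → α → σ × α) : StackProg (HostAlphabet Γ α) (σ × Option α) :=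
  .seq (.pop (.inr .x) fun v o => (o.elim v.1 fun a => (f v.1 a).1, o.map fun a => (f v.1 a).2))
    (.ite (fun v => v.2.isSome)
      (.seq (.push (.inr .x) fun v => (v.2.getD default : α)) (.load fun v => (v.1, none))) skip)

/-- The translation of array programs to stack programs. Output is pushed to the stack `kq`. -/
def compile (kq : K) (eq : Γ kq ≃ Bool) :
    ArrayProg σ α → StackProg (HostAlphabet Γ α) (σ × Option α)
  -- The cell with index `i * n + j` is reached by `lo i` moves over `nn` cells each and one move
  -- over `lo j` cells.
  | upd i j f =>
    .seq (.seq (loopCnt (lo i) (.seq (skipCells nn nt) (.push (.inr (.cnt ta)) fun _ => ())))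
      (moveCnt ta (lo i))) (.seq (skipCells (lo j) ta) (.seq (updTop f) rewind))
  | load f => .load fun v => (f v.1, v.2)
  | emit f => .push (.inl kq) fun v => eq.symm (f v.1)
  | seq P Q => .seq (P.compile kq eq) (Q.compile kq eq)
  | ite c P Q => .ite (fun v => c v.1) (P.compile kq eq) (Q.compile kq eq)
  -- `hi i` receives a copy of `nn` and counts down the rounds, while `lo i` counts up and holds the
  -- index. The copy destroys `nn`, which is restored from `ta`.
  | all i P =>
    .seq (loopCnt nn (.seq (.push (.inr (.cnt ta)) fun _ => ())
      (.push (.inr (.cnt (hi i))) fun _ => ())))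
    (.seq (moveCnt ta nn)
    (.seq (loopCnt (hi i) (.seq (P.compile kq eq) (.push (.inr (.cnt (lo i))) fun _ => ())))
      (clearCnt (lo i))))

variable {A : (∀ k, List (HostAlphabet Γ α k)) → ∀ k, List (HostAlphabet Γ α k)}

theorem runLE_updTop (f : σ → α → σ × α) {q : σ} {h : ∀ k, List (Γ k)} {m : Mem α} :
    RunLE A (updTop f) (q, none) (m.stk h) (m.x.head?.elim q fun a => (f q a).1, none)
      (({ m with x := m.x.head?.elim m.x fun a => (f q a).2 :: m.x.tail } : Mem α).stk h) 4 := by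
  refine RunLE.seq (t₁ := 1) (t₂ := 3) (RunLE.pop _ _ rfl rfl) ?_
  rcases hx : m.x with _ | ⟨a, l⟩
  · refine (RunLE.ite_false (t := 1) (by simp [hx]) ?_).mono (by omega)
    refine runLE_skip.of_eq (by simp [hx]) (by simp [hx]) le_rfl
  · refine (RunLE.ite_true (t := 2) (by simp [hx]) ?_).mono (by omega)
    refine RunLE.seq (RunLE.push _ _ rfl) ?_ (t₁ := 1) (t₂ := 1)
    exact (RunLE.load _).of_eq (by simp [hx]) (by simp [hx]) le_rfl

/-- At most `n` rows are skipped at about `8 * n` steps each, and the way back takes three steps for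
each of at most `n * n` cells; the constant 20 leaves room for the lower terms. -/
theorem runLE_upd (kq : K) (eq : Γ kq ≃ Bool) (i j : Fin 5) (f : σ → α → σ × α) {q : σ}
    {h : ∀ k, List (Γ k)} {m : Mem α} {n : ℕ} (hxb : m.xb = []) (hn : m.cnt nn = n)
    (hnt : m.cnt nt = 0) (hta : m.cnt ta = 0) (hi : m.cnt (lo i) ≤ n) (hj : m.cnt (lo j) ≤ n)
    (hx : m.x.length = n * n) (o : List Bool) :
    RunLE A ((upd i j f).compile kq eq) (q, none) (m.stk h)
      (((upd i j f).den n (fun i => m.cnt (lo i)) (q, m.x, o)).1, none)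
      (({ m with x := ((upd i j f).den n (fun i => m.cnt (lo i)) (q, m.x, o)).2.1 } :
        Mem α).stk h) (20 * (n + 1) ^ 2) := by
  have h₁ := runLE_loopCnt (A := A) (c := lo i)
    (P := .seq (skipCells nn nt) (.push (.inr (.cnt ta)) fun _ => ())) (t := 8 * n + 3)
    (m.cnt (lo i)) (fun _ => q) (fun _ => h)
    (fun k => ((m.shift (k * n)).set (lo i) (m.cnt (lo i) - k)).set ta k) ?_ ?_
  rotate_left
  · intro k _
    simp [Mem.set_cnt]
  · intro k _
    refine ((runLE_skipCells (by simp) ?_).seq (runLE_pushCnt _)).of_eq rfl (congrArg _ ?_) ?_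
    · simp [Mem.set_cnt, hnt]
    · refine Mem.ext ?_ ?_ (funext fun e => ?_)
      · simp [Mem.set_cnt, hn, Nat.succ_mul]
      · simp [Mem.set_cnt, hn, Nat.succ_mul]
      · by_cases h₁ : e = lo i <;> by_cases h₂ : e = ta <;> simp_all [Mem.set_cnt]
    · simp [Mem.set_cnt, hn]; omega
  have h₂ := runLE_moveCnt (A := A) (c := ta) (c' := lo i) (by simp) (v := q) (h := h)
    (m := ((m.shift (m.cnt (lo i) * n)).set (lo i) (m.cnt (lo i) - m.cnt (lo i))).set ta
      (m.cnt (lo i)))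
  have h₃ := runLE_skipCells (A := A) (c := lo j) (d := ta) (by simp) (v := q) (h := h)
    (m := m.shift (m.cnt (lo i) * n)) hta
  have e₁ : ((m.shift (0 * n)).set (lo i) (m.cnt (lo i) - 0)).set ta 0 = m := by
    refine Mem.ext ?_ ?_ (funext fun e => ?_)
    · simp
    · simp
    · by_cases h₁ : e = lo i <;> by_cases h₂ : e = ta <;> simp_all [Mem.set_cnt]
  have e₂ : ((((m.shift (m.cnt (lo i) * n)).set (lo i) (m.cnt (lo i) - m.cnt (lo i))).set ta
      (m.cnt (lo i))).set ta 0).set (lo i)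
      ((((m.shift (m.cnt (lo i) * n)).set (lo i) (m.cnt (lo i) - m.cnt (lo i))).set ta
      (m.cnt (lo i))).cnt (lo i) + (((m.shift (m.cnt (lo i) * n)).set (lo i)
      (m.cnt (lo i) - m.cnt (lo i))).set ta (m.cnt (lo i))).cnt ta) =
      m.shift (m.cnt (lo i) * n) := by
    refine Mem.ext rfl rfl (funext fun e => ?_)
    by_cases h₁ : e = lo i <;> by_cases h₂ : e = ta <;> simp_all [Mem.set_cnt]
  rw [e₁] at h₁
  rw [e₂] at h₂
  rw [Mem.shift_shift, Mem.shift_cnt] at h₃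
  refine ((h₁.seq h₂).seq (h₃.seq ((runLE_updTop f).seq runLE_rewind))).of_eq ?_
    (congrArg _ ?_) ?_
  · simp only [Mem.shift, den, List.head?_drop]
    cases m.x[m.cnt (lo i) * n + m.cnt (lo j)]? <;> rfl
  · refine Mem.ext ?_ ?_ rfl
    · simp only [Mem.shift, den, List.head?_drop, hxb, List.append_nil, List.reverse_reverse]
      rcases ha : m.x[m.cnt (lo i) * n + m.cnt (lo j)]? with _ | a
      · simp
      · have hlt := (List.getElem?_eq_some_iff.1 ha).1
        simp [List.set_eq_take_append_cons_drop, hlt]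
    · exact hxb.symm
  · have : ((m.shift (m.cnt (lo i) * n + m.cnt (lo j))).xb).length ≤ n * n := by
      simp [Mem.shift, hxb, hx]
    simp only [Mem.set_cnt_self]
    nlinarith

/-- Induction with the invariant that between programs the cells are rewound, the temporary counters
are zero, and both counters of an inactive index are zero. Well-formedness is what guarantees that a
loop finds its own two counters at zero and that its body leaves them alone. -/
theorem runLE_compile (kq : K) (eq : Γ kq ≃ Bool) (P : ArrayProg σ α) {q : σ}
    {h : ∀ k, List (Γ k)} {m : Mem α} {n : ℕ} (act : Set (Fin 5)) (hP : P.WF act) (hxb : m.xb = [])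
    (hn : m.cnt nn = n) (hnt : m.cnt nt = 0) (hta : m.cnt ta = 0)
    (hact : ∀ i ∉ act, m.cnt (lo i) = 0 ∧ m.cnt (hi i) = 0)
    (hlo : ∀ i, m.cnt (lo i) ≤ n) (hx : m.x.length = n * n) (o : List Bool) :
    RunLE A (P.compile kq eq) (q, none) (m.stk (Function.update h kq (o.map eq.symm)))
      ((P.den n (fun i => m.cnt (lo i)) (q, m.x, o)).1, none)
      (({ m with x := (P.den n (fun i => m.cnt (lo i)) (q, m.x, o)).2.1 } : Mem α).stk
        (Function.update h kq ((P.den n (fun i => m.cnt (lo i)) (q, m.x, o)).2.2.map eq.symm)))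
      (P.cost.eval n) := by
  induction P generalizing q m act o with
  | upd i j f =>
    refine (runLE_upd kq eq i j f hxb hn hnt hta (hlo i) (hlo j) hx o).of_eq rfl ?_ ?_
    · have : ((upd i j f).den n (fun i => m.cnt (lo i)) (q, m.x, o)).2.2 = o := by
        simp only [den]
        cases m.x[m.cnt (lo i) * n + m.cnt (lo j)]? <;> rfl
      rw [this]
    · simp [cost]
  | load f => simpa [cost, compile, den] using RunLE.load _
  | emit f =>
    refine (RunLE.push _ _ rfl).of_eq rfl ?_ (by simp [cost])
    simp [den]
  | seq P Q ihP ihQ =>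
    have h₁ := ihP act hP.1 hxb hn hnt hta hact hlo hx o (q := q)
    have h₂ := ihQ act hP.2 (q := (P.den n (fun i => m.cnt (lo i)) (q, m.x, o)).1)
      (m := { m with x := (P.den n (fun i => m.cnt (lo i)) (q, m.x, o)).2.1 }) hxb hn hnt hta hact
      hlo (by rw [length_den]; exact hx) (P.den n (fun i => m.cnt (lo i)) (q, m.x, o)).2.2
    refine (h₁.seq h₂).of_eq rfl rfl ?_
    simp [cost]
  | ite c P Q ihP ihQ =>
    rcases hc : c q
    · refine (RunLE.ite_false (v := (q, none)) hc (ihQ act hP.2 hxb hn hnt hta hact hlo hx o)).of_eq ?_ ?_ ?_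
      · simp [den, hc]
      · simp [den, hc]
      · simp [cost]
    · refine (RunLE.ite_true (v := (q, none)) hc (ihP act hP.1 hxb hn hnt hta hact hlo hx o)).of_eq ?_ ?_ ?_
      · simp [den, hc]
      · simp [den, hc]
      · simp [cost]
  | all i P ih =>
    obtain ⟨hi₁, hP⟩ := hP
    obtain ⟨hlo₀, hhi₀⟩ := hact i hi₁
    set u : Fin 5 → ℕ := fun i => m.cnt (lo i) with hu
    set s : ℕ → σ × List α × List Bool := fun k =>
      (List.range k).foldl (fun s k => P.den n (Function.update u i k) s) (q, m.x, o) with hs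
    have hs₁ : ∀ k, s (k + 1) = P.den n (Function.update u i k) (s k) := fun k => by
      simp [hs, List.range_succ]
    have hlen : ∀ k, (s k).2.1.length = n * n := fun k => by
      induction k with
      | zero => exact hx
      | succ k ih => rw [hs₁, length_den, ih]
    set H : ℕ → ∀ k, List (Γ k) := fun k => Function.update h kq ((s k).2.2.map eq.symm) with hH
    -- The memory before round `k` of the loop.
    set M : ℕ → Mem α := fun k =>
      ({ m with x := (s k).2.1 }.set (hi i) (n - k)).set (lo i) k with hM
    have h₁ := runLE_loopCnt (A := A) (c := nn) (P := .seq (.push (.inr (.cnt ta)) fun _ => ())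
      (.push (.inr (.cnt (hi i))) fun _ => ())) (t := 2) n (fun _ => q) (fun _ => H 0)
      (fun k => ((m.set nn (n - k)).set ta k).set (hi i) k) ?_ ?_
    rotate_left
    · intro k _
      simp [Mem.set_cnt]
    · intro k _
      refine ((runLE_pushCnt _).seq (runLE_pushCnt _)).of_eq rfl (congrArg _ ?_) le_rfl
      refine Mem.ext rfl rfl (funext fun e => ?_)
      by_cases h₁ : e = nn <;> by_cases h₂ : e = ta <;> by_cases h₃ : e = hi i <;>
        simp_all [Mem.set_cnt]
    have h₂ := runLE_moveCnt (A := A) (c := ta) (c' := nn) (by simp) (v := q) (h := H 0)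
      (m := ((m.set nn (n - n)).set ta n).set (hi i) n)
    have h₃ := runLE_loopCnt (A := A) (c := hi i)
      (P := .seq (P.compile kq eq) (.push (.inr (.cnt (lo i))) fun _ => ()))
      (t := P.cost.eval n + 1) n (fun k => (s k).1) H M ?_ ?_
    rotate_left
    · intro k _
      simp [hM, Mem.set_cnt]
    · intro k hk
      have h₁ := ih (insert i act) hP (q := (s k).1) (m := (M k).set (hi i) (n - (k + 1))) hxb
        ?_ ?_ ?_ ?_ ?_ (hlen k) (s k).2.2
      · refine (h₁.seq (runLE_pushCnt _)).of_eq ?_ ?_ le_rfl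
        all_goals
          have e : (fun j => ((M k).set (hi i) (n - (k + 1))).cnt (lo j)) =
              Function.update u i k := by
            funext j
            by_cases hj : j = i <;> simp [hj, hM, Mem.set_cnt, hu]
          rw [e]
          simp only [Mem.set_x]
          change _ = _
          have e₂ : P.den n (Function.update u i k) ((s k).1, (M k).x, (s k).2.2) = s (k + 1) :=
            (hs₁ k).symm
          rw [e₂]
        rw [hH]
        refine congrArg _ (Mem.ext rfl rfl (funext fun e => ?_))
        by_cases h₁ : e = lo i <;> by_cases h₂ : e = hi i <;> simp_all [Mem.set_cnt]
      · simp [hM, Mem.set_cnt, hn]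
      · simp [hM, Mem.set_cnt, hnt]
      · simp [hM, Mem.set_cnt, hta]
      · intro j hj
        rw [Set.mem_insert_iff, not_or] at hj
        simpa [hM, Mem.set_cnt, hj.1] using hact j hj.2
      · intro j
        simp only [hM, Mem.set_cnt]
        split_ifs <;> first | omega | exact hlo j
    have h₄ := runLE_clearCnt (A := A) (lo i) (v := (s n).1) (h := H n) (m := M n)
    have e₁ : ((m.set nn (n - 0)).set ta 0).set (hi i) 0 = m := by
      refine Mem.ext rfl rfl (funext fun e => ?_)
      rcases e with _ | _ | _ | j | j
      case lo | hi => by_cases hj : j = i <;> simp [Mem.set_cnt, hlo₀, hhi₀, hj]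
      all_goals simp [Mem.set_cnt, hn, hta]
    have e₂ : ((((m.set nn (n - n)).set ta n).set (hi i) n).set ta 0).set nn
        ((((m.set nn (n - n)).set ta n).set (hi i) n).cnt nn +
          (((m.set nn (n - n)).set ta n).set (hi i) n).cnt ta) = M 0 := by
      refine Mem.ext rfl rfl (funext fun e => ?_)
      rcases e with _ | _ | _ | j | j
      case lo | hi => by_cases hj : j = i <;> simp [Mem.set_cnt, hM, hlo₀, hj]
      all_goals simp [Mem.set_cnt, hM, hn, hta]
    have e₃ : (M n).set (lo i) 0 = { m with x := (s n).2.1 } := by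
      refine Mem.ext rfl rfl (funext fun e => ?_)
      rcases e with _ | _ | _ | j | j
      case lo | hi => by_cases hj : j = i <;> simp [Mem.set_cnt, hM, hlo₀, hhi₀, hj]
      all_goals simp [Mem.set_cnt, hM, hn, hta]
    rw [e₁] at h₁
    rw [e₂] at h₂
    rw [e₃] at h₄
    refine (h₁.seq (h₂.seq (h₃.seq h₄))).of_eq rfl rfl ?_
    simp only [cost, Polynomial.eval_add, Polynomial.eval_mul, Polynomial.eval_X,
      Polynomial.eval_ofNat]
    have : (M n).cnt (lo i) = n := by simp [hM]
    rw [this]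
    simp [Mem.set_cnt]
    nlinarith

end ArrayProg

/-! ### Reading graph codes, and subroutines that leave no trace -/

namespace Mem

/-- The memory in which all stacks are empty. -/
def empty (α : Type) : Mem α := ⟨[], [], fun _ => 0⟩

/-- The first `k` entries of a list that is continued by the element `d`. -/
def padded {α : Type} (d : α) (l : List α) (k : ℕ) : List α :=
  (List.range k).map fun a => l[a]?.getD d

/-- The cells that represent the graph with code `w`. -/
def cells {α : Type} (ini : Bool → α) (w : List Bool) : List α :=
  padded (ini false) ((w.drop (LoopGraph.codeSize w + 1)).map ini)
    (LoopGraph.codeSize w * LoopGraph.codeSize w)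

/-- The memory that represents the graph with code `w`. -/
def init {α : Type} (ini : Bool → α) (w : List Bool) : Mem α :=
  { x := cells ini w, xb := [], cnt := Function.update (fun _ => 0) .nn (LoopGraph.codeSize w) }

theorem padded_succ {α : Type} (d : α) (l : List α) (k : ℕ) :
    padded d l (k + 1) = padded d l k ++ [l[k]?.getD d] := by
  simp [padded, List.range_succ]

@[simp] theorem length_padded {α : Type} (d : α) (l : List α) (k : ℕ) :
    (padded d l k).length = k := by
  simp [padded]

@[simp] theorem length_cells {α : Type} (ini : Bool → α) (w : List Bool) :
    (cells ini w).length = LoopGraph.codeSize w * LoopGraph.codeSize w := by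
  simp [cells]

end Mem

namespace StackProg

open Counter

theorem codeSize_le (w : List Bool) : LoopGraph.codeSize w ≤ w.length :=
  (List.takeWhile_prefix _).length_le

variable {α : Type} {K : Type} [DecidableEq K] {Γ : K → Type} {σ : Type}
  {A : (∀ k, List (HostAlphabet Γ α k)) → ∀ k, List (HostAlphabet Γ α k)}

/-- Empty a stack of the host. -/
def clearHost (k : K) : StackProg (HostAlphabet Γ α) (σ × Option α) :=
  loop (.inl k) (fun v _ => v) skip

theorem runLE_clearHost (k : K) {v : σ} {h : ∀ k, List (Γ k)} {m : Mem α} :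
    RunLE A (clearHost k) (v, none) (m.stk h) (v, none) (m.stk (Function.update h k []))
      ((h k).length * 2 + 1) := by
  have := RunLE.loop (A := A) (k := .inl k) (f := fun (v : σ × Option α) _ => v) (P := skip)
    (t := 1) (h k) (fun _ => (v, none)) (fun i => m.stk (Function.update h k ((h k).drop i)))
    (by simp) ?_
  · simpa [clearHost] using this
  · intro i hi
    simpa using runLE_skip

/-- Empty the stack `x`. -/
def clearCells : StackProg (HostAlphabet Γ α) (σ × Option α) :=
  loop (.inr .x) (fun v _ => v) skip

theorem runLE_clearCells {v : σ} {h : ∀ k, List (Γ k)} {m : Mem α} :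
    RunLE A clearCells (v, none) (m.stk h) (v, none) (({ m with x := [] } : Mem α).stk h)
      (m.x.length * 2 + 1) := by
  have := RunLE.loop (A := A) (k := .inr .x) (f := fun (v : σ × Option α) _ => v) (P := skip)
    (t := 1) m.x (fun _ => (v, none)) (fun i => ({ m with x := m.x.drop i } : Mem α).stk h)
    (by simp) ?_
  · simpa [clearCells] using this
  · intro i hi
    simpa using runLE_skip

/-- Push the first `k` symbols of the string `f v` to the stack `ka` of the host. -/
def pushString (ka : K) (eqa : Γ ka ≃ Bool) (f : σ → List Bool) :
    ℕ → StackProg (HostAlphabet Γ α) (σ × Option α)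
  | 0 => skip
  | k + 1 => seq (ite (fun v => decide (k < (f v.1).length))
      (push (.inl ka) fun v => eqa.symm ((f v.1).getD k false)) skip) (pushString ka eqa f k)

/-- Pushing from the last position down to the first leaves the head of the string on top. The
string depends on the register, so positions beyond its end are skipped at run time. -/
theorem runLE_pushString (ka : K) (eqa : Γ ka ≃ Bool) (f : σ → List Bool) (k : ℕ) {v : σ}
    {h : ∀ k, List (Γ k)} {m : Mem α} :
    RunLE A (pushString ka eqa f k) (v, none)
      (m.stk (Function.update h ka (((f v).drop k).map eqa.symm))) (v, none)
      (m.stk (Function.update h ka ((f v).map eqa.symm))) (2 * k + 1) := by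
  induction k with
  | zero => exact runLE_skip
  | succ k ih =>
    refine (RunLE.seq (t₁ := 2) ?_ ih).mono (by omega)
    by_cases hk : k < (f v).length
    · refine RunLE.ite_true (by simp [hk]) ((RunLE.push _ _ rfl).of_eq rfl ?_ le_rfl)
      rw [List.drop_eq_getElem_cons hk, List.map_cons, Mem.update_inl, Mem.stk_inl,
        Function.update_self, Function.update_idem, List.getD_eq_getElem _ _ hk]
    · refine RunLE.ite_false (by simp [hk]) (runLE_skip.of_eq rfl ?_ le_rfl)
      rw [List.drop_eq_nil_of_le (by omega), List.drop_eq_nil_of_le (by omega)]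

variable [Inhabited α]

/-- Move the remaining input to the cells. -/
def readBits (kq : K) (eq : Γ kq ≃ Bool) (ini : Bool → α) :
    StackProg (HostAlphabet Γ α) (σ × Option α) :=
  loop (.inl kq) (fun v b => (v.1, some (ini (eq b))))
    (seq (push (.inr .xb) fun v => (v.2.getD default : α)) (load fun v => (v.1, none)))

theorem runLE_readBits (kq : K) (eq : Γ kq ≃ Bool) (ini : Bool → α) (l : List Bool) {v : σ}
    {h : ∀ k, List (Γ k)} {m : Mem α} :
    RunLE A (readBits kq eq ini) (v, none) (m.stk (Function.update h kq (l.map eq.symm))) (v, none)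
      (({ m with xb := (l.map ini).reverse ++ m.xb } : Mem α).stk (Function.update h kq []))
      (l.length * 3 + 1) := by
  have := RunLE.loop (A := A) (k := .inl kq)
    (f := fun (v : σ × Option α) b => (v.1, some (ini (eq b))))
    (P := seq (push (.inr .xb) fun v => (v.2.getD default : α)) (load fun v => (v.1, none)))
    (t := 2) (l.map eq.symm) (fun _ => (v, none))
    (fun i => ({ m with xb := ((l.take i).map ini).reverse ++ m.xb } : Mem α).stk
      (Function.update h kq ((l.map eq.symm).drop i))) (by simp) ?_
  · rw [List.drop_length] at this
    simpa [readBits] using this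
  · intro i hi
    rw [List.length_map] at hi
    refine (RunLE.push _ _ rfl).seq ((RunLE.load _).of_eq rfl ?_ le_rfl)
    rw [Mem.update_inl, Mem.update_xb, Mem.stk_xb, Function.update_idem]
    refine congrArg _ (Mem.ext rfl ?_ rfl)
    change ini (eq (l.map eq.symm)[i]) :: _ = _
    rw [List.take_succ_eq_append_getElem hi, List.map_append, List.reverse_append]
    simp

/-- Read the code of a graph: the counter `nn` gets the number of vertices, and `xb` the bits. -/
def readCode (kq : K) (eq : Γ kq ≃ Bool) (ini : Bool → α) :
    StackProg (HostAlphabet Γ α) (σ × Option α) :=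
  loop (.inl kq) (fun v b => (v.1, if eq b then some default else none))
    (ite (fun v => v.2.isSome)
      (seq (push (.inr (.cnt nn)) fun _ => ()) (load fun v => (v.1, none))) (readBits kq eq ini))

/-- At the first zero the inner loop consumes the rest of the input, so the outer loop then finds an
empty stack and ends. A string without a zero is read entirely as the size and yields no bits. -/
theorem runLE_readCode (kq : K) (eq : Γ kq ≃ Bool) (ini : Bool → α) (w : List Bool) {v : σ}
    {h : ∀ k, List (Γ k)} {m : Mem α} (hxb : m.xb = []) :
    RunLE A (readCode kq eq ini) (v, none) (m.stk (Function.update h kq (w.map eq.symm))) (v, none)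
      (({ m with xb := ((w.drop (LoopGraph.codeSize w + 1)).map ini).reverse }.set nn
        (m.cnt nn + LoopGraph.codeSize w)).stk (Function.update h kq [])) (w.length * 4 + 5) := by
  induction w generalizing m with
  | nil =>
    refine (RunLE.loop_nil (by simp)).of_eq rfl (congrArg₂ _ rfl ?_) (by omega)
    refine Mem.ext rfl (by simp [hxb]) (by simp [LoopGraph.codeSize, Mem.set])
  | cons b w ih =>
    set S := m.stk (Function.update h kq ((b :: w).map eq.symm)) with hS
    have hS₁ : S (.inl kq) = eq.symm b :: w.map eq.symm := by simp [hS]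
    have hS₂ : Function.update S (.inl kq) (w.map eq.symm) =
        m.stk (Function.update h kq (w.map eq.symm)) := by simp [hS]
    rcases b with _ | _
    · refine (RunLE.loop_cons (t₁ := (w.length * 3 + 1) + 1) (t₂ := 1) hS₁ ?_
        (RunLE.loop_nil (by simp))).of_eq rfl (congrArg₂ _ rfl ?_) ?_
        (S₁ := ({ m with xb := (w.map ini).reverse ++ m.xb } : Mem α).stk (Function.update h kq []))
      · rw [hS₂, eq.apply_symm_apply]
        exact RunLE.ite_false rfl (runLE_readBits kq eq ini w)
      · refine Mem.ext rfl ?_ ?_ <;> simp [LoopGraph.codeSize, Mem.set, hxb]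
      · simp; omega
    · refine (RunLE.loop_cons (t₁ := 3) hS₁ ?_ (ih (m := m.set nn (m.cnt nn + 1)) hxb)).of_eq rfl
        (congrArg₂ _ rfl ?_) ?_
      · rw [hS₂, eq.apply_symm_apply]
        exact RunLE.ite_true rfl ((runLE_pushCnt nn).seq (RunLE.load _))
      · refine Mem.ext rfl ?_ ?_
        · simp [LoopGraph.codeSize]
        · simp [LoopGraph.codeSize, Mem.set, add_assoc, add_comm]
      · simp; omega

/-- Move a cell from `x` to `xb`; take the cell `d` if there is none. -/
def pullCell (d : α) : StackProg (HostAlphabet Γ α) (σ × Option α) :=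
  seq (pop (.inr .x) (fun v o => (v.1, some (o.getD d))))
    (seq (push (.inr .xb) fun v => (v.2.getD default : α)) (load fun v => (v.1, none)))

theorem runLE_pullCell (d : α) {v : σ} {h : ∀ k, List (Γ k)} {m : Mem α} :
    RunLE A (pullCell d) (v, none) (m.stk h) (v, none)
      (({ m with x := m.x.tail, xb := m.x.head?.getD d :: m.xb } : Mem α).stk h) 3 := by
  refine (RunLE.pop _ _ rfl rfl).seq
    ((RunLE.push _ _ rfl).seq ((RunLE.load _).of_eq rfl ?_ le_rfl) (t₁ := 1) (t₂ := 1))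
  rw [Mem.update_x, Mem.update_xb]
  rfl

/-- Replace the list `x` by its first `n ^ 2` entries, where `n` is the counter `nn`; the list is
continued by `d`. -/
def padCells (d : α) : StackProg (HostAlphabet Γ α) (σ × Option α) :=
  seq (loopCnt nn (seq (push (.inr (.cnt ta)) fun _ => ()) (push (.inr (.cnt nt)) fun _ => ())))
  (seq (moveCnt ta nn)
  (seq (loopCnt nt
    (seq (loopCnt nn (seq (pullCell d) (push (.inr (.cnt ta)) fun _ => ()))) (moveCnt ta nn)))
  (seq clearCells rewind)))

/-- No counter holds `n * n`, so the cells are pulled in two nested loops: `nt` counts the outer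
rounds, and `nn` is used up and restored through `ta` in each of them. What then remains on `x` is
surplus and is erased before rewinding. -/
theorem runLE_padCells (d : α) {v : σ} {h : ∀ k, List (Γ k)} {m : Mem α} {n : ℕ}
    (hxb : m.xb = []) (hn : m.cnt nn = n) (hta : m.cnt ta = 0) (hnt : m.cnt nt = 0) :
    RunLE A (padCells d) (v, none) (m.stk h) (v, none)
      (({ m with x := Mem.padded d m.x (n * n) } : Mem α).stk h)
      (10 * (n + 1) ^ 2 + m.x.length * 2) := by
  have h₁ := runLE_loopCnt (A := A) (c := nn) (P := .seq (.push (.inr (.cnt ta)) fun _ => ())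
    (.push (.inr (.cnt nt)) fun _ => ())) (t := 2) n (fun _ => v) (fun _ => h)
    (fun k => ((m.set nn (n - k)).set ta k).set nt k) ?_ ?_
  rotate_left
  · intro k _
    simp [Mem.set_cnt]
  · intro k _
    refine ((runLE_pushCnt _).seq (runLE_pushCnt _)).of_eq rfl (congrArg _ ?_) le_rfl
    refine Mem.ext rfl rfl (funext fun e => ?_)
    cases e <;> simp [Mem.set_cnt]
  have h₂ := runLE_moveCnt (A := A) (c := ta) (c' := nn) (by simp) (v := v) (h := h)
    (m := ((m.set nn (n - n)).set ta n).set nt n)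
  set M : ℕ → Mem α := fun k =>
    { m with x := m.x.drop k, xb := (Mem.padded d m.x k).reverse } with hM
  have hM₁ : ∀ k, (M k).x.tail = (M (k + 1)).x := fun k => by simp [hM]
  have hM₂ : ∀ k, (M k).x.head?.getD d :: (M k).xb = (M (k + 1)).xb := fun k => by
    simp [hM, Mem.padded_succ]
  have hM₃ : ∀ k, (M k).cnt = m.cnt := fun k => rfl
  have h₃ := runLE_loopCnt (A := A) (c := nt)
    (P := seq (loopCnt nn (seq (pullCell d) (push (.inr (.cnt ta)) fun _ => ()))) (moveCnt ta nn))
    (t := 7 * n + 2) n (fun _ => v) (fun _ => h) (fun i => (M (i * n)).set nt (n - i)) ?_ ?_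
  rotate_left
  · intro k _
    simp
  · intro k _
    have g₁ := runLE_loopCnt (A := A) (c := nn)
      (P := seq (pullCell d) (push (.inr (.cnt ta)) fun _ => ())) (t := 4) n (fun _ => v)
      (fun _ => h) (fun j => (((M (k * n + j)).set nt (n - (k + 1))).set nn (n - j)).set ta j) ?_ ?_
    rotate_left
    · intro j _
      simp [Mem.set_cnt]
    · intro j _
      refine ((runLE_pullCell d).seq (runLE_pushCnt _)).of_eq rfl (congrArg _ ?_) le_rfl
      refine Mem.ext (hM₁ (k * n + j)) (hM₂ (k * n + j)) (funext fun e => ?_)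
      cases e <;> simp [Mem.set, hM₃]
    have g₂ := runLE_moveCnt (A := A) (c := ta) (c' := nn) (by simp) (v := v) (h := h)
      (m := (((M (k * n + n)).set nt (n - (k + 1))).set nn (n - n)).set ta n)
    have e₁ : (((M (k * n + 0)).set nt (n - (k + 1))).set nn (n - 0)).set ta 0 =
        ((M (k * n)).set nt (n - k)).set nt (n - (k + 1)) := by
      refine Mem.ext rfl rfl (funext fun e => ?_)
      cases e <;> simp [Mem.set_cnt, hM₃, hn, hta]
    rw [e₁] at g₁
    refine (g₁.seq g₂).of_eq rfl (congrArg _ ?_) ?_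
    · rw [← Nat.succ_mul]
      refine Mem.ext rfl rfl (funext fun e => ?_)
      cases e <;> simp [Mem.set_cnt, hM₃, hn, hta]
    · simp only [Mem.set_cnt_self]; omega
  have h₄ := runLE_clearCells (A := A) (v := v) (h := h) (m := (M (n * n)).set nt (n - n))
  have h₅ := runLE_rewind (A := A) (v := v) (h := h)
    (m := { (M (n * n)).set nt (n - n) with x := [] })
  have e₁ : ((m.set nn (n - 0)).set ta 0).set nt 0 = m := by
    refine Mem.ext rfl rfl (funext fun e => ?_)
    cases e <;> simp [Mem.set_cnt, hn, hta, hnt]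
  have e₂ : ((((m.set nn (n - n)).set ta n).set nt n).set ta 0).set nn
      ((((m.set nn (n - n)).set ta n).set nt n).cnt nn +
        (((m.set nn (n - n)).set ta n).set nt n).cnt ta) = (M (0 * n)).set nt (n - 0) := by
    refine Mem.ext ?_ ?_ (funext fun e => ?_)
    · simp [hM]
    · simp [hM, hxb, Mem.padded]
    · cases e <;> simp [Mem.set_cnt, hM₃, hn, hta]
  rw [e₁] at h₁
  rw [e₂] at h₂
  refine (h₁.seq (h₂.seq (h₃.seq (h₄.seq h₅)))).of_eq rfl (congrArg _ ?_) ?_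
  · refine Mem.ext ?_ ?_ (funext fun e => ?_)
    · simp [hM]
    · simp [hxb]
    · cases e <;> simp [Mem.set_cnt, hM₃, hnt]
  · have : ((M (n * n)).set nt (n - n)).x.length ≤ m.x.length := by simp [hM]
    simp [Mem.set_cnt] at this ⊢
    have h₆ : (M (n * n)).xb.length = n * n := by simp [hM]
    rw [h₆]
    nlinarith

/-- Read the graph whose code is on the stack `kq` of the host. -/
def parse (kq : K) (eq : Γ kq ≃ Bool) (ini : Bool → α) :
    StackProg (HostAlphabet Γ α) (σ × Option α) :=
  seq (readCode kq eq ini) (seq rewind (padCells (ini false)))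

theorem runLE_parse (kq : K) (eq : Γ kq ≃ Bool) (ini : Bool → α) (w : List Bool) {v : σ}
    {h : ∀ k, List (Γ k)} :
    RunLE A (parse kq eq ini) (v, none)
      ((Mem.empty α).stk (Function.update h kq (w.map eq.symm))) (v, none)
      ((Mem.init ini w).stk (Function.update h kq [])) (40 * (w.length + 1) ^ 2) := by
  have h₁ := runLE_readCode (A := A) kq eq ini w (v := v) (h := h) (m := Mem.empty α) rfl
  have h₂ := runLE_rewind (A := A) (v := v) (h := Function.update h kq [])
    (m := ({ Mem.empty α with xb := ((w.drop (LoopGraph.codeSize w + 1)).map ini).reverse }.set nn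
      ((Mem.empty α).cnt nn + LoopGraph.codeSize w)))
  have h₃ := runLE_padCells (A := A) (ini false) (v := v) (h := Function.update h kq [])
    (m := ({ Mem.empty α with x := ((w.drop (LoopGraph.codeSize w + 1)).map ini) }.set nn
      (LoopGraph.codeSize w))) (n := LoopGraph.codeSize w) rfl (by simp) (by simp [Mem.set, Mem.empty])
    (by simp [Mem.set, Mem.empty])
  refine (h₁.seq ((h₂.of_eq rfl (congrArg _ ?_) le_rfl).seq h₃)).of_eq rfl (congrArg _ ?_) ?_
  · refine Mem.ext ?_ rfl ?_ <;> simp [Mem.empty, Mem.set]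
  · refine Mem.ext ?_ rfl rfl
    simp [Mem.init, Mem.cells]
  · have h₁ := Nat.pow_le_pow_left (Nat.succ_le_succ (codeSize_le w)) 2
    have h₂ := Nat.le_self_pow (two_ne_zero) (w.length + 1)
    simp only [Nat.succ_eq_add_one] at h₁
    generalize (w.length + 1) ^ 2 = a at h₁ h₂ ⊢
    generalize (LoopGraph.codeSize w + 1) ^ 2 = b at h₁ h₂ ⊢
    simp
    omega

/-- The program that reads a graph from the stack `kq`, runs `body`, clears the memory, writes the
result to the stack `ka`, and restores the register. -/
def subroutine (kq ka : K) (eq : Γ kq ≃ Bool) (eqa : Γ ka ≃ Bool) (ini : Bool → α)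
    (body : StackProg (HostAlphabet Γ α) (σ × Option α)) (v₀ : σ) (f : σ → List Bool) (L : ℕ) :
    StackProg (HostAlphabet Γ α) (σ × Option α) :=
  seq (parse kq eq ini) (seq (clearHost ka) (seq body (seq clearCells (seq (clearCnt nn)
    (seq (pushString ka eqa f L) (load fun _ => (v₀, none)))))))

/-- The memory and the register end as they began, so the subroutine can be called any number of
times by a host that knows nothing about it. -/
theorem runLE_subroutine (kq ka : K) (eq : Γ kq ≃ Bool) (eqa : Γ ka ≃ Bool) (ini : Bool → α)
    {body : StackProg (HostAlphabet Γ α) (σ × Option α)} (v₀ : σ) (f : σ → List Bool) {L : ℕ}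
    (w : List Bool) {h : ∀ k, List (Γ k)} (hw : h kq = w.map eq.symm) {v : σ} {x : List α} {T : ℕ}
    (hx : x.length = LoopGraph.codeSize w * LoopGraph.codeSize w) (hL : (f v).length ≤ L)
    (hbody : ∀ h : ∀ k, List (Γ k), h kq = [] → h ka = [] →
      RunLE A body (v₀, none) ((Mem.init ini w).stk h) (v, none)
        (({ Mem.init ini w with x := x } : Mem α).stk h) T) :
    RunLE A (subroutine kq ka eq eqa ini body v₀ f L) (v₀, none) ((Mem.empty α).stk h)
      (v₀, none) ((Mem.empty α).stk
        (Function.update (Function.update h kq []) ka ((f v).map eqa.symm)))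
      (T + (2 * L + 2 * (h ka).length + 60 * (w.length + 1) ^ 2)) := by
  have h₁ := runLE_parse (A := A) kq eq ini w (v := v₀) (h := h)
  rw [← hw, Function.update_eq_self] at h₁
  have h₂ := runLE_clearHost (A := A) ka (v := v₀) (h := Function.update h kq [])
    (m := Mem.init ini w)
  set H := Function.update (Function.update h kq []) ka [] with hH
  -- The host may use the same stack for the query and the answer, so `ka = kq` is not excluded.
  have hka : ((Function.update h kq []) ka).length ≤ (h ka).length := by
    by_cases hk : ka = kq
    · subst hk; simp
    · simp [hk]
  have hq : H kq = [] := by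
    rcases eq_or_ne kq ka with hk | hk
    · subst hk; simp [hH]
    · simp [hH, hk]
  have h₃ := hbody H hq (by simp [hH])
  have h₄ := runLE_clearCells (A := A) (v := v) (h := H) (m := { Mem.init ini w with x := x })
  have h₅ := runLE_clearCnt (A := A) nn (v := v) (h := H) (m := { Mem.init ini w with x := [] })
  have h₆ := runLE_pushString (A := A) ka eqa f L (v := v) (h := H) (m := Mem.empty α)
  rw [List.drop_eq_nil_of_le hL, List.map_nil,
    show Function.update H ka [] = H by simp [hH]] at h₆
  refine (h₁.seq (h₂.seq (h₃.seq (h₄.seq ((h₅.of_eq rfl (congrArg _ ?_) le_rfl).seq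
    (h₆.seq (RunLE.load _))))))).of_eq rfl ?_ ?_
  · refine Mem.ext rfl rfl (funext fun e => ?_)
    cases e <;> simp [Mem.set, Mem.init, Mem.empty]
  · simp [hH]
  · have h₁ := Nat.pow_le_pow_left (Nat.succ_le_succ (codeSize_le w)) 2
    have h₂ := Nat.le_self_pow (two_ne_zero) (w.length + 1)
    have h₃ : LoopGraph.codeSize w * LoopGraph.codeSize w + 2 * LoopGraph.codeSize w + 1 =
      (LoopGraph.codeSize w + 1) ^ 2 := by ring
    simp only [Nat.succ_eq_add_one] at h₁
    have h₄ : (Mem.init ini w).cnt nn = LoopGraph.codeSize w := by simp [Mem.init]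
    simp only [hx, h₄]
    generalize LoopGraph.codeSize w * LoopGraph.codeSize w = c at *
    generalize (w.length + 1) ^ 2 = a at h₁ h₂ ⊢
    generalize (LoopGraph.codeSize w + 1) ^ 2 = b at h₁ h₂ h₃ ⊢
    omega

/-! ### Oracle queries -/

/-- Run an array program, use its output as an oracle query, and read the answer. -/
def queryRound (kq ka : K) (eq : Γ kq ≃ Bool) (eqa : Γ ka ≃ Bool) (rd : σ → Bool → σ)
    (P : ArrayProg σ α) : StackProg (HostAlphabet Γ α) (σ × Option α) :=
  seq (P.compile kq eq) (seq ask (loop (.inl ka) (fun v b => (rd v.1 (eqa b), v.2)) skip))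

/-- The semantics of a query round on a register and an array of cells. -/
def queryDen (O : List Bool → List Bool) (rd : σ → Bool → σ) (n : ℕ) (P : ArrayProg σ α)
    (s : σ × List α) : σ × List α :=
  let r := P.den n (fun _ => 0) (s.1, s.2, [])
  ((O r.2.2).foldl rd r.1, r.2.1)

/-- The action of an oracle on the stacks of a host machine. -/
def oracleAct (kq ka : K) (eq : Γ kq ≃ Bool) (eqa : Γ ka ≃ Bool) (O : List Bool → List Bool)
    (S : ∀ k, List (HostAlphabet Γ α k)) : ∀ k, List (HostAlphabet Γ α k) :=
  Function.update (Function.update S (.inl kq) []) (.inl ka)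
    ((O ((S (.inl kq)).map eq)).map eqa.symm)

/-- The oracle erases the query, and the final loop consumes the answer into the register. Both host
stacks are therefore empty again, and the uniform bound `L` on the answers makes the reading time
constant. -/
theorem runLE_queryRound (kq ka : K) (eq : Γ kq ≃ Bool) (eqa : Γ ka ≃ Bool)
    (O : List Bool → List Bool) {L : ℕ} (hO : ∀ w, (O w).length ≤ L) (rd : σ → Bool → σ)
    (P : ArrayProg σ α) (hP : P.WF ∅) {n : ℕ} {m : Mem α} (hxb : m.xb = [])
    (hm : m.cnt = Function.update (fun _ => 0) nn n) (hx : m.x.length = n * n) {v : σ}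
    {h : ∀ k, List (Γ k)} (hq : h kq = []) (ha : h ka = []) :
    RunLE (oracleAct kq ka eq eqa O) (queryRound kq ka eq eqa rd P) (v, none) (m.stk h)
      ((queryDen O rd n P (v, m.x)).1, none)
      (({ m with x := (queryDen O rd n P (v, m.x)).2 } : Mem α).stk h)
      (P.cost.eval n + (2 * L + 2)) := by
  have h₁ := ArrayProg.runLE_compile (A := oracleAct kq ka eq eqa O) kq eq P (q := v) (h := h)
    (m := m) (n := n) ∅ hP hxb (by simp [hm]) (by simp [hm]) (by simp [hm]) (by simp [hm])
    (by simp [hm]) hx []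
  rw [List.map_nil, ← hq, Function.update_eq_self] at h₁
  have e : (fun i => m.cnt (lo i)) = fun _ => 0 := by simp [hm]
  rw [e] at h₁
  set r := P.den n (fun _ => 0) (v, m.x, []) with hr
  have h₃ := RunLE.loop (A := oracleAct kq ka eq eqa O) (k := .inl ka)
    (f := fun (v : σ × Option α) b => (rd v.1 (eqa b), v.2)) (P := skip) (t := 1)
    ((O r.2.2).map eqa.symm) (fun i => (((O r.2.2).take i).foldl rd r.1, none))
    (fun i => ({ m with x := r.2.1 } : Mem α).stk
      (Function.update h ka (((O r.2.2).map eqa.symm).drop i))) (by simp) ?_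
  rotate_left
  · intro i hi
    rw [List.length_map] at hi
    refine runLE_skip.of_eq ?_ ?_ le_rfl
    · rw [List.take_succ_eq_append_getElem hi, List.foldl_append]
      simp
    · rw [Mem.update_inl, Function.update_idem]
  rw [List.drop_length, List.length_map, List.take_length, ← ha, Function.update_eq_self] at h₃
  refine (h₁.seq ((RunLE.ask.of_eq rfl ?_ le_rfl).seq h₃)).of_eq rfl rfl ?_
  · rw [oracleAct, Mem.stk_inl, Function.update_self, Mem.update_inl, Mem.update_inl,
      Function.update_idem, ← hq, Function.update_eq_self, List.map_map]
    simp
  · have := hO r.2.2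
    omega

/-- Run a list of query rounds. -/
def queryRounds (kq ka : K) (eq : Γ kq ≃ Bool) (eqa : Γ ka ≃ Bool) (rd : σ → Bool → σ) :
    List (ArrayProg σ α) → StackProg (HostAlphabet Γ α) (σ × Option α)
  | [] => skip
  | P :: l => seq (queryRound kq ka eq eqa rd P) (queryRounds kq ka eq eqa rd l)

/-- A bound for the time of a list of query rounds. -/
noncomputable def queryCost (L : ℕ) : List (ArrayProg σ α) → Polynomial ℕ
  | [] => 1
  | P :: l => P.cost + Polynomial.C (2 * L + 2) + queryCost L l

theorem runLE_queryRounds (kq ka : K) (eq : Γ kq ≃ Bool) (eqa : Γ ka ≃ Bool)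
    (O : List Bool → List Bool) {L : ℕ} (hO : ∀ w, (O w).length ≤ L) (rd : σ → Bool → σ)
    (l : List (ArrayProg σ α)) (hl : ∀ P ∈ l, P.WF ∅) {n : ℕ} {m : Mem α} (hxb : m.xb = [])
    (hm : m.cnt = Function.update (fun _ => 0) nn n) (hx : m.x.length = n * n) {v : σ}
    {h : ∀ k, List (Γ k)} (hq : h kq = []) (ha : h ka = []) :
    RunLE (oracleAct kq ka eq eqa O) (queryRounds kq ka eq eqa rd l) (v, none) (m.stk h)
      ((l.foldl (fun s P => queryDen O rd n P s) (v, m.x)).1, none)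
      (({ m with x := (l.foldl (fun s P => queryDen O rd n P s) (v, m.x)).2 } : Mem α).stk h)
      ((queryCost L l).eval n) := by
  induction l generalizing v m with
  | nil => exact runLE_skip.of_eq rfl rfl (by simp [queryCost])
  | cons P l ih =>
    have h₁ := runLE_queryRound kq ka eq eqa O hO rd P (hl P (by simp)) hxb hm hx hq ha (v := v)
    have h₂ := ih (fun P hP => hl P (by simp [hP])) (v := (queryDen O rd n P (v, m.x)).1)
      (m := { m with x := (queryDen O rd n P (v, m.x)).2 }) hxb hm
      (by simpa [queryDen, ArrayProg.length_den] using hx)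
    exact (h₁.seq h₂).of_eq rfl rfl (by simp [queryCost])

end StackProg

/-! ### Polynomial time from array programs -/

open Turing Computability StateTransition

theorem Polynomial.eval_nat_mono (q : Polynomial ℕ) {a b : ℕ} (h : a ≤ b) : q.eval a ≤ q.eval b := by
  rw [Polynomial.eval_eq_sum_range, Polynomial.eval_eq_sum_range]
  gcongr

namespace ArrayProg

/-- The program produces no output. -/
def EmitFree {σ α : Type} : ArrayProg σ α → Prop
  | upd _ _ _ => True
  | load _ => True
  | emit _ => False
  | seq P Q => P.EmitFree ∧ Q.EmitFree
  | ite _ P Q => P.EmitFree ∧ Q.EmitFree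
  | all _ P => P.EmitFree

theorem EmitFree.den {σ α : Type} {P : ArrayProg σ α} (hP : P.EmitFree) (n : ℕ) (u : Fin 5 → ℕ)
    (s : σ × List α × List Bool) : (P.den n u s).2.2 = s.2.2 := by
  induction P generalizing u s with
  | upd i j f =>
    rw [ArrayProg.den]
    cases s.2.1[u i * n + u j]? <;> simp
  | load f => rfl
  | emit f => exact hP.elim
  | seq P Q ihP ihQ => rw [ArrayProg.den, ihQ hP.2, ihP hP.1]
  | ite c P Q ihP ihQ => rw [ArrayProg.den]; split_ifs <;> simp [ihP hP.1, ihQ hP.2]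
  | all i P ih =>
    rw [ArrayProg.den]
    induction List.range n generalizing s with
    | nil => rfl
    | cons k l ihl => rw [List.foldl_cons, ihl, ih hP]

end ArrayProg

namespace StackProg

/-- The machine that runs a program on a host with a single stack. -/
def machine {σ α : Type} [Fintype σ] [Fintype α]
    (P : StackProg (HostAlphabet (fun _ : Unit => Bool) α) (σ × Option α)) (v₀ : σ) : FinTM2 where
  K := Unit ⊕ Aux
  k₀ := .inl ()
  k₁ := .inl ()
  Γ := HostAlphabet (fun _ : Unit => Bool) α
  Λ := Option P.Label
  main := some P.entry
  σ := Unit × Bool × σ × Option α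
  initialState := ((), false, v₀, none)
  Γk₀Fin := inferInstanceAs (Fintype Bool)
  m
    | none => .halt
    | some x => (P.instr Unit some none x).elim id fun l => .goto fun _ => l

theorem initList_machine {σ α : Type} [Fintype σ] [Fintype α]
    (P : StackProg (HostAlphabet (fun _ : Unit => Bool) α) (σ × Option α)) (v₀ : σ) (w : List Bool) :
    initList (machine P v₀) w =
      ⟨some (some P.entry), ((), false, v₀, none), (Mem.empty α).stk fun _ => w⟩ := by
  unfold initList
  congr 1
  funext k
  rcases k with ⟨⟩ | (_ | _ | c) <;> rfl

theorem haltList_machine {σ α : Type} [Fintype σ] [Fintype α]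
    (P : StackProg (HostAlphabet (fun _ : Unit => Bool) α) (σ × Option α)) (v₀ : σ) (w : List Bool) :
    haltList (machine P v₀) w =
      ⟨none, ((), false, v₀, none), (Mem.empty α).stk fun _ => w⟩ := by
  unfold haltList
  congr 1
  funext k
  rcases k with ⟨⟩ | (_ | _ | c) <;> rfl

end StackProg

/-- Functions that are computed by an array program are computable in polynomial time. -/
theorem polyTime_of_arrayProg {σ α : Type} [Fintype σ] [Fintype α] [Inhabited α] (ini : Bool → α)
    (P : ArrayProg σ α) (hP : P.WF ∅) (hP' : P.EmitFree) (v₀ : σ) (res : σ → ℕ)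
    (g : List Bool → ℕ)
    (hg : ∀ w, g w = res (P.den (LoopGraph.codeSize w) (fun _ => 0) (v₀, Mem.cells ini w, [])).1) :
    PolyTime g := by
  classical
  -- The register has finitely many values, so the length of the output is bounded by a constant.
  set L := Finset.univ.sup fun v : σ => (encodeNat (res v)).length with hL
  have hL' : ∀ v, (encodeNat (res v)).length ≤ L := fun v =>
    Finset.le_sup (f := fun v : σ => (encodeNat (res v)).length) (Finset.mem_univ v)
  set Γ : Unit → Type := fun _ => Bool
  set Q : StackProg (HostAlphabet Γ α) (σ × Option α) := StackProg.subroutine () ()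
    (Equiv.refl Bool) (Equiv.refl Bool) ini (P.compile () (Equiv.refl Bool)) v₀
    (fun v => encodeNat (res v)) L with hQ
  have hrun : ∀ w : List Bool, StackProg.RunLE id Q (v₀, none) ((Mem.empty α).stk fun _ => w)
      (v₀, none) ((Mem.empty α).stk fun _ => encodeNat (g w))
      (P.cost.eval w.length + (2 * L + 2 * w.length + 60 * (w.length + 1) ^ 2)) := by
    intro w
    have h := StackProg.runLE_subroutine (A := id) (Γ := Γ) () () (Equiv.refl Bool)
      (Equiv.refl Bool) ini (body := P.compile () (Equiv.refl Bool)) v₀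
      (fun v => encodeNat (res v)) (L := L) w (h := fun _ => w) (by simp [Γ])
      (v := (P.den (LoopGraph.codeSize w) (fun _ => 0) (v₀, Mem.cells ini w, [])).1)
      (x := (P.den (LoopGraph.codeSize w) (fun _ => 0) (v₀, Mem.cells ini w, [])).2.1)
      (T := P.cost.eval w.length) (by simp [ArrayProg.length_den]) (hL' _) ?_
    · refine h.of_eq rfl (congrArg₂ _ ?_ rfl) le_rfl
      funext
      rw [hg w]
      simp [Γ]
    · intro h hh _
      have h₁ := ArrayProg.runLE_compile (A := id) (Γ := Γ) () (Equiv.refl Bool) P (q := v₀)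
        (h := h) (m := Mem.init ini w) (n := LoopGraph.codeSize w) ∅ hP rfl (by simp [Mem.init])
        (by simp [Mem.init]) (by simp [Mem.init]) (by simp [Mem.init]) (by simp [Mem.init])
        (by simp [Mem.init]) []
      have e₁ : Function.update h () [] = h := funext fun _ => by simpa using hh.symm
      rw [hP'.den, List.map_nil, e₁] at h₁
      have e : (fun i => (Mem.init ini w).cnt (.lo i)) = fun _ => 0 := by
        funext i; simp [Mem.init]
      rw [e] at h₁
      exact h₁.mono (Polynomial.eval_nat_mono _ (StackProg.codeSize_le w))
  have hout : ∀ w w' o : List Bool, w' = w → o = encodeNat (g w) →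
      Nonempty (EvalsToInTime (StackProg.machine Q v₀).step (initList (StackProg.machine Q v₀) w')
      (some (haltList (StackProg.machine Q v₀) o))
      ((P.cost + Polynomial.C (2 * L + 1) + 2 * Polynomial.X +
        60 * (Polynomial.X + 1) ^ 2 : Polynomial ℕ).eval w.length)) := by
    intro w w' o hw ho
    rw [hw, ho]
    obtain ⟨t, ht, h⟩ := hrun w
    have h₁ := h.iterate (σ := Unit) (step := (StackProg.machine Q v₀).step) some none ?_ ()
    -- The additional step executes `halt` at the exit label.
    · refine ⟨⟨⟨t + 1, ?_⟩, ?_⟩⟩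
      · rw [StackProg.initList_machine, StackProg.haltList_machine, add_comm, Function.iterate_add_apply]
        exact congrArg (flip bind (StackProg.machine Q v₀).step) h₁
      · simp only [Polynomial.eval_add, Polynomial.eval_mul, Polynomial.eval_C, Polynomial.eval_X,
          Polynomial.eval_pow, Polynomial.eval_one, Polynomial.eval_ofNat]
        omega
    · intro x v S
      refine congrArg some ?_
      change TM2.stepAux ((Q.instr Unit some none x).elim id fun l => .goto fun _ => l) v S =
        (Q.instr Unit some none x).elim (fun q => TM2.stepAux q v S) fun l => ⟨some l, v, S⟩
      rcases Q.instr Unit some none x with q | l <;> rfl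
  exact ⟨{
    tm := StackProg.machine Q v₀
    inputAlphabet := Equiv.refl Bool
    outputAlphabet := Equiv.refl Bool
    time := P.cost + Polynomial.C (2 * L + 1) + 2 * Polynomial.X + 60 * (Polynomial.X + 1) ^ 2
    outputsFun := fun w => (hout w _ _ (List.map_id w) (List.map_id _)).some }⟩

/-! ### Replacing oracle calls by a subroutine -/

open Turing Computability StateTransition

namespace Turing.TM2

variable {K Λ σ : Type} {Γ : K → Type}

/-- The number of push instructions of a statement. -/
def Stmt.pushes : Stmt Γ Λ σ → ℕ
  | push _ _ q => q.pushes + 1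
  | peek _ _ q => q.pushes
  | pop _ _ q => q.pushes
  | load _ q => q.pushes
  | branch _ q₁ q₂ => q₁.pushes + q₂.pushes
  | goto _ => 0
  | halt => 0

/-- Bounds the growth of the stacks per step, and thereby the length of the queries that a machine
can write. Counting both branches of a `branch` keeps the bound independent of the register. -/
theorem length_stepAux_le [DecidableEq K] (q : Stmt Γ Λ σ) (v : σ) (S : ∀ k, List (Γ k)) (k : K) :
    ((stepAux q v S).stk k).length ≤ (S k).length + q.pushes := by
  induction q generalizing v S with
  | push k' f q ih =>
    refine (ih _ _).trans ?_
    by_cases hk : k = k'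
    · subst hk; simp [Stmt.pushes]; omega
    · simp [Stmt.pushes, hk]
  | peek k' f q ih => exact ih _ _
  | pop k' f q ih =>
    refine (ih _ _).trans ?_
    by_cases hk : k = k'
    · subst hk; simp [Stmt.pushes]
    · simp [Stmt.pushes, hk]
  | load f q ih => exact ih _ _
  | branch f q₁ q₂ ih₁ ih₂ =>
    rw [stepAux, Stmt.pushes]
    cases f v
    · exact (ih₂ _ _).trans (by omega)
    · exact (ih₁ _ _).trans (by omega)
  | goto f => simp [Stmt.pushes]
  | halt => simp [Stmt.pushes]

/-- A statement of a machine as a statement of a machine with more stacks, labels and registers. -/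
def Stmt.lift (α ρ Λ' : Type) : Stmt Γ Λ σ → Stmt (HostAlphabet Γ α) (Λ ⊕ Λ') (σ × ρ)
  | push k f q => push (.inl k) (fun s => f s.1) (q.lift α ρ Λ')
  | peek k f q => peek (.inl k) (fun s o => (f s.1 o, s.2)) (q.lift α ρ Λ')
  | pop k f q => pop (.inl k) (fun s o => (f s.1 o, s.2)) (q.lift α ρ Λ')
  | load f q => load (fun s => (f s.1, s.2)) (q.lift α ρ Λ')
  | branch f q₁ q₂ => branch (fun s => f s.1) (q₁.lift α ρ Λ') (q₂.lift α ρ Λ')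
  | goto f => goto fun s => .inl (f s.1)
  | halt => halt

/-- The configuration of the larger machine. -/
def Cfg.lift {α ρ : Type} (Λ' : Type) (m : Mem α) (r : ρ) (c : Cfg Γ Λ σ) :
    Cfg (HostAlphabet Γ α) (Λ ⊕ Λ') (σ × ρ) :=
  ⟨c.l.map .inl, (c.var, r), m.stk c.stk⟩

theorem stepAux_lift [DecidableEq K] {α ρ Λ' : Type} (m : Mem α) (r : ρ) (q : Stmt Γ Λ σ) (v : σ)
    (S : ∀ k, List (Γ k)) :
    stepAux (q.lift α ρ Λ') (v, r) (m.stk S) = (stepAux q v S).lift Λ' m r := by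
  induction q generalizing v S with
  | push k f q ih => rw [Stmt.lift, stepAux, stepAux, ← ih, Mem.update_inl]; rfl
  | peek k f q ih => rw [Stmt.lift, stepAux, stepAux, ← ih]; rfl
  | pop k f q ih => rw [Stmt.lift, stepAux, stepAux, ← ih, Mem.update_inl]; rfl
  | load f q ih => rw [Stmt.lift, stepAux, stepAux, ← ih]
  | branch f q₁ q₂ ih₁ ih₂ =>
    rw [Stmt.lift, stepAux, stepAux]
    cases h : f v <;> simp [ih₁, ih₂]
  | goto f => rfl
  | halt => rfl

end Turing.TM2

namespace OracleTM

variable (M : OracleTM) {σ α : Type} [Fintype σ] [Fintype α]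
  (P : StackProg (HostAlphabet M.Γ α) (σ × Option α)) (v₀ : σ)

/-- The machine that runs the program `P` in place of the oracle queries of `M`. -/
def withSubroutine : OracleTM where
  K := M.K ⊕ Aux
  kDecidableEq := letI := M.kDecidableEq; inferInstance
  kFin := letI := M.kFin; inferInstance
  k₀ := .inl M.k₀
  k₁ := .inl M.k₁
  Γ := HostAlphabet M.Γ α
  Λ := M.Λ ⊕ (M.Λ × P.Label)
  main := .inl M.main
  ΛFin := letI := M.ΛFin; inferInstance
  σ := M.σ × Bool × σ × Option α
  initialState := (M.initialState, false, v₀, none)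
  σFin := letI := M.σFin; inferInstance
  Γk₀Fin := M.Γk₀Fin
  m
    | .inl l => (M.ask l).elim ((M.m l).lift α _ _) fun l' => .goto fun _ => .inr (l', P.entry)
    | .inr x => (P.instr M.σ (fun y => .inr (x.1, y)) (.inl x.1) x.2).elim id fun _ => .halt
  inputAlphabet := M.inputAlphabet
  outputAlphabet := M.outputAlphabet
  kq := .inl M.kq
  ka := .inl M.ka
  queryAlphabet := M.queryAlphabet
  answerAlphabet := M.answerAlphabet
  ask
    | .inl _ => none
    | .inr x => (P.instr M.σ (fun y => .inr (x.1, y)) (.inl x.1) x.2).elim (fun _ => none) some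

/-- The configuration of the machine with the subroutine that corresponds to a configuration of
`M`. -/
def liftCfg (c : M.Cfg) : (M.withSubroutine P v₀).Cfg :=
  TM2.Cfg.lift (M.Λ × P.Label) (Mem.empty α) (false, v₀, (none : Option α)) c

theorem initList_withSubroutine (x : List (M.Γ M.k₀)) :
    initList (M.withSubroutine P v₀).toFinTM2 x = M.liftCfg P v₀ (initList M.toFinTM2 x) := by
  unfold initList liftCfg TM2.Cfg.lift
  congr 1
  funext k
  rcases k with k | (_ | _ | c)
  · by_cases hk : k = M.k₀
    · subst hk
      simp [withSubroutine]
      rfl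
    · simp [withSubroutine, hk]
  all_goals rfl

theorem haltList_withSubroutine (x : List (M.Γ M.k₁)) :
    haltList (M.withSubroutine P v₀).toFinTM2 x = M.liftCfg P v₀ (haltList M.toFinTM2 x) := by
  unfold haltList liftCfg TM2.Cfg.lift
  congr 1
  funext k
  rcases k with k | (_ | _ | c)
  · by_cases hk : k = M.k₁
    · subst hk
      simp [withSubroutine]
      rfl
    · simp [withSubroutine, hk]
  all_goals rfl

/-- The first component of a subroutine label is the state in which `M` resumes; it is carried along
unchanged and serves as the exit of the program. -/
theorem implements_withSubroutine (O : List Bool → List Bool) (l' : M.Λ) :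
    StackProg.Implements ((M.withSubroutine P v₀).step O)
      (StackProg.oracleAct M.kq M.ka M.queryAlphabet M.answerAlphabet O) P
      (fun y => .inr (l', y)) (.inl l') := by
  intro x v S
  -- The right-hand side as a function of the instruction, so that the value of the instruction
  -- enters through `congrArg` and no rewriting inside dependent types is needed.
  let F (I : TM2.Stmt (HostAlphabet M.Γ α) (M.Λ ⊕ (M.Λ × P.Label)) (M.σ × Bool × σ × Option α) ⊕
      (M.Λ ⊕ (M.Λ × P.Label))) : Option (M.withSubroutine P v₀).Cfg :=
    some (I.elim (fun q => TM2.stepAux q v S) fun l => ⟨some l, v,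
      StackProg.oracleAct M.kq M.ka M.queryAlphabet M.answerAlphabet O S⟩)
  have ha : (M.withSubroutine P v₀).ask (Sum.inr (l', x)) = (P.instr M.σ
      (Λ := M.Λ ⊕ (M.Λ × P.Label)) (fun y => Sum.inr (l', y)) (Sum.inl l') x).elim
      (fun _ => none) some := rfl
  have hm : (M.withSubroutine P v₀).m (Sum.inr (l', x)) = (P.instr M.σ
      (Λ := M.Λ ⊕ (M.Λ × P.Label)) (fun y => Sum.inr (l', y)) (Sum.inl l') x).elim
      id fun _ => .halt := rfl
  rcases hI : P.instr M.σ (Λ := M.Λ ⊕ (M.Λ × P.Label)) (fun y => Sum.inr (l', y)) (Sum.inl l') x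
    with q | l
  · rw [hI, Sum.elim_inl] at ha hm
    have h : (M.withSubroutine P v₀).step O ⟨some (Sum.inr (l', x)), v, S⟩ =
        some (TM2.stepAux ((M.withSubroutine P v₀).m (Sum.inr (l', x))) v S) := by
      simp only [step, ha]; rfl
    rw [hm] at h
    exact h.trans (congrArg F hI).symm
  · rw [hI, Sum.elim_inr] at ha
    have h : (M.withSubroutine P v₀).step O ⟨some (Sum.inr (l', x)), v, S⟩ =
        some ⟨some l, v, StackProg.oracleAct M.kq M.ka M.queryAlphabet M.answerAlphabet O S⟩ := by
      simp only [step, ha]; rfl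
    exact h.trans (congrArg F hI).symm

variable {M P v₀}

/-- The action of the oracle `O` on the stacks. -/
def answer (M : OracleTM) (O : List Bool → List Bool) (S : ∀ k, List (M.Γ k)) :
    ∀ k, List (M.Γ k) :=
  Function.update (Function.update S M.kq []) M.ka
    ((O ((S M.kq).map M.queryAlphabet)).map M.answerAlphabet.symm)

/-- An ordinary step is copied; a query becomes one jump and one run of `P`. The query and the
answer stack have length at most `N` each, which gives the argument `2 * N`. -/
theorem exists_steps {O O' : List Bool → List Bool} {T : ℕ → ℕ} (hT : Monotone T)
    (hP : ∀ S : ∀ k, List (M.Γ k), StackProg.RunLE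
      (StackProg.oracleAct M.kq M.ka M.queryAlphabet M.answerAlphabet O') P (v₀, none)
      ((Mem.empty α).stk S) (v₀, none) ((Mem.empty α).stk (M.answer O S))
      (T ((S M.kq).length + (S M.ka).length)))
    {c c' : M.Cfg} (h : M.step O c = some c') {N : ℕ} (hN : ∀ k, (c.stk k).length ≤ N) :
    ∃ s ≤ T (2 * N) + 1, (flip bind ((M.withSubroutine P v₀).step O'))^[s]
      (some (M.liftCfg P v₀ c)) = some (M.liftCfg P v₀ c') := by
  obtain ⟨_ | l, u, S⟩ := c
  · cases h
  rcases hl : M.ask l with _ | l'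
  · refine ⟨1, by omega, ?_⟩
    have h₁ : M.step O ⟨some l, u, S⟩ = some (TM2.stepAux (M.m l) u S) := by
      simp only [step, hl]; rfl
    rw [h₁] at h
    have h₂ : (M.withSubroutine P v₀).step O' (M.liftCfg P v₀ ⟨some l, u, S⟩) =
        some (TM2.stepAux ((M.ask l).elim ((M.m l).lift α (Bool × σ × Option α) (M.Λ × P.Label))
          fun l' => .goto fun _ => Sum.inr (l', P.entry)) (u, false, v₀, none)
          ((Mem.empty α).stk S)) := rfl
    rw [hl, Option.elim_none, TM2.stepAux_lift] at h₂
    obtain rfl := Option.some.inj h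
    exact h₂
  · have h₁ : M.step O ⟨some l, u, S⟩ = some ⟨some l', u, M.answer O S⟩ := by
      simp only [step, hl]; rfl
    rw [h₁] at h
    obtain rfl := Option.some.inj h
    obtain ⟨t, ht, hr⟩ := hP S
    refine ⟨t + 1, ?_, ?_⟩
    · exact Nat.succ_le_succ (ht.trans (hT (by have := hN M.kq; have := hN M.ka; simp at *; omega)))
    · have h₂ : (M.withSubroutine P v₀).step O' (M.liftCfg P v₀ ⟨some l, u, S⟩) =
          some (TM2.stepAux ((M.ask l).elim ((M.m l).lift α (Bool × σ × Option α) (M.Λ × P.Label))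
            fun l' => .goto fun _ => Sum.inr (l', P.entry)) (u, false, v₀, none)
            ((Mem.empty α).stk S)) := rfl
      rw [hl] at h₂
      rw [Function.iterate_succ_apply]
      refine Eq.trans (congrArg _ h₂) ?_
      exact hr.iterate (fun y => Sum.inr (l', y)) (Sum.inl l') (implements_withSubroutine M P v₀ O' l') u

/-- A program step adds at most the maximal number of pushes over the finitely many states; a query
only replaces the answer stack by a string of length at most `L`. Unbounded oracle values would
break this. -/
theorem exists_length_step_le (M : OracleTM) {O : List Bool → List Bool} {L : ℕ}
    (hO : ∀ w, (O w).length ≤ L) : ∃ C, ∀ (c c' : M.Cfg) (N : ℕ), M.step O c = some c' →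
      (∀ k, (c.stk k).length ≤ N) → ∀ k, (c'.stk k).length ≤ N + C := by
  let := M.ΛFin
  refine ⟨Finset.univ.sup (fun l => (M.m l).pushes) + L, ?_⟩
  rintro ⟨_ | l, u, S⟩ c' N h hN k
  · cases h
  rcases hl : M.ask l with _ | l'
  · have h₁ : M.step O ⟨some l, u, S⟩ = some (TM2.stepAux (M.m l) u S) := by
      simp only [step, hl]; rfl
    rw [h₁] at h
    obtain rfl := Option.some.inj h
    have h₂ := TM2.length_stepAux_le (M.m l) u S k
    have h₃ := Finset.le_sup (f := fun l => (M.m l).pushes) (Finset.mem_univ l)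
    have h₄ := hN k
    simp only at h₃ h₄
    omega
  · have h₁ : M.step O ⟨some l, u, S⟩ = some ⟨some l', u, M.answer O S⟩ := by
      simp only [step, hl]; rfl
    rw [h₁] at h
    obtain rfl := Option.some.inj h
    have h₄ := hN k
    change (M.answer O S k).length ≤ _
    rcases eq_or_ne k M.ka with rfl | h₁
    · have := hO ((S M.kq).map M.queryAlphabet)
      simp [answer]
      omega
    · rcases eq_or_ne k M.kq with rfl | h₂
      · simp [answer, h₁]
      · simp only [answer, Function.update_of_ne h₁, Function.update_of_ne h₂]
        simp only at h₄
        omega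

/-- Within `t` steps the stacks stay below `x.length + t * C`, so each of the simulated steps costs
at most the value of `T` at twice that length, plus one. -/
theorem OutputsInTime.withSubroutine {O O' : List Bool → List Bool} {T : ℕ → ℕ} (hT : Monotone T)
    (hP : ∀ S : ∀ k, List (M.Γ k), StackProg.RunLE
      (StackProg.oracleAct M.kq M.ka M.queryAlphabet M.answerAlphabet O') P (v₀, none)
      ((Mem.empty α).stk S) (v₀, none) ((Mem.empty α).stk (M.answer O S))
      (T ((S M.kq).length + (S M.ka).length))) {C : ℕ}
    (hC : ∀ (c c' : M.Cfg) (N : ℕ), M.step O c = some c' →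
      (∀ k, (c.stk k).length ≤ N) → ∀ k, (c'.stk k).length ≤ N + C)
    {x y : List Bool} {t : ℕ} (h : M.OutputsInTime O x y t) :
    (M.withSubroutine P v₀).OutputsInTime O' x y (t * (T (2 * (x.length + t * C)) + 1)) := by
  have key : ∀ (s : ℕ) (c c' : M.Cfg) (N : ℕ), (flip bind (M.step O))^[s] (some c) = some c' →
      (∀ k, (c.stk k).length ≤ N) → ∃ s' ≤ s * (T (2 * (N + s * C)) + 1),
        (flip bind ((M.withSubroutine P v₀).step O'))^[s'] (some (M.liftCfg P v₀ c)) =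
          some (M.liftCfg P v₀ c') := by
    intro s
    induction s with
    | zero =>
      intro c c' N h _
      obtain rfl := Option.some.inj h
      exact ⟨0, by omega, rfl⟩
    | succ s ih =>
      intro c c' N h hN
      rw [Function.iterate_succ_apply] at h
      change (flip bind (M.step O))^[s] (M.step O c) = some c' at h
      rcases hc : M.step O c with _ | c₁
      · rw [hc] at h
        have : ∀ s, (flip bind (M.step O))^[s] none = none := fun s => by
          induction s with
          | zero => rfl
          | succ s ih => rw [Function.iterate_succ_apply]; exact ih
        rw [this] at h
        cases h
      · rw [hc] at h
        obtain ⟨s₁, hs₁, h₁⟩ := exists_steps hT hP hc hN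
        obtain ⟨s₂, hs₂, h₂⟩ := ih c₁ c' (N + C) h (hC c c₁ N hc hN)
        refine ⟨s₂ + s₁, ?_, by rw [Function.iterate_add_apply, h₁, h₂]⟩
        have e : N + C + s * C = N + (s + 1) * C := by ring
        rw [e] at hs₂
        have h₃ : T (2 * N) ≤ T (2 * (N + (s + 1) * C)) := hT (by omega)
        rw [Nat.succ_mul]
        omega
  obtain ⟨⟨⟨s, hs⟩, hst⟩⟩ := h
  obtain ⟨s', hs', h'⟩ := key s _ _ x.length hs (fun k => by
    by_cases hk : k = M.k₀
    · subst hk; simp [initList]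
    · simp [initList, hk])
  refine ⟨⟨⟨s', ?_⟩, hs'.trans ?_⟩⟩
  · have e₁ := initList_withSubroutine M P v₀ (x.map M.inputAlphabet.symm)
    have e₂ := haltList_withSubroutine M P v₀ (y.map M.outputAlphabet.symm)
    rw [← e₁, ← e₂] at h'
    exact h'
  · have hst : s ≤ t := hst
    have h₁ : T (2 * (x.length + s * C)) ≤ T (2 * (x.length + t * C)) :=
      hT (by have := Nat.mul_le_mul_right C hst; omega)
    exact Nat.mul_le_mul hst (by omega)

end OracleTM

/-- A Turing reduction to `g` is a Turing reduction to `g'` if `g` is computed by an array program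
with oracle queries to the bounded function `g'`. -/
theorem TuringReduces.of_queries {f g g' : List Bool → ℕ} (hfg : TuringReduces f g) {σ α : Type}
    [Fintype σ] [Fintype α] [Inhabited α] (ini : Bool → α) (l : List (ArrayProg σ α))
    (hl : ∀ P ∈ l, P.WF ∅) (rd : σ → Bool → σ) (v₀ : σ) (res : σ → ℕ) {L : ℕ}
    (hg' : ∀ w, (encodeNat (g' w)).length ≤ L)
    (hg : ∀ w, g w = res (l.foldl (fun s P => StackProg.queryDen (fun w => encodeNat (g' w)) rd
      (LoopGraph.codeSize w) P s) (v₀, Mem.cells ini w)).1) :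
    TuringReduces f g' := by
  obtain ⟨M, q, hM⟩ := hfg
  set R := Finset.univ.sup fun v : σ => (encodeNat (res v)).length with hR
  have hR' : ∀ v, (encodeNat (res v)).length ≤ R := fun v =>
    Finset.le_sup (f := fun v : σ => (encodeNat (res v)).length) (Finset.mem_univ v)
  set P := StackProg.subroutine M.kq M.ka M.queryAlphabet M.answerAlphabet ini
    (StackProg.queryRounds M.kq M.ka M.queryAlphabet M.answerAlphabet rd l) v₀
    (fun v => encodeNat (res v)) R with hP
  set T : Polynomial ℕ := StackProg.queryCost L l + (Polynomial.C (2 * R) + 2 * Polynomial.X +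
    60 * (Polynomial.X + 1) ^ 2) with hT
  have hrun : ∀ S : ∀ k, List (M.Γ k), StackProg.RunLE
      (StackProg.oracleAct M.kq M.ka M.queryAlphabet M.answerAlphabet fun w => encodeNat (g' w)) P
      (v₀, none) ((Mem.empty α).stk S) (v₀, none)
      ((Mem.empty α).stk (M.answer (fun w => encodeNat (g w)) S))
      (T.eval ((S M.kq).length + (S M.ka).length)) := by
    intro S
    set w := (S M.kq).map M.queryAlphabet with hw
    set s := l.foldl (fun s P => StackProg.queryDen (fun w => encodeNat (g' w)) rd
      (LoopGraph.codeSize w) P s) (v₀, Mem.cells ini w) with hs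
    have hlen : ∀ (l : List (ArrayProg σ α)) (s : σ × List α),
        (l.foldl (fun s P => StackProg.queryDen (fun w => encodeNat (g' w)) rd
          (LoopGraph.codeSize w) P s) s).2.length = s.2.length := by
      intro l
      induction l with
      | nil => intro s; rfl
      | cons P l ih => intro s; rw [List.foldl_cons, ih]; simp [StackProg.queryDen,
          ArrayProg.length_den]
    have h := StackProg.runLE_subroutine M.kq M.ka M.queryAlphabet M.answerAlphabet ini v₀
      (fun v => encodeNat (res v)) w (h := S) (by simp [hw]) (v := s.1) (x := s.2)
      (by rw [hs, hlen]; simp) (hR' _)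
      (fun h hq ha => StackProg.runLE_queryRounds M.kq M.ka M.queryAlphabet M.answerAlphabet
        (fun w => encodeNat (g' w)) hg' rd l hl (m := Mem.init ini w) rfl rfl
        (by simp [Mem.init]) hq ha (v := v₀))
    refine h.of_eq rfl (congrArg₂ _ ?_ rfl) ?_
    · rw [OracleTM.answer, ← hw, hg w]
    · rw [hT]
      simp only [Polynomial.eval_add, Polynomial.eval_mul, Polynomial.eval_C, Polynomial.eval_X,
          Polynomial.eval_pow, Polynomial.eval_one, Polynomial.eval_ofNat]
      have hw' : w.length = (S M.kq).length := by simp [hw]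
      have h₁ := Polynomial.eval_nat_mono (StackProg.queryCost L l)
        ((StackProg.codeSize_le w).trans (hw'.le.trans
          (Nat.le_add_right _ (S M.ka).length)))
      have h₂ : (w.length + 1) ^ 2 ≤ ((S M.kq).length + (S M.ka).length + 1) ^ 2 :=
        Nat.pow_le_pow_left (by omega) 2
      omega
  -- By `hg` the function `g` factors through the finite register, so the answers of the old oracle
  -- are bounded too.
  obtain ⟨C, hC⟩ := M.exists_length_step_le (O := fun w => encodeNat (g w)) (L := R)
    (fun w => by rw [hg w]; exact hR' _)
  refine ⟨M.withSubroutine P v₀, q * (T.comp (2 * (Polynomial.X + q * Polynomial.C C)) + 1),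
    fun x => ?_⟩
  have := (hM x).withSubroutine (T := fun n => T.eval n)
    (fun a b hab => Polynomial.eval_nat_mono T hab) hrun hC
  simpa using this

/-! ### Disjoint unions and their codes -/

namespace LoopGraph

/-- The disjoint union of two graphs. -/
def sum {V W : Type} (G : LoopGraph V) (K : LoopGraph W) : LoopGraph (V ⊕ W) where
  Adj := Sum.LiftRel G.Adj K.Adj
  symm _ _ h := by
    cases h with
    | inl h => exact .inl (G.symm _ _ h)
    | inr h => exact .inr (K.symm _ _ h)

/-- Disjoint unions respect isomorphisms. -/
def Iso.sumCongr {V V' W W' : Type} {G : LoopGraph V} {G' : LoopGraph V'} {K : LoopGraph W}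
    {K' : LoopGraph W'} (e : G.Iso G') (e' : K.Iso K') : (G.sum K).Iso (G'.sum K') where
  toEquiv := Equiv.sumCongr e.toEquiv e'.toEquiv
  map_rel_iff' {a b} := by
    have h : ∀ a b, G'.Adj (e a) (e b) ↔ G.Adj a b := fun a b => e.map_rel_iff
    have h' : ∀ a b, K'.Adj (e' a) (e' b) ↔ K.Adj a b := fun a b => e'.map_rel_iff
    rcases a with a | a <;> rcases b with b | b <;> simp [sum, h, h']

/-- A copy of a graph on `Fin m`. -/
def transport {V W : Type} (e : W ≃ V) (G : LoopGraph V) : LoopGraph W where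
  Adj a b := G.Adj (e a) (e b)
  symm _ _ h := G.symm _ _ h

/-- A graph is isomorphic to its copies. -/
def transportIso {V W : Type} (e : W ≃ V) (G : LoopGraph V) : (G.transport e).Iso G where
  toEquiv := e
  map_rel_iff' := Iff.rfl

/-- The string that describes the graph on `N` vertices with adjacency matrix `D`, with the vertices
in reverse order. -/
def revCode (N : ℕ) (D : ℕ → ℕ → Bool) : List Bool :=
  ((List.range N).flatMap (fun i => (List.range N).map (D i)) ++
    (false :: List.replicate N true)).reverse

theorem flatMap_range_map {α : Type} (D : ℕ → ℕ → α) (N M : ℕ) :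
    (List.range N).flatMap (fun i => (List.range M).map (D i)) =
      (List.range (N * M)).map fun k => D (k / M) (k % M) := by
  induction N with
  | zero => simp
  | succ N ih =>
    rw [List.range_succ, List.flatMap_append, ih, Nat.succ_mul, List.range_add, List.map_append,
      List.flatMap_singleton, List.map_map]
    refine congrArg _ (List.map_congr_left fun j hj => ?_)
    rw [List.mem_range] at hj
    have hM : 0 < M := by omega
    simp [mul_comm N M, Nat.mul_add_div hM, Nat.div_eq_of_lt hj,
      Nat.mod_eq_of_lt hj]

theorem revCode_eq (N : ℕ) (D : ℕ → ℕ → Bool) : revCode N D = List.replicate N true ++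
    false :: ((List.range (N * N)).map fun k => D (k / N) (k % N)).reverse := by
  rw [revCode, flatMap_range_map]
  simp

theorem codeSize_replicate (N : ℕ) (l : List Bool) :
    codeSize (List.replicate N true ++ false :: l) = N := by
  induction N with
  | zero => simp [codeSize]
  | succ m ih => simp_all [codeSize, List.replicate_succ]

theorem codeSize_revCode (N : ℕ) (D : ℕ → ℕ → Bool) : codeSize (revCode N D) = N := by
  rw [revCode_eq, codeSize_replicate]

/-- A program that pushes its output produces the matrix backwards. Reversing a row-major list
reverses both indices, since `N * N - 1 - (i * N + j)` is `(N - 1 - i) * N + (N - 1 - j)`; the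
result is the same graph with its vertices in reverse order. -/
theorem getD_drop_revCode {N : ℕ} (D : ℕ → ℕ → Bool) {i j : ℕ} (hi : i < N) (hj : j < N) :
    ((revCode N D).drop (N + 1)).getD (i * N + j) false = D (N - 1 - i) (N - 1 - j) := by
  have h : (revCode N D).drop (N + 1) =
      ((List.range (N * N)).map fun k => D (k / N) (k % N)).reverse := by
    rw [revCode_eq, List.drop_append]
    simp
  have hlt : i * N + j < N * N := by nlinarith
  rw [h, List.getD_eq_getElem _ _ (by simpa using hlt), List.getElem_reverse]
  simp only [List.length_map, List.length_range, List.getElem_map, List.getElem_range]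
  obtain ⟨i', rfl⟩ : ∃ i', N = i + 1 + i' := ⟨N - (i + 1), by omega⟩
  have e : (i + 1 + i') * (i + 1 + i') - 1 - (i * (i + 1 + i') + j) =
      (i + 1 + i') * i' + (i + i' - j) := by
    have : (i + 1 + i') * (i + 1 + i') =
      i * (i + 1 + i') + (i + 1 + i') + (i + 1 + i') * i' := by ring
    omega
  rw [e, Nat.mul_add_div (by omega), Nat.mul_add_mod, Nat.div_eq_of_lt (by omega),
    Nat.mod_eq_of_lt (by omega)]
  congr 1 <;> omega

/-- The graph described by `revCode N D`. -/
def revCodeIso {N : ℕ} {D : ℕ → ℕ → Bool} {V : Type} {G : LoopGraph V} (e : Fin N ≃ V)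
    (h : ∀ i j, G.Adj (e i) (e j) ↔ (D i j = true ∨ D j i = true)) :
    (ofCode (revCode N D)).Iso G where
  toEquiv := ((finCongr (codeSize_revCode N D)).trans Fin.revPerm).trans e
  map_rel_iff' {a b} := by
    have ha : (a : ℕ) < N := a.2.trans_eq (codeSize_revCode N D)
    have hb : (b : ℕ) < N := b.2.trans_eq (codeSize_revCode N D)
    have h₁ := getD_drop_revCode D ha hb
    have h₂ := getD_drop_revCode D hb ha
    simp only [ofCode, codeSize_revCode, h₁, h₂, Equiv.trans_apply, h, finCongr_apply,
      Fin.revPerm_apply, Fin.val_rev, Fin.val_cast]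
    rw [Nat.sub_sub, Nat.sub_sub, add_comm 1, add_comm 1]

/-- The adjacency matrix of the disjoint union of the graph with code `w` and the graph with the
matrix `B`. -/
def sumMatrix (w : List Bool) (B : ℕ → ℕ → Bool) (i j : ℕ) : Bool :=
  if i < codeSize w then
    if j < codeSize w then (w.drop (codeSize w + 1)).getD (i * codeSize w + j) false else false
  else if j < codeSize w then false else B (i - codeSize w) (j - codeSize w)

/-- The graph with adjacency matrix `sumMatrix` is the disjoint union. -/
def sumMatrixIso (w : List Bool) {m : ℕ} (K : LoopGraph (Fin m)) {B : ℕ → ℕ → Bool}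
    (hB : ∀ a b : Fin m, B a b = true ↔ K.Adj a b) :
    (ofCode (revCode (codeSize w + m) (sumMatrix w B))).Iso ((ofCode w).sum K) :=
  revCodeIso finSumFinEquiv.symm (by
    have hK : ∀ a b : Fin m, (K.Adj a b ∨ K.Adj b a) ↔ K.Adj a b :=
      fun a b => ⟨fun h => h.elim id (K.symm _ _), .inl⟩
    intro i j
    obtain ⟨i, rfl⟩ := finSumFinEquiv.surjective i
    obtain ⟨j, rfl⟩ := finSumFinEquiv.surjective j
    rcases i with i | i <;> rcases j with j | j <;> simp [sum, sumMatrix, ofCode, hB, hK])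

end LoopGraph

/-! ### Queries for disjoint unions, and linear combinations of the answers -/

/-- Reading the binary expansion of a number by Horner's scheme. -/
theorem foldl_encodeNat {R : Type} [Semiring R] (v : ℕ) (a c : R) (b : Bool) :
    ((Computability.encodeNat v).foldl (fun (s : R × R × Bool) (b : Bool) =>
      (if b then s.1 + s.2.1 else s.1, 2 * s.2.1, false)) (a, c, b)).1 = a + c * v := by
  have h : ∀ (v : PosNum) (a c : R) (b : Bool),
      ((Computability.encodePosNum v).foldl (fun (s : R × R × Bool) (b : Bool) =>
        (if b then s.1 + s.2.1 else s.1, 2 * s.2.1, false)) (a, c, b)).1 = a + c * (v : ℕ) := by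
    intro v
    induction v with
    | one => simp [Computability.encodePosNum]
    | bit0 v ih =>
      intro a c b
      simp only [Computability.encodePosNum, List.foldl_cons, ih]
      simp [PosNum.cast_bit0, two_mul, mul_add, add_mul]
    | bit1 v ih =>
      intro a c b
      simp only [Computability.encodePosNum, List.foldl_cons, ih]
      simp [PosNum.cast_bit1, two_mul, mul_add, add_mul]
      abel
  rcases hv : (v : Num) with _ | k
  · have : v = 0 := by simpa using congrArg (fun k : Num => (k : ℕ)) hv
    simp [Computability.encodeNat, Computability.encodeNum, this]
  · have : v = (k : ℕ) := by simpa using congrArg (fun k : Num => (k : ℕ)) hv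
    simp only [Computability.encodeNat, hv, Computability.encodeNum, h]
    rw [this]

namespace ArrayProg

/-- Emit the symbols of a list. -/
def emits {σ α : Type} : List Bool → ArrayProg σ α
  | [] => .load id
  | b :: l => .seq (.emit fun _ => b) (emits l)

/-- Run the programs of a list. -/
def seqs {σ α : Type} : List (ArrayProg σ α) → ArrayProg σ α
  | [] => .load id
  | P :: l => .seq P (seqs l)

/-- The program that emits the code of the disjoint union of the input and the graph on `m` vertices
with the matrix `B`. The register holds an accumulator, a coefficient and the current bit. -/
def sumQuery {R : Type} (c : R) (m : ℕ) (B : ℕ → ℕ → Bool) : ArrayProg (R × R × Bool) Bool :=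
  .seq (.load fun s => (s.1, c, s.2.2))
  -- The symbol emitted last is the first of the query, so the matrix is written before the
  -- separator and the unary size at the end.
  (.seq (.all 0 (.seq
      (.all 1 (.seq (.upd 0 1 fun s b => ((s.1, s.2.1, b), b)) (.emit fun s => s.2.2)))
      (emits (List.replicate m false))))
  (.seq (seqs ((List.range m).map fun a =>
      .seq (.all 0 (.emit fun _ => false)) (emits ((List.range m).map (B a)))))
  (.seq (.emit fun _ => false) (.seq (.all 0 (.emit fun _ => true))
    (emits (List.replicate m true))))))

theorem WF_emits {σ α : Type} (l : List Bool) (act : Set (Fin 5)) :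
    (emits l : ArrayProg σ α).WF act := by
  induction l with
  | nil => trivial
  | cons b l ih => exact ⟨trivial, ih⟩

theorem WF_seqs {σ α : Type} (l : List (ArrayProg σ α)) (act : Set (Fin 5))
    (h : ∀ P ∈ l, P.WF act) : (seqs l).WF act := by
  induction l with
  | nil => trivial
  | cons P l ih => exact ⟨h P (by simp), ih fun Q hQ => h Q (by simp [hQ])⟩

theorem WF_sumQuery {R : Type} (c : R) (m : ℕ) (B : ℕ → ℕ → Bool) : (sumQuery c m B).WF ∅ := by
  simp [sumQuery, WF, WF_emits]
  exact WF_seqs _ _ (by simp [WF, WF_emits])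

/-- The program `P` emits the string `e` and changes at most the bit of the register. -/
def Emits {R α : Type} (n : ℕ) (P : ArrayProg (R × R × Bool) α) (u : Fin 5 → ℕ) (X : List α)
    (e : List Bool) : Prop :=
  ∀ a c b o, ∃ b', P.den n u ((a, c, b), X, o) = ((a, c, b'), X, e.reverse ++ o)

section

variable {R α : Type} {n : ℕ} {u : Fin 5 → ℕ} {X : List α}

theorem Emits.seq {P Q : ArrayProg (R × R × Bool) α} {e e' : List Bool} (hP : Emits n P u X e)
    (hQ : Emits n Q u X e') : Emits n (.seq P Q) u X (e ++ e') := by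
  intro a c b o
  obtain ⟨b', h⟩ := hP a c b o
  obtain ⟨b'', h'⟩ := hQ a c b' (e.reverse ++ o)
  exact ⟨b'', by rw [den, h, h']; simp⟩

theorem emits_emit (b : Bool) : Emits (R := R) n (.emit fun _ => b) u X [b] :=
  fun _ _ b' _ => ⟨b', rfl⟩

theorem emits_emits (l : List Bool) : Emits (R := R) n (emits l) u X l := by
  induction l with
  | nil => exact fun _ _ b _ => ⟨b, rfl⟩
  | cons b l ih => exact (emits_emit b).seq ih

theorem emits_seqs {ι : Type} (l : List ι) (P : ι → ArrayProg (R × R × Bool) α)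
    (e : ι → List Bool) (h : ∀ i ∈ l, Emits n (P i) u X (e i)) :
    Emits n (seqs (l.map P)) u X (l.flatMap e) := by
  induction l with
  | nil => exact fun _ _ b _ => ⟨b, rfl⟩
  | cons i l ih => exact (h i (by simp)).seq (ih fun j hj => h j (by simp [hj]))

theorem emits_all {i : Fin 5} {P : ArrayProg (R × R × Bool) α} {e : ℕ → List Bool}
    (h : ∀ k < n, Emits n P (Function.update u i k) X (e k)) :
    Emits n (.all i P) u X ((List.range n).flatMap e) := by
  have : ∀ l : List ℕ, (∀ k ∈ l, k < n) → ∀ a c b o, ∃ b',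
      l.foldl (fun s k => P.den n (Function.update u i k) s) ((a, c, b), X, o) =
        ((a, c, b'), X, (l.flatMap e).reverse ++ o) := by
    intro l
    induction l with
    | nil => exact fun _ a c b o => ⟨b, rfl⟩
    | cons k l ih =>
      intro hl a c b o
      obtain ⟨b', hb⟩ := h k (hl k (by simp)) a c b o
      obtain ⟨b'', hb'⟩ := ih (fun j hj => hl j (by simp [hj])) a c b' ((e k).reverse ++ o)
      exact ⟨b'', by rw [List.foldl_cons, hb, hb']; simp⟩
  exact this _ (by simp)

theorem flatMap_range_singleton {β : Type} (f : ℕ → β) (n : ℕ) :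
    (List.range n).flatMap (fun k => [f k]) = (List.range n).map f := by
  induction List.range n with
  | nil => rfl
  | cons k l ih => simp [ih]

theorem map_range_const {β : Type} (b : β) (n : ℕ) :
    (List.range n).map (fun _ => b) = List.replicate n b := by
  simp

end

open LoopGraph

theorem getElem?_cells {α : Type} (ini : Bool → α) (w : List Bool) {i j : ℕ}
    (hi : i < codeSize w) (hj : j < codeSize w) :
    (Mem.cells ini w)[i * codeSize w + j]? =
      some (ini ((w.drop (codeSize w + 1)).getD (i * codeSize w + j) false)) := by
  have hlt : i * codeSize w + j < codeSize w * codeSize w := by nlinarith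
  rw [Mem.cells, Mem.padded, List.getElem?_map, List.getElem?_range hlt]
  simp only [Option.map_some, List.getElem?_map, List.getD_eq_getElem?_getD]
  cases (w.drop (codeSize w + 1))[i * codeSize w + j]? <;> rfl

/-- The final value of the bit in the register is irrelevant, hence the existential; the matrix
survives because each cell is written back unchanged. -/
theorem den_sumQuery {R : Type} (c : R) (m : ℕ) (B : ℕ → ℕ → Bool) (w : List Bool) (a c' : R)
    (b : Bool) : ∃ b', (sumQuery c m B).den (codeSize w) (fun _ => 0)
      ((a, c', b), Mem.cells id w, []) =
        ((a, c, b'), Mem.cells id w, revCode (codeSize w + m) (sumMatrix w B)) := by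
  set n := codeSize w with hn
  have h := (emits_all (R := R) (n := n) (u := fun _ => 0) (X := Mem.cells id w) (i := 0)
    (P := .seq (.all 1 (.seq (.upd 0 1 fun s b => ((s.1, s.2.1, b), b)) (.emit fun s => s.2.2)))
      (emits (List.replicate m false)))
    (e := fun i => (List.range n).flatMap (fun j => [sumMatrix w B i j]) ++
      List.replicate m false) (fun i hi => (emits_all fun j hj => ?_).seq (emits_emits _))).seq
    ((emits_seqs (List.range m)
      (fun a => .seq (.all 0 (.emit fun _ => false)) (emits ((List.range m).map (B a))))
      (fun a => (List.range n).flatMap (fun _ => [false]) ++ (List.range m).map (B a))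
      (fun a _ => (emits_all fun k hk => emits_emit _).seq (emits_emits _))).seq
    ((emits_emit false).seq ((emits_all (i := 0) (e := fun _ => [true])
      fun k hk => emits_emit true).seq (emits_emits (List.replicate m true)))))
  · obtain ⟨b', hb⟩ := h a c b []
    refine ⟨b', ?_⟩
    rw [sumQuery, den]
    refine (congrArg _ ?_).trans (hb.trans ?_)
    · rfl
    · rw [revCode]
      simp only [List.append_nil]
      refine congrArg (fun l : List Bool => ((a, c, b'), Mem.cells id w, l.reverse)) ?_
      rw [List.range_add, List.flatMap_append]
      simp only [List.map_append, flatMap_range_singleton, map_range_const, List.map_map,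
        List.replicate_add, List.append_assoc, List.singleton_append, List.flatMap_map]
      refine congrArg₂ _ (List.flatMap_congr fun i hi => congrArg _ ?_)
        (congrArg₂ _ (List.flatMap_congr fun i hi => congrArg₂ _ ?_ ?_) rfl)
      · rw [List.mem_range] at hi
        rw [← map_range_const, List.map_inj_left]
        exact fun k _ => by simp [sumMatrix, ← hn, hi]
      · rw [← map_range_const, List.map_inj_left]
        exact fun k hk => by simp [sumMatrix, ← hn, List.mem_range.1 hk]
      · exact List.map_congr_left fun k hk => by simp [sumMatrix, ← hn]
  · intro a c b o
    refine ⟨sumMatrix w B i j, ?_⟩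
    have hc := getElem?_cells id w hi hj
    rw [← hn] at hc
    have hset : (Mem.cells id w).set (i * n + j)
        ((w.drop (n + 1)).getD (i * n + j) false) = Mem.cells id w := by
      obtain ⟨h, e⟩ := List.getElem?_eq_some_iff.1 hc
      rw [id] at e
      rw [← e, List.set_getElem_self]
    simpa [den, hc, sumMatrix, ← hn, hi, hj] using hset

end ArrayProg

open LoopGraph in
/-- A Turing reduction to a linear combination modulo `p` of the values of a graph invariant on
disjoint unions of the input with fixed graphs yields a Turing reduction to the invariant. -/
theorem TuringReduces.of_sum {f g : List Bool → ℕ} (hfg : TuringReduces f g) {p : ℕ} [NeZero p]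
    (I : ∀ {V : Type}, LoopGraph V → ℕ)
    (hI : ∀ {V W : Type} (G : LoopGraph V) (G' : LoopGraph W), G.Iso G' → I G = I G')
    {ι : Type} (s : Finset ι) (c : ι → ZMod p) {W : ι → Type} [∀ i, Finite (W i)]
    (K : ∀ i, LoopGraph (W i))
    (hg : ∀ w, g w = (∑ i ∈ s, c i * (I ((ofCode w).sum (K i)) : ZMod p)).val) :
    TuringReduces f (fun w => I (ofCode w) % p) := by
  classical
  have : Fintype (ZMod p) := ZMod.fintype p
  let m : ι → ℕ := fun i => Nat.card (W i)
  let e : ∀ i, Fin (m i) ≃ W i := fun i => (Finite.equivFin (W i)).symm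
  let B : ι → ℕ → ℕ → Bool := fun i a b =>
    decide (∃ (ha : a < m i) (hb : b < m i), (K i).Adj (e i ⟨a, ha⟩) (e i ⟨b, hb⟩))
  -- Binary numbers are read with the least significant bit first. The second component holds the
  -- coefficient times the current power of two, so reading an answer adds the coefficient times the
  -- answer to the accumulator.
  let rd : ZMod p × ZMod p × Bool → Bool → ZMod p × ZMod p × Bool := fun s b =>
    (if b then s.1 + s.2.1 else s.1, 2 * s.2.1, false)
  refine hfg.of_queries (σ := ZMod p × ZMod p × Bool) (α := Bool) id
    (s.toList.map fun i => ArrayProg.sumQuery (c i) (m i) (B i)) ?_ rd (0, 0, false)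
    (fun v => v.1.val)
    (L := (Finset.range p).sup fun v => (Computability.encodeNat v).length) ?_ ?_
  · simpa using fun i _ => ArrayProg.WF_sumQuery _ _ _
  · exact fun w => Finset.le_sup (f := fun v => (Computability.encodeNat v).length)
      (Finset.mem_range.2 (Nat.mod_lt _ (NeZero.pos p)))
  · intro w
    rw [hg]
    have key : ∀ (l : List ι) (v : ZMod p × ZMod p × Bool),
        ((l.map fun i => ArrayProg.sumQuery (c i) (m i) (B i)).foldl (fun s P =>
          StackProg.queryDen (fun w => Computability.encodeNat (I (ofCode w) % p)) rd (codeSize w)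
            P s) (v, Mem.cells id w)).1.1 =
        v.1 + (l.map fun i => c i * (I ((ofCode w).sum (K i)) : ZMod p)).sum := by
      intro l
      induction l with
      | nil => simp
      | cons i l ih =>
        intro v
        obtain ⟨b', hb⟩ := ArrayProg.den_sumQuery (c i) (m i) (B i) w v.1 v.2.1 v.2.2
        have hq : StackProg.queryDen (fun w => Computability.encodeNat (I (ofCode w) % p)) rd
            (codeSize w) (ArrayProg.sumQuery (c i) (m i) (B i)) (v, Mem.cells id w) =
            ((Computability.encodeNat (I (ofCode (revCode (codeSize w + m i)
              (sumMatrix w (B i)))) % p)).foldl rd (v.1, c i, b'), Mem.cells id w) := by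
          rw [StackProg.queryDen]
          simp only [Prod.mk.eta] at hb ⊢
          rw [hb]
        have hiso : I (ofCode (revCode (codeSize w + m i) (sumMatrix w (B i)))) =
            I ((ofCode w).sum (K i)) :=
          (hI _ _ (sumMatrixIso w ((K i).transport (e i)) fun a b => by simp [B, transport])).trans
            (hI _ _ (Iso.sumCongr (RelIso.refl _) (transportIso (e i) (K i))))
        rw [List.map_cons, List.foldl_cons, hq, ih, hiso, foldl_encodeNat]
        simp [add_assoc]
    rw [key]
    simp [Finset.sum_map_toList]

/-! ### Inclusion–exclusion over identifications of vertices -/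

/-- Inclusion–exclusion for the elements of a finite type with property `P` that have none of the
properties `Q d` with `d ∈ s`. -/
theorem sum_powerset_neg_one_pow_mul_card {A D R : Type} [Finite A] [CommRing R]
    (s : Finset D) (P : A → Prop) (Q : D → A → Prop) :
    ∑ E ∈ s.powerset, (-1) ^ E.card * (Nat.card {a // P a ∧ ∀ d ∈ E, Q d a} : R) =
      Nat.card {a // P a ∧ ∀ d ∈ s, ¬ Q d a} := by
  classical
  have := Fintype.ofFinite A
  have hcard : ∀ T : A → Prop, (Nat.card {a // T a} : R) = ∑ a, if T a then 1 else 0 := by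
    intro T
    rw [Nat.card_eq_fintype_card, Fintype.card_subtype, Finset.card_filter]
    push_cast
    rfl
  simp only [hcard, Finset.mul_sum]
  rw [Finset.sum_comm]
  refine Finset.sum_congr rfl fun a _ => ?_
  by_cases hP : P a
  · simp only [hP, true_and]
    -- The product over `d` of 1 plus the signed indicator of `Q d` is the indicator that no `Q d`
    -- holds; its expansion runs over the subsets of `s`.
    have h := Finset.prod_add_one (f := fun d => if Q d a then (-1 : R) else 0) (s := s)
    have h₁ : ∀ d, (if Q d a then (-1 : R) else 0) + 1 = if ¬ Q d a then 1 else 0 := by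
      intro d
      by_cases h : Q d a <;> simp [h]
    simp only [h₁] at h
    rw [Finset.prod_ite_zero, Finset.prod_const_one] at h
    rw [h]
    refine Finset.sum_congr rfl fun E _ => ?_
    rw [Finset.prod_ite_zero, Finset.prod_const]
    simp
  · simp [hP]

namespace LoopGraph

variable {V W U : Type}

/-- The images of the edges under a homomorphism. -/
def edgeImage {G : LoopGraph W} {H : LoopGraph V} (σ : G.Hom H) : Set (V × V) :=
  {e | ∃ a b, G.Adj a b ∧ σ a = e.1 ∧ σ b = e.2}

/-- The number of homomorphisms whose images of vertices and edges have the property `P`. -/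
noncomputable def numImage (P : Set V → Set (V × V) → Prop) (G : LoopGraph W) (H : LoopGraph V) :
    ℕ :=
  Nat.card {σ : G.Hom H // P (Set.range σ) (edgeImage σ)}

/-- The property of the image that defines surjections. -/
def Covers (R : Set V) (_ : Set (V × V)) : Prop := R = Set.univ

/-- The property of the image that defines compactions to `H`. -/
def CoversEdges (H : LoopGraph V) (R : Set V) (E : Set (V × V)) : Prop :=
  R = Set.univ ∧ ∀ u v, H.Adj u v → u ≠ v → (u, v) ∈ E

theorem coversEdges_univ (H : LoopGraph V) (E : Set (V × V))
    (h : {e : V × V | H.Adj e.1 e.2} ⊆ E) :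
    CoversEdges H Set.univ E := ⟨rfl, fun _ _ huv _ => h huv⟩

theorem numVertSurj_eq (G : LoopGraph W) (H : LoopGraph V) :
    G.numVertSurj H = numImage Covers G H := by
  simp only [numVertSurj, numImage, Covers, Set.range_eq_univ]

theorem numCompaction_eq (G : LoopGraph W) (H : LoopGraph V) :
    G.numCompaction H = numImage (CoversEdges H) G H := by
  simp only [numCompaction, numImage, CoversEdges, Set.range_eq_univ, edgeImage, Set.mem_ofPred_eq]

theorem numImage_congr (P : Set V → Set (V × V) → Prop) {G : LoopGraph W} {G' : LoopGraph U}
    (e : G.Iso G') (H : LoopGraph V) : numImage P G H = numImage P G' H := by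
  refine Nat.card_congr (Equiv.subtypeEquiv
    ⟨fun σ => σ.comp e.symm.toRelEmbedding.toRelHom, fun σ => σ.comp e.toRelEmbedding.toRelHom,
      fun σ => ?_, fun σ => ?_⟩ fun σ => ?_)
  · ext a
    exact congrArg σ (e.symm_apply_apply a)
  · ext a
    exact congrArg σ (e.apply_symm_apply a)
  · have h₁ : Set.range (σ.comp e.symm.toRelEmbedding.toRelHom) = Set.range σ :=
      e.symm.surjective.range_comp σ
    have h₂ : edgeImage (σ.comp e.symm.toRelEmbedding.toRelHom) = edgeImage σ := by
      ext q
      constructor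
      · rintro ⟨a, b, h, h'⟩
        exact ⟨e.symm a, e.symm b, e.symm.map_rel_iff.2 h, h'⟩
      · rintro ⟨a, b, h, h₁, h₂⟩
        exact ⟨e a, e b, e.map_rel_iff.2 h, (congrArg σ (e.symm_apply_apply a)).trans h₁,
          (congrArg σ (e.symm_apply_apply b)).trans h₂⟩
    exact iff_of_eq (congrArg₂ P h₁.symm h₂.symm)

/-- The graph that results from the identification of pairs of vertices. -/
def quot (F : LoopGraph U) (E : Finset (U × U)) : LoopGraph (Quot fun x y => (x, y) ∈ E) where
  Adj a b := ∃ x y, Quot.mk _ x = a ∧ Quot.mk _ y = b ∧ F.Adj x y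
  symm := fun _ _ ⟨x, y, hx, hy, h⟩ => ⟨y, x, hy, hx, F.symm _ _ h⟩

/-- A homomorphism from the union is a pair of homomorphisms whose second member is constant on the
pairs in `E`. Passing to the quotient changes neither the image of the vertices nor that of the
edges, so any property of the joint image is kept. -/
theorem numImage_sum_quot (P : Set V → Set (V × V) → Prop) (G : LoopGraph W) (F : LoopGraph U)
    (H : LoopGraph V) (E : Finset (U × U)) : numImage P (G.sum (F.quot E)) H =
      Nat.card {q : G.Hom H × F.Hom H // P (Set.range q.1 ∪ Set.range q.2)
        (edgeImage q.1 ∪ edgeImage q.2) ∧ ∀ e ∈ E, q.2 e.1 = q.2 e.2} := by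
  let toFun : (G.sum (F.quot E)).Hom H → G.Hom H × F.Hom H := fun ψ =>
    (⟨fun a => ψ (.inl a), fun h => ψ.map_rel (.inl h)⟩,
      ⟨fun x => ψ (.inr (Quot.mk _ x)), fun h => ψ.map_rel (.inr ⟨_, _, rfl, rfl, h⟩)⟩)
  have hrange : ∀ ψ, Set.range (toFun ψ).1 ∪ Set.range (toFun ψ).2 = Set.range ψ := by
    intro ψ
    ext v
    constructor
    · rintro (⟨a, rfl⟩ | ⟨a, rfl⟩)
      · exact ⟨_, rfl⟩
      · exact ⟨_, rfl⟩
    · rintro ⟨a | ⟨⟨a⟩⟩, rfl⟩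
      · exact .inl ⟨a, rfl⟩
      · exact .inr ⟨a, rfl⟩
  have hedge : ∀ ψ, edgeImage (toFun ψ).1 ∪ edgeImage (toFun ψ).2 = edgeImage ψ := by
    intro ψ
    ext e
    constructor
    · rintro (⟨a, b, h, h'⟩ | ⟨a, b, h, h'⟩)
      · exact ⟨_, _, .inl h, h'⟩
      · exact ⟨_, _, .inr ⟨_, _, rfl, rfl, h⟩, h'⟩
    · rintro ⟨_, _, ⟨h⟩ | ⟨_, _, rfl, rfl, h⟩, h'⟩
      · exact .inl ⟨_, _, h, h'⟩
      · exact .inr ⟨_, _, h, h'⟩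
  refine Nat.card_congr ⟨fun ψ => ⟨toFun ψ, ?_, ?_⟩, fun q => ⟨⟨Sum.elim q.1.1
    (Quot.lift q.1.2 fun x y h => q.2.2 _ h), ?_⟩, ?_⟩, ?_, ?_⟩
  · rw [hrange, hedge]
    exact ψ.2
  · exact fun e he => congrArg (fun a => ψ.1 (.inr a)) (Quot.sound he)
  · rintro _ _ (h | ⟨_, _, rfl, rfl, h⟩)
    · exact q.1.1.map_rel h
    · exact q.1.2.map_rel h
  · rw [← hrange, ← hedge]
    exact q.2.1
  · intro ψ
    refine Subtype.ext (RelHom.ext ?_)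
    rintro (a | ⟨⟨a⟩⟩) <;> rfl
  · intro q
    rfl

/-- Injectivity means that none of the events `q.2 x = q.2 y` with `x ≠ y` occurs; the signed sum
sieves out these events. -/
theorem sum_numImage_quot {R : Type} [CommRing R] [DecidableEq U] [Fintype U]
    [Finite V] [Finite W]
    (P : Set V → Set (V × V) → Prop) (G : LoopGraph W) (F : LoopGraph U) (H : LoopGraph V) :
    ∑ E ∈ (Finset.univ : Finset U).offDiag.powerset,
      (-1) ^ E.card * (numImage P (G.sum (F.quot E)) H : R) =
      Nat.card {q : G.Hom H × F.Hom H // P (Set.range q.1 ∪ Set.range q.2)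
        (edgeImage q.1 ∪ edgeImage q.2) ∧ Function.Injective q.2} := by
  have : Finite (G.Hom H) := DFunLike.finite _
  have : Finite (F.Hom H) := DFunLike.finite _
  simp only [numImage_sum_quot]
  rw [sum_powerset_neg_one_pow_mul_card _
    (fun q : G.Hom H × F.Hom H => P (Set.range q.1 ∪ Set.range q.2)
      (edgeImage q.1 ∪ edgeImage q.2)) (fun (e : U × U) q => q.2 e.1 = q.2 e.2)]
  congr 2
  refine congrArg _ (funext fun q => congrArg _ (propext ?_))
  simp only [Finset.mem_offDiag, Finset.mem_univ, true_and, Prod.forall]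
  exact ⟨fun h x y hxy => by_contra fun hne => h x y hne hxy, fun h x y hne hxy => hne (h hxy)⟩

/-- A bijective endomorphism of a finite graph is an automorphism. -/
noncomputable def autOfInjective [Finite V] {H : LoopGraph V} (τ : H.Hom H)
    (hτ : Function.Injective τ) : H.Aut where
  toEquiv := Equiv.ofBijective τ (Finite.injective_iff_bijective.1 hτ)
  map_rel_iff' {a b} := by
    refine ⟨fun h => ?_, fun h => τ.map_rel h⟩
    let f : {e : V × V // H.Adj e.1 e.2} → {e : V × V // H.Adj e.1 e.2} :=
      fun e => ⟨(τ e.1.1, τ e.1.2), τ.map_rel e.2⟩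
    have hf : Function.Injective f := by
      rintro ⟨⟨a, b⟩, h⟩ ⟨⟨c, d⟩, h'⟩ he
      simp only [f, Subtype.mk.injEq, Prod.mk.injEq] at he ⊢
      exact ⟨hτ he.1, hτ he.2⟩
    obtain ⟨⟨⟨c, d⟩, h'⟩, he⟩ := Finite.surjective_of_injective hf ⟨(τ a, τ b), h⟩
    have he' := Prod.ext_iff.1 (Subtype.ext_iff.1 he)
    have h₁ : c = a := hτ he'.1
    have h₂ : d = b := hτ he'.2
    rwa [← h₁, ← h₂]

/-- Injective endomorphisms of a finite graph are the same as automorphisms. -/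
noncomputable def injectiveEquivAut [Finite V] (H : LoopGraph V) :
    {τ : H.Hom H // Function.Injective τ} ≃ H.Aut where
  toFun τ := autOfInjective τ.1 τ.2
  invFun ρ := ⟨ρ.toRelEmbedding.toRelHom, ρ.injective⟩
  left_inv _ := rfl
  right_inv _ := RelIso.ext fun _ => rfl

/-- Both image properties hold if an automorphism is among the homomorphisms. -/
theorem card_image_union_aut [Finite V] (P : Set V → Set (V × V) → Prop) (G : LoopGraph W)
    (H : LoopGraph V) (hP : ∀ E, {e : V × V | H.Adj e.1 e.2} ⊆ E → P Set.univ E) :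
    Nat.card {q : G.Hom H × H.Hom H // P (Set.range q.1 ∪ Set.range q.2)
      (edgeImage q.1 ∪ edgeImage q.2) ∧ Function.Injective q.2} =
      G.numHom H * Nat.card H.Aut := by
  rw [numHom, ← Nat.card_prod]
  refine Nat.card_congr (Equiv.trans (Equiv.subtypeEquivRight fun q => ?_)
    ((⟨fun q => (q.1.1, ⟨q.1.2, q.2⟩), fun q => ⟨(q.1, q.2.1), q.2.2⟩, fun _ => rfl,
      fun _ => rfl⟩ : {q : G.Hom H × H.Hom H // Function.Injective q.2} ≃
        G.Hom H × {τ : H.Hom H // Function.Injective τ}).trans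
      (Equiv.prodCongr (Equiv.refl _) (injectiveEquivAut H))))
  refine and_iff_right_of_imp fun hq => ?_
  have h := autOfInjective q.2 hq
  have h₁ : Set.range q.2 = Set.univ :=
    Set.range_eq_univ.2 (Finite.injective_iff_surjective.1 hq)
  rw [h₁, Set.union_univ]
  refine hP _ (Set.subset_union_of_subset_right ?_ _)
  rintro ⟨u, v⟩ huv
  set ρ := autOfInjective q.2 hq with hρ
  exact ⟨ρ.symm u, ρ.symm v, ρ.symm.map_rel_iff.2 huv, ρ.apply_symm_apply u, ρ.apply_symm_apply v⟩

/-- Cauchy's theorem. -/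
theorem card_aut_ne_zero [Finite V] {H : LoopGraph V} {p : ℕ} (hp : p.Prime)
    (h : ¬ H.HasAutOfOrder p) : (Nat.card H.Aut : ZMod p) ≠ 0 := by
  have : Fact p.Prime := ⟨hp⟩
  have : Finite H.Aut := Finite.of_injective (fun ρ : H.Aut => (ρ : V → V)) DFunLike.coe_injective
  rw [Ne, ZMod.natCast_eq_zero_iff]
  exact fun hd => h (exists_prime_orderOf_dvd_card' p hd)

/-! ### Rectangular graphs and the deletion of an edge -/

/-- The graph without the edge `uv`. -/
def deleteEdge (H : LoopGraph V) (u v : V) : LoopGraph V where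
  Adj a b := H.Adj a b ∧ s(a, b) ≠ s(u, v)
  symm a b h := ⟨H.symm _ _ h.1, by rw [Sym2.eq_swap]; exact h.2⟩

/-- Every walk of length three has adjacent ends. -/
def IsRectangular (H : LoopGraph V) : Prop :=
  ∀ a b c d, H.Adj a b → H.Adj b c → H.Adj c d → H.Adj a d

/-- In a complete bipartite component a walk of odd length changes sides. -/
theorem ComponentsBicliqueOrReflexive.isRectangular {H : LoopGraph V}
    (h : H.ComponentsBicliqueOrReflexive) : H.IsRectangular := by
  intro a b c d hab hbc hcd
  have ha : a ∈ H.component a := .refl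
  have hb : b ∈ H.component a := Relation.ReflTransGen.tail ha hab
  have hc : c ∈ H.component a := Relation.ReflTransGen.tail hb hbc
  have hd : d ∈ H.component a := Relation.ReflTransGen.tail hc hcd
  rcases h a with ⟨L, hL⟩ | h
  · have h₁ := (hL ⟨a, ha⟩ ⟨b, hb⟩).1 hab
    have h₂ := (hL ⟨b, hb⟩ ⟨c, hc⟩).1 hbc
    have h₃ := (hL ⟨c, hc⟩ ⟨d, hd⟩).1 hcd
    exact (hL ⟨a, ha⟩ ⟨d, hd⟩).2 (by tauto)
  · exact h ⟨a, ha⟩ ⟨d, hd⟩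

section DeleteEdge

variable {H : LoopGraph V} {u v x y : V}

theorem not_isRectangular_deleteEdge (h₁ : (H.deleteEdge u v).Adj u x)
    (h₂ : (H.deleteEdge u v).Adj x y) (h₃ : (H.deleteEdge u v).Adj y v) :
    ¬ (H.deleteEdge u v).IsRectangular := fun h => (h _ _ _ _ h₁ h₂ h₃).2 rfl

/-- A homomorphism from `H` without the edge `uv` is a homomorphism from `H`, if there is another
walk of length three from `u` to `v`. -/
def homOfDeleteEdge (hH : H.IsRectangular) (h₁ : (H.deleteEdge u v).Adj u x)
    (h₂ : (H.deleteEdge u v).Adj x y) (h₃ : (H.deleteEdge u v).Adj y v)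
    (τ : (H.deleteEdge u v).Hom H) : H.Hom H where
  toFun := τ
  map_rel' {a b} h := by
    have huv : H.Adj (τ u) (τ v) := hH _ _ _ _ (τ.map_rel h₁) (τ.map_rel h₂) (τ.map_rel h₃)
    by_cases hab : s(a, b) = s(u, v)
    · rcases Sym2.eq_iff.1 hab with ⟨rfl, rfl⟩ | ⟨rfl, rfl⟩
      · exact huv
      · exact H.symm _ _ huv
    · exact τ.map_rel ⟨h, hab⟩

/-- Homomorphisms to `H` without the edge `uv` are the homomorphisms to `H` that avoid this edge. -/
def homDeleteEdgeEquiv (G : LoopGraph W) (H : LoopGraph V) (u v : V) :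
    G.Hom (H.deleteEdge u v) ≃ {σ : G.Hom H // ¬ ((u, v) ∈ edgeImage σ)} where
  toFun σ := ⟨⟨σ, fun h => (σ.map_rel h).1⟩, fun ⟨a, b, h, ha, hb⟩ =>
    (σ.map_rel h).2 (congrArg₂ (fun a b => s(a, b)) ha hb)⟩
  invFun σ := ⟨σ.1, fun {a b} h => ⟨σ.1.map_rel h, fun hab => σ.2 (by
    rcases Sym2.eq_iff.1 hab with ⟨ha, hb⟩ | ⟨ha, hb⟩
    · exact ⟨a, b, h, ha, hb⟩
    · exact ⟨b, a, G.symm _ _ h, hb, ha⟩)⟩⟩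
  left_inv _ := rfl
  right_inv _ := rfl

/-- An injective `τ` from H - uv to `H` is an automorphism ρ of `H` on vertices. Its edge image
lacks exactly the image of the edge uv, so the pair covers `H` if and only if σ uses the edge
ρ(u)ρ(v), that is, ρ⁻¹σ uses uv. This leaves |Aut H| times the number of homomorphisms that use uv.
The other homomorphisms to `H` are those to H - uv. -/
theorem card_image_union_deleteEdge [Finite V] [Finite W] (hH : H.IsRectangular) (huv : H.Adj u v)
    (hne : u ≠ v) (h₁ : (H.deleteEdge u v).Adj u x) (h₂ : (H.deleteEdge u v).Adj x y)
    (h₃ : (H.deleteEdge u v).Adj y v) (G : LoopGraph W) :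
    Nat.card {q : G.Hom H × (H.deleteEdge u v).Hom H //
      CoversEdges H (Set.range q.1 ∪ Set.range q.2) (edgeImage q.1 ∪ edgeImage q.2) ∧
        Function.Injective q.2} + G.numHom (H.deleteEdge u v) * Nat.card H.Aut =
      G.numHom H * Nat.card H.Aut := by
  have : Finite (G.Hom H) := DFunLike.finite _
  have : Finite H.Aut := Finite.of_injective (fun ρ : H.Aut => (ρ : V → V)) DFunLike.coe_injective
  have hsum : G.numHom H = Nat.card {σ : G.Hom H // (u, v) ∈ edgeImage σ} +
      G.numHom (H.deleteEdge u v) := by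
    rw [numHom, numHom, Nat.card_congr (homDeleteEdgeEquiv G H u v), ← Nat.card_sum]
    classical
    exact Nat.card_congr (Equiv.sumCompl _).symm
  rw [hsum, add_mul, ← Nat.card_prod]
  refine congrArg (· + _) (Nat.card_congr ?_)
  let aut : ∀ τ : (H.deleteEdge u v).Hom H, Function.Injective τ → H.Aut := fun τ hτ =>
    autOfInjective (homOfDeleteEdge hH h₁ h₂ h₃ τ) hτ
  -- Stated for any ρ that agrees with τ on vertices, because both directions of the bijection below
  -- use it.
  have hcov : ∀ (σ : G.Hom H) (ρ : H.Aut) (τ : (H.deleteEdge u v).Hom H), (∀ a, τ a = ρ a) →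
      (CoversEdges H (Set.range σ ∪ Set.range τ) (edgeImage σ ∪ edgeImage τ) ↔
        (u, v) ∈ edgeImage (ρ.symm.toRelEmbedding.toRelHom.comp σ)) := by
    intro σ ρ τ hτ
    have hrange : Set.range τ = Set.univ := by
      rw [Set.range_eq_univ]
      exact fun a => ⟨ρ.symm a, (hτ _).trans (ρ.apply_symm_apply a)⟩
    constructor
    · rintro ⟨-, h⟩
      rcases h (ρ u) (ρ v) (ρ.map_rel_iff.2 huv) (ρ.injective.ne hne) with
        ⟨a, b, h, ha, hb⟩ | ⟨a, b, h, ha, hb⟩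
      · exact ⟨a, b, h, (congrArg ρ.symm ha).trans (ρ.symm_apply_apply u),
          (congrArg ρ.symm hb).trans (ρ.symm_apply_apply v)⟩
      · rw [hτ] at ha hb
        rw [ρ.injective ha, ρ.injective hb] at h
        exact absurd rfl h.2
    · rintro ⟨a, b, h, ha, hb⟩
      have ha' : σ a = ρ u := (ρ.apply_symm_apply _).symm.trans (congrArg ρ ha)
      have hb' : σ b = ρ v := (ρ.apply_symm_apply _).symm.trans (congrArg ρ hb)
      refine ⟨by rw [hrange, Set.union_univ], fun c d hcd _ => ?_⟩
      have hcd' : H.Adj (ρ.symm c) (ρ.symm d) := ρ.symm.map_rel_iff.2 hcd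
      by_cases he : s(ρ.symm c, ρ.symm d) = s(u, v)
      · rcases Sym2.eq_iff.1 he with ⟨hc, hd⟩ | ⟨hc, hd⟩
        · exact .inl ⟨a, b, h, by rw [ha', ← hc]; exact ρ.apply_symm_apply c,
            by rw [hb', ← hd]; exact ρ.apply_symm_apply d⟩
        · exact .inl ⟨b, a, G.symm _ _ h, by rw [hb', ← hc]; exact ρ.apply_symm_apply c,
            by rw [ha', ← hd]; exact ρ.apply_symm_apply d⟩
      · exact .inr ⟨_, _, ⟨hcd', he⟩, (hτ _).trans (ρ.apply_symm_apply c),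
          (hτ _).trans (ρ.apply_symm_apply d)⟩
  -- The bijection sends (σ, τ) to (ρ⁻¹σ, ρ); the twist moves the edge to be covered from ρ(u)ρ(v)
  -- to the fixed edge uv.
  refine ⟨fun q => (⟨(aut q.1.2 q.2.2).symm.toRelEmbedding.toRelHom.comp q.1.1,
      (hcov _ (aut q.1.2 q.2.2) _ fun _ => rfl).1 q.2.1⟩, aut q.1.2 q.2.2),
    fun r => ⟨(r.2.toRelEmbedding.toRelHom.comp r.1.1,
      ⟨r.2, fun h => r.2.map_rel_iff.2 h.1⟩), (hcov _ r.2 _ fun _ => rfl).2 ?_, r.2.injective⟩,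
    fun q => ?_, fun r => ?_⟩
  · obtain ⟨a, b, h, ha, hb⟩ := r.1.2
    exact ⟨a, b, h, (r.2.symm_apply_apply _).trans ha, (r.2.symm_apply_apply _).trans hb⟩
  · refine Subtype.ext (Prod.ext (RelHom.ext fun a => ?_) rfl)
    exact (aut q.1.2 q.2.2).apply_symm_apply _
  · refine Prod.ext (Subtype.ext (RelHom.ext fun a => ?_)) (RelIso.ext fun _ => rfl)
    exact (aut ⟨r.2, fun h => r.2.map_rel_iff.2 h.1⟩ r.2.injective).symm_apply_apply (r.1.1 a)

/-- An automorphism of H - uv is an injective homomorphism to `H`, hence an automorphism of `H` with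
the same underlying permutation and the same order. -/
theorem not_hasAutOfOrder_deleteEdge [Finite V] (hH : H.IsRectangular)
    (h₁ : (H.deleteEdge u v).Adj u x) (h₂ : (H.deleteEdge u v).Adj x y)
    (h₃ : (H.deleteEdge u v).Adj y v) {p : ℕ} (h : ¬ H.HasAutOfOrder p) :
    ¬ (H.deleteEdge u v).HasAutOfOrder p := by
  rintro ⟨ρ, hρ⟩
  let τ := homOfDeleteEdge hH h₁ h₂ h₃ ⟨ρ, fun h => (ρ.map_rel_iff.2 h).1⟩
  refine h ⟨autOfInjective τ ρ.injective, ?_⟩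
  have key : ∀ F : LoopGraph V, ∀ ρ : F.Aut, orderOf ρ = orderOf (ρ.toEquiv : Equiv.Perm V) :=
    fun F ρ => (orderOf_injective
      (⟨⟨RelIso.toEquiv, rfl⟩, fun _ _ => rfl⟩ : F.Aut →* Equiv.Perm V)
      RelIso.toEquiv_injective ρ).symm
  rw [← hρ, key, key]
  exact congrArg orderOf (Equiv.ext fun _ => rfl)

end DeleteEdge

theorem eq_of_mem_component {H : LoopGraph V} {r : V} (h : ∀ a, ¬ H.Adj r a) {a : V}
    (ha : a ∈ H.component r) : a = r := by
  rcases Relation.ReflTransGen.cases_head ha with h' | ⟨b, hb, -⟩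
  · exact h'.symm
  · exact absurd hb (h b)

/-- If one side is empty, the component has no edges and consists of `r` alone; if it is a single
vertex, this vertex is the centre. -/
theorem isStar_of_subsingleton {H : LoopGraph V} {r : V} {L : Set (H.component r)}
    (hL : ∀ a b, (H.induce (H.component r)).Adj a b ↔ ((a ∈ L ∧ b ∉ L) ∨ (a ∉ L ∧ b ∈ L)))
    (h : L.Subsingleton) : (H.induce (H.component r)).IsStar := by
  rcases h.eq_empty_or_singleton with rfl | ⟨c, rfl⟩
  · have hr : ∀ a, ¬ H.Adj r a := by
      intro a ha
      have := (hL ⟨r, .refl⟩ ⟨a, .single ha⟩).1 ha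
      simp at this
    refine ⟨⟨r, .refl⟩, fun a b => ?_⟩
    have ha : a = ⟨r, .refl⟩ := Subtype.ext (eq_of_mem_component hr a.2)
    have hb : b = ⟨r, .refl⟩ := Subtype.ext (eq_of_mem_component hr b.2)
    rw [hL, ha, hb]
    simp
  · exact ⟨c, fun a b => by simpa using hL a b⟩

/-- A complete bipartite component that is not a star has two vertices on each side, hence a
4-cycle, and three of its edges go around the fourth. In a reflexive clique with three vertices u,
v, w, a loop extends the detour through w to length three. -/
theorem exists_deleteEdge_walk [Finite V] {H : LoopGraph V} (h : H.ComponentsBicliqueOrReflexive)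
    (h' : ¬ H.ComponentsStarOrSmallReflexive) : ∃ u v x y, u ≠ v ∧ H.Adj u v ∧
      (H.deleteEdge u v).Adj u x ∧ (H.deleteEdge u v).Adj x y ∧ (H.deleteEdge u v).Adj y v := by
  rw [ComponentsStarOrSmallReflexive] at h'
  push Not at h'
  obtain ⟨r, hr, hr'⟩ := h'
  rcases h r with ⟨L, hL⟩ | hC
  · have hL₁ : ¬ L.Subsingleton := fun hs => hr (isStar_of_subsingleton hL hs)
    have hL₂ : ¬ (Lᶜ).Subsingleton := fun hs => hr (isStar_of_subsingleton (L := Lᶜ)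
      (fun a b => (hL a b).trans (by simp only [Set.mem_compl_iff]; tauto)) hs)
    obtain ⟨u, hu, u', hu', huu⟩ := Set.not_subsingleton_iff.1 hL₁
    obtain ⟨v, hv, v', hv', hvv⟩ := Set.not_subsingleton_iff.1 hL₂
    rw [Set.mem_compl_iff] at hv hv'
    have hadj : ∀ a b, a ∈ L → b ∉ L → H.Adj a b := fun a b ha hb => (hL a b).2 (.inl ⟨ha, hb⟩)
    have hne : ∀ a b, a ∈ L → b ∉ L → (a : V) ≠ b := fun a b ha hb hab =>
      hb (Subtype.ext hab ▸ ha)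
    have hu₁ : (u : V) ≠ u' := fun e => huu (Subtype.ext e)
    have hv₁ : (v : V) ≠ v' := fun e => hvv (Subtype.ext e)
    refine ⟨u, v, v', u', hne _ _ hu hv, hadj _ _ hu hv, ⟨hadj _ _ hu hv', ?_⟩,
      ⟨H.symm _ _ (hadj _ _ hu' hv'), ?_⟩, ⟨hadj _ _ hu' hv, ?_⟩⟩
    · simp [hv₁.symm, hne _ _ hu hv]
    · simp [hv₁.symm, (hne _ _ hu hv').symm]
    · simp [hu₁.symm, hne _ _ hu' hv]
  · have h₃ := hr' hC
    rw [Nat.card_coe_set_eq, Set.two_lt_ncard_iff (Set.toFinite _)] at h₃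
    obtain ⟨u, v, w, hu, hv, hw, huv, huw, hvw⟩ := h₃
    -- The walk u, w, v, v ends with the loop at v, which survives the deletion of uv.
    refine ⟨u, v, w, v, huv, hC ⟨u, hu⟩ ⟨v, hv⟩, ⟨hC ⟨u, hu⟩ ⟨w, hw⟩, ?_⟩,
      ⟨hC ⟨w, hw⟩ ⟨v, hv⟩, ?_⟩, ⟨hC ⟨v, hv⟩ ⟨v, hv⟩, ?_⟩⟩
    · simp [hvw.symm, huv]
    · simp [huw.symm, hvw.symm]
    · simp [huv.symm]

end LoopGraph

/-! ### Hardness -/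

open LoopGraph

section Hardness

variable {p : ℕ} {V : Type} [Finite V] {H : LoopGraph V}

/-- Without automorphisms of order `p`, `H` is its own reduced form. -/
theorem FabenJerrumConjecture.sharpModPHard (h : FabenJerrumConjecture) (hp : p.Prime)
    (hH : ¬ H.HasAutOfOrder p) (hH' : ¬ H.ComponentsBicliqueOrReflexive) :
    SharpModPHard p (homsProblem H p) :=
  ((h p hp V H V H ⟨.iso (RelIso.refl _), hH⟩).2 hH').2

/-- The number of homomorphisms is a linear combination of numbers of homomorphisms with a property
that is satisfied by every image that covers the target. -/
theorem card_aut_mul_numHom {W : Type} [Finite W] [Fintype V] [DecidableEq V]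
    (P : Set V → Set (V × V) → Prop)
    (hP : ∀ E, {e : V × V | H.Adj e.1 e.2} ⊆ E → P Set.univ E) (G : LoopGraph W) :
    (Nat.card H.Aut * G.numHom H : ZMod p) = ∑ E ∈ (Finset.univ : Finset V).offDiag.powerset,
      (-1) ^ E.card * (numImage P (G.sum (H.quot E)) H : ZMod p) := by
  rw [sum_numImage_quot, card_image_union_aut P G H hP]
  push_cast
  ring

theorem sharpModPHard_numImage (hp : p.Prime) (hH : ¬ H.HasAutOfOrder p)
    (P : Set V → Set (V × V) → Prop)
    (hP : ∀ E, {e : V × V | H.Adj e.1 e.2} ⊆ E → P Set.univ E)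
    (h : SharpModPHard p (homsProblem H p)) :
    SharpModPHard p fun w => numImage P (ofCode w) H % p := by
  classical
  have := Fintype.ofFinite V
  have : Fact p.Prime := ⟨hp⟩
  intro f hf
  refine (h f hf).of_sum (fun G => numImage P G H) (fun G G' e => numImage_congr P e H)
    (Finset.univ : Finset V).offDiag.powerset
    (fun E => (Nat.card H.Aut : ZMod p)⁻¹ * (-1) ^ E.card) (fun E => H.quot E) fun w => ?_
  have key := card_aut_mul_numHom (p := p) P hP (ofCode w)
  simp only [mul_assoc]
  rw [← Finset.mul_sum, ← key, inv_mul_cancel_left₀ (card_aut_ne_zero hp hH), ZMod.val_natCast,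
    homsProblem]

theorem FabenJerrumConjecture.sharpModPHard_vertSurj (h : FabenJerrumConjecture) (hp : p.Prime)
    (hH : ¬ H.HasAutOfOrder p) (hH' : ¬ H.ComponentsBicliqueOrReflexive) :
    SharpModPHard p (vertSurjProblem H p) := by
  have := sharpModPHard_numImage hp hH Covers (fun _ _ => rfl) (h.sharpModPHard hp hH hH')
  unfold vertSurjProblem
  simpa only [← numVertSurj_eq] using this

/-- If counting homomorphisms to `H` is already hard, the general reduction applies. Otherwise `H`
is rectangular, and the hard problem is the one for `H` without a suitable edge. -/
theorem FabenJerrumConjecture.sharpModPHard_compaction (h : FabenJerrumConjecture) (hp : p.Prime)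
    (hH : ¬ H.HasAutOfOrder p) (hH' : ¬ H.ComponentsStarOrSmallReflexive) :
    SharpModPHard p (compactionProblem H p) := by
  classical
  have := Fintype.ofFinite V
  have : Fact p.Prime := ⟨hp⟩
  unfold compactionProblem
  simp only [numCompaction_eq]
  by_cases hc : H.ComponentsBicliqueOrReflexive
  · obtain ⟨u, v, x, y, hne, huv, h₁, h₂, h₃⟩ := exists_deleteEdge_walk hc hH'
    have hrect := hc.isRectangular
    have hard := h.sharpModPHard (H := H.deleteEdge u v) hp
      (not_hasAutOfOrder_deleteEdge hrect h₁ h₂ h₃ hH)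
      (fun hc => not_isRectangular_deleteEdge h₁ h₂ h₃ hc.isRectangular)
    intro f hf
    let F : Bool → LoopGraph V := fun b => if b then H else H.deleteEdge u v
    refine (hard f hf).of_sum (fun G => numImage (CoversEdges H) G H)
      (fun G G' e => numImage_congr _ e H)
      ((Finset.univ : Finset Bool) ×ˢ (Finset.univ : Finset V).offDiag.powerset)
      -- The signed sum for `H` is |Aut H|·hom(G, H), the one for H - uv is |Aut H|·(hom(G, H) -
      -- hom(G, H - uv)); their difference isolates hom(G, H - uv).
      (fun i => (Nat.card H.Aut : ZMod p)⁻¹ * (if i.1 then 1 else -1) * (-1) ^ i.2.card)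
      (fun i => (F i.1).quot i.2) fun w => ?_
    have key₁ := card_aut_mul_numHom (p := p) _ (coversEdges_univ H) (ofCode w)
    have key₂ := sum_numImage_quot (R := ZMod p) (CoversEdges H) (ofCode w) (H.deleteEdge u v) H
    have key₃ := congrArg (fun k : ℕ => (k : ZMod p))
      (card_image_union_deleteEdge hrect huv hne h₁ h₂ h₃ (ofCode w))
    rw [Finset.sum_product]
    simp only [Fintype.sum_bool, F, mul_assoc, ← Finset.mul_sum, if_true, Bool.false_eq_true,
      if_false]
    rw [← key₁, key₂]
    push_cast at key₃
    rw [homsProblem, ← ZMod.val_natCast]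
    refine congrArg ZMod.val ((eq_inv_mul_iff_mul_eq₀ (card_aut_ne_zero hp hH)).2 ?_)
    linear_combination key₃
  · exact sharpModPHard_numImage hp hH _ (coversEdges_univ H) (h.sharpModPHard hp hH hc)

end Hardness

/-! ### Automorphisms of order p -/

namespace LoopGraph

variable {V W : Type}

/-- If the target has an automorphism of order `p` that preserves `P`, and `P` implies surjectivity,
then the number of homomorphisms with property `P` is divisible by `p`. -/
theorem HasAutOfOrder.dvd_numImage [Finite V] [Finite W] {H : LoopGraph V} {p : ℕ} (hp : p.Prime)
    (h : H.HasAutOfOrder p) (P : Set V → Set (V × V) → Prop) (hP : ∀ R E, P R E → R = Set.univ)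
    (hP' : ∀ (ρ : H.Aut) (R : Set V) (E : Set (V × V)), P R E →
      P (ρ '' R) ((fun e => (ρ e.1, ρ e.2)) '' E)) (G : LoopGraph W) : p ∣ numImage P G H := by
  classical
  obtain ⟨ρ, hρ⟩ := h
  have : Fact p.Prime := ⟨hp⟩
  have : Finite (G.Hom H) := DFunLike.finite _
  let X := {σ : G.Hom H // P (Set.range σ) (edgeImage σ)}
  have : Fintype X := Fintype.ofFinite X
  let f : X → X := fun σ => ⟨ρ.toRelEmbedding.toRelHom.comp σ.1, by
    have h := hP' ρ _ _ σ.2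
    rw [← Set.range_comp] at h
    have he : edgeImage (ρ.toRelEmbedding.toRelHom.comp σ.1) =
        (fun e => (ρ e.1, ρ e.2)) '' edgeImage σ.1 := by
      refine Set.ext fun e => ⟨?_, ?_⟩
      · rintro ⟨a, b, h, h'⟩
        exact ⟨(σ.1 a, σ.1 b), ⟨a, b, h, rfl, rfl⟩, Prod.ext h'.1 h'.2⟩
      · rintro ⟨e, ⟨a, b, h, ha, hb⟩, rfl⟩
        exact ⟨a, b, h, congrArg ρ ha, congrArg ρ hb⟩
    rw [he]
    exact h⟩
  have hf : ∀ k : ℕ, ∀ σ a, (f^[k] σ).1 a = (ρ ^ k) (σ.1 a) := by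
    intro k
    induction k with
    | zero => exact fun _ _ => rfl
    | succ k ih =>
      intro σ a
      rw [Function.iterate_succ_apply, ih, pow_succ]
      rfl
  let f' : Function.End X := f
  -- The exponent has the form `p ^ 1` because the fixed point congruence is used for maps of prime
  -- power order.
  have hfp : f' ^ p ^ 1 = 1 := by
    refine funext fun σ => Subtype.ext (RelHom.ext fun a => ?_)
    have h₁ : (f' ^ p ^ 1) σ = f^[p] σ := by
      rw [pow_one]
      exact congrFun (hom_coe_pow (fun g : Function.End X => (g : X → X)) rfl
        (fun _ _ => rfl) f' p) σ
    rw [h₁, hf, ← hρ, pow_orderOf_eq_one]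
    rfl
  -- A fixed point satisfies ρσ = σ, and surjectivity of σ forces ρ = 1.
  have hfix : IsEmpty (Function.fixedPoints f) := by
    refine ⟨fun ⟨σ, hσ⟩ => ?_⟩
    have hs : Function.Surjective σ.1 := Set.range_eq_univ.1 (hP _ _ σ.2)
    have h₁ : ρ = 1 := RelIso.ext fun v => by
      obtain ⟨a, rfl⟩ := hs v
      exact congrArg (fun σ : X => σ.1 a) hσ
    rw [h₁, orderOf_one] at hρ
    exact hp.one_lt.ne hρ
  have hmod := Equiv.Perm.card_fixedPoints_modEq hfp
  rw [numImage, Nat.card_eq_fintype_card, ← Nat.modEq_zero_iff_dvd]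
  refine hmod.trans ?_
  rw [Fintype.card_eq_zero_iff.2 hfix]

theorem HasAutOfOrder.dvd_numVertSurj [Finite V] [Finite W] {H : LoopGraph V} {p : ℕ}
    (hp : p.Prime) (h : H.HasAutOfOrder p) (G : LoopGraph W) : p ∣ G.numVertSurj H := by
  rw [numVertSurj_eq]
  refine h.dvd_numImage hp _ (fun _ _ h => h) (fun ρ R E h => ?_) G
  have h : R = Set.univ := h
  change ρ '' R = Set.univ
  rw [h, Set.image_univ, Set.range_eq_univ]
  exact ρ.surjective

theorem HasAutOfOrder.dvd_numCompaction [Finite V] [Finite W] {H : LoopGraph V} {p : ℕ}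
    (hp : p.Prime) (h : H.HasAutOfOrder p) (G : LoopGraph W) : p ∣ G.numCompaction H := by
  rw [numCompaction_eq]
  refine h.dvd_numImage hp _ (fun _ _ h => h.1) (fun ρ R E h => ⟨?_, fun u v huv hne => ?_⟩) G
  · rw [h.1, Set.image_univ, Set.range_eq_univ]
    exact ρ.surjective
  · exact ⟨(ρ.symm u, ρ.symm v),
      h.2 _ _ (ρ.symm.map_rel_iff.2 huv) (ρ.symm.injective.ne hne),
      Prod.ext (ρ.apply_symm_apply u) (ρ.apply_symm_apply v)⟩

/-! ### Homomorphisms to rectangular graphs, one component at a time -/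

/-- The number of homomorphisms to `F` from the subgraph of `G` induced by `D`, with image in
`S`. -/
noncomputable def numHomOn (G : LoopGraph W) (F : LoopGraph V) (S : Set V) (D : Set W) : ℕ :=
  Nat.card {σ : D → V // (∀ a, σ a ∈ S) ∧ ∀ a b : D, G.Adj a b → F.Adj (σ a) (σ b)}

theorem numHomOn_univ (G : LoopGraph W) (F : LoopGraph V) (S : Set V) :
    numHomOn G F S Set.univ = Nat.card {σ : G.Hom F // ∀ a, σ a ∈ S} :=
  Nat.card_congr ⟨fun σ => ⟨⟨fun a => σ.1 ⟨a, trivial⟩, fun h => σ.2.2 _ _ h⟩, fun _ => σ.2.1 _⟩,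
    fun σ => ⟨fun a => σ.1 a, fun a => σ.2 a, fun _ _ h => σ.1.map_rel h⟩, fun _ => rfl,
    fun _ => rfl⟩

theorem numHomOn_empty (G : LoopGraph W) (F : LoopGraph V) (S : Set V) :
    numHomOn G F S ∅ = 1 := by
  rw [numHomOn, Nat.card_eq_one_iff_unique]
  exact ⟨⟨fun σ τ => Subtype.ext (funext fun a => a.2.elim)⟩,
    ⟨⟨fun a => a.2.elim, fun a => a.2.elim, fun a => a.2.elim⟩⟩⟩

theorem numHomOn_union (G : LoopGraph W) (F : LoopGraph V) (S : Set V) {D C : Set W}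
    (hd : Disjoint D C) (hDC : ∀ a ∈ D, ∀ b ∈ C, ¬ G.Adj a b) :
    numHomOn G F S (D ∪ C) = numHomOn G F S D * numHomOn G F S C := by
  classical
  rw [numHomOn, numHomOn, numHomOn, ← Nat.card_prod]
  refine Nat.card_congr ⟨fun σ => (⟨fun a => σ.1 ⟨a, .inl a.2⟩, fun _ => σ.2.1 _,
      fun _ _ h => σ.2.2 _ _ h⟩, ⟨fun a => σ.1 ⟨a, .inr a.2⟩, fun _ => σ.2.1 _,
      fun _ _ h => σ.2.2 _ _ h⟩),
    fun q => ⟨fun a => if h : a.1 ∈ D then q.1.1 ⟨a, h⟩ else q.2.1 ⟨a, a.2.resolve_left h⟩, ?_, ?_⟩,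
    fun σ => ?_, fun q => ?_⟩
  · intro a
    dsimp only
    split_ifs with h
    · exact q.1.2.1 _
    · exact q.2.2.1 _
  · intro a b hab
    dsimp only
    split_ifs with ha hb hb
    · exact q.1.2.2 _ _ hab
    · exact absurd hab (hDC _ ha _ (b.2.resolve_left hb))
    · exact absurd (G.symm _ _ hab) (hDC _ hb _ (a.2.resolve_left ha))
    · exact q.2.2.2 _ _ hab
  · refine Subtype.ext (funext fun a => ?_)
    dsimp only
    split_ifs <;> rfl
  · refine Prod.ext (Subtype.ext (funext fun a => ?_)) (Subtype.ext (funext fun a => ?_))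
    · exact dif_pos a.2
    · exact dif_neg fun h => Set.disjoint_left.1 hd h a.2

/-- The edges of the bipartite double cover. -/
def ParityStep (G : LoopGraph W) (a b : W × Bool) : Prop := G.Adj a.1 b.1 ∧ b.2 = !a.2

/-- There is a walk from `r` to `q.1` whose length is odd if and only if `q.2` is true. -/
def ParityReach (G : LoopGraph W) (r : W) (q : W × Bool) : Prop :=
  Relation.ReflTransGen G.ParityStep (r, false) q

/-- The possible images of the vertex `v` if the image of `r` is `x`. -/
def allowed (G : LoopGraph W) (F : LoopGraph V) (S : Set V) (r : W) (x : V) (v : W) : Set V :=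
  {y | y ∈ S ∧ (v = r → y = x) ∧
    (v ≠ r → G.ParityReach r (v, false) → ∃ z, F.Adj x z ∧ F.Adj z y) ∧
    (G.ParityReach r (v, true) → F.Adj x y)}

/-- In a rectangular graph, walks of odd length from x to y shorten to an edge, and walks of
positive even length to a walk of length two. This makes the conditions necessary, by induction
along walks from `r`. The root is exempt from the even condition: its trivial walk does not give a
neighbour of x. -/
theorem forall_mem_allowed_iff {G : LoopGraph W} {F : LoopGraph V} (hF : F.IsRectangular)
    (S : Set V) (r : W) (x : V) (σ : {v | ∃ s, G.ParityReach r (v, s)} → V) :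
    (((∀ a, σ a ∈ S) ∧ ∀ a b : {v | ∃ s, G.ParityReach r (v, s)}, G.Adj a b → F.Adj (σ a) (σ b)) ∧
      σ ⟨r, false, .refl⟩ = x) ↔ ∀ v, σ v ∈ allowed G F S r x v.1 := by
  constructor
  · rintro ⟨⟨hS, hσ⟩, hx⟩
    have key : ∀ q, G.ParityReach r q → ∀ h : q.1 ∈ {v | ∃ s, G.ParityReach r (v, s)},
        (q.2 = true → F.Adj x (σ ⟨q.1, h⟩)) ∧
        (q.2 = false → q.1 ≠ r → ∃ z, F.Adj x z ∧ F.Adj z (σ ⟨q.1, h⟩)) := by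
      intro q hq
      induction hq with
      | refl => exact fun h => ⟨fun h => (Bool.false_ne_true h).elim, fun _ h => (h rfl).elim⟩
      | @tail a b ha hab ih =>
        intro hb
        have haC : a.1 ∈ {v | ∃ s, G.ParityReach r (v, s)} := ⟨a.2, ha⟩
        obtain ⟨ih₁, ih₂⟩ := ih haC
        have hadj : F.Adj (σ ⟨a.1, haC⟩) (σ ⟨b.1, hb⟩) := hσ _ _ hab.1
        constructor
        · intro hb'
          have ha' : a.2 = false := by have := hab.2; rw [hb'] at this; simpa using this.symm
          by_cases har : a.1 = r
          · have : σ ⟨a.1, haC⟩ = x := by rw [← hx]; exact congrArg σ (Subtype.ext har)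
            rwa [this] at hadj
          · obtain ⟨z, hz, hz'⟩ := ih₂ ha' har
            exact hF _ _ _ _ hz hz' hadj
        · intro hb' _
          have ha' : a.2 = true := by have := hab.2; rw [hb'] at this; simpa using this.symm
          exact ⟨_, ih₁ ha', hadj⟩
    refine fun v => ⟨hS v, fun h => ?_, fun hr h => (key _ h v.2).2 rfl hr,
      fun h => (key _ h v.2).1 rfl⟩
    rw [← hx]
    exact congrArg σ (Subtype.ext h)
  -- Conversely, of two adjacent vertices one is reached evenly and the other oddly by the extended
  -- walk. Their images are joined by a walk of length three through z and x, hence adjacent; if the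
  -- even one is the root, its image is x itself.
  · intro h
    have hx : ∀ v, v.1 = r → σ v = x := fun v => (h v).2.1
    refine ⟨⟨fun v => (h v).1, fun a b hab => ?_⟩, hx _ rfl⟩
    obtain ⟨s, hs⟩ := a.2
    cases s with
    | false =>
      have hb : F.Adj x (σ b) := (h b).2.2.2 (hs.tail ⟨hab, rfl⟩)
      by_cases har : a.1 = r
      · rwa [hx a har]
      · obtain ⟨z, hz, hz'⟩ := (h a).2.2.1 har hs
        exact hF _ _ _ _ (F.symm _ _ hz') (F.symm _ _ hz) hb
    | true =>
      have ha : F.Adj x (σ a) := (h a).2.2.2 hs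
      by_cases hbr : b.1 = r
      · rw [hx b hbr]
        exact F.symm _ _ ha
      · obtain ⟨z, hz, hz'⟩ := (h b).2.2.1 hbr (hs.tail ⟨hab, rfl⟩)
        exact hF _ _ _ _ (F.symm _ _ ha) hz hz'

/-- The homomorphisms are sorted by the image x of the root; for fixed x the other choices are
independent, so each fibre is a product. -/
theorem numHomOn_component [Fintype V] [Finite W] {G : LoopGraph W} {F : LoopGraph V}
    (hF : F.IsRectangular) (S : Set V) (r : W) [Fintype {v | ∃ s, G.ParityReach r (v, s)}] :
    numHomOn G F S {v | ∃ s, G.ParityReach r (v, s)} =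
      ∑ x, ∏ v : {v | ∃ s, G.ParityReach r (v, s)}, Nat.card (allowed G F S r x v.1) := by
  rw [numHomOn, ← Nat.card_congr (Equiv.sigmaFiberEquiv fun σ :
    {σ : {v | ∃ s, G.ParityReach r (v, s)} → V // (∀ a, σ a ∈ S) ∧
      ∀ a b, G.Adj a.1 b.1 → F.Adj (σ a) (σ b)} =>
        σ.1 ⟨r, false, .refl⟩), Nat.card_sigma]
  refine Finset.sum_congr rfl fun x _ => ?_
  rw [← Nat.card_pi]
  refine Nat.card_congr ((Equiv.subtypeSubtypeEquivSubtypeInter _ fun σ :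
    {v | ∃ s, G.ParityReach r (v, s)} → V => σ ⟨r, false, .refl⟩ = x).trans
    ((Equiv.subtypeEquivRight fun σ => ?_).trans Equiv.subtypePiEquivPi))
  exact forall_mem_allowed_iff hF S r x σ

/-! ### Surjections and compactions as signed sums -/

/-- The graph `H` without a set of edges. -/
def deleteEdges (H : LoopGraph V) (E : Set (V × V)) : LoopGraph V where
  Adj a b := H.Adj a b ∧ (a, b) ∉ E ∧ (b, a) ∉ E
  symm _ _ h := ⟨H.symm _ _ h.1, h.2.2, h.2.1⟩

/-- A walk of length three in a star repeats its centre, so its ends are joined by its first or its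
last edge. With two vertices, a walk between distinct ends uses the edge that joins them, and
coinciding ends keep their loop, as no loop is deleted. -/
theorem ComponentsStarOrSmallReflexive.isRectangular_deleteEdges [Finite V] {H : LoopGraph V}
    (h : H.ComponentsStarOrSmallReflexive) {E : Set (V × V)} (hE : ∀ a, (a, a) ∉ E) :
    (H.deleteEdges E).IsRectangular := by
  intro a b c d hab hbc hcd
  have ha : a ∈ H.component a := .refl
  have hb : b ∈ H.component a := Relation.ReflTransGen.tail ha hab.1
  have hc : c ∈ H.component a := Relation.ReflTransGen.tail hb hbc.1
  have hd : d ∈ H.component a := Relation.ReflTransGen.tail hc hcd.1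
  rcases h a with ⟨⟨z, hz⟩, hL⟩ | ⟨hR, hcard⟩
  · have h₁ := (hL ⟨a, ha⟩ ⟨b, hb⟩).1 hab.1
    have h₂ := (hL ⟨b, hb⟩ ⟨c, hc⟩).1 hbc.1
    have h₃ := (hL ⟨c, hc⟩ ⟨d, hd⟩).1 hcd.1
    simp only [Subtype.mk.injEq, ne_eq] at h₁ h₂ h₃
    by_cases hba : b = z
    · have hdb : d = b := by
        rw [hba]
        by_contra hdz
        tauto
      rwa [hdb]
    · have hac : a = c := by
        have : a = z := by tauto
        have : c = z := by tauto
        simp_all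
      rwa [hac]
  · by_cases had : a = d
    · subst had
      exact ⟨hR ⟨a, ha⟩ ⟨a, ha⟩, hE a, hE a⟩
    · have key : ∀ x ∈ H.component a, x = a ∨ x = d := by
        intro x hx
        by_contra hne
        push Not at hne
        refine absurd hcard (not_le.2 ?_)
        rw [Nat.card_coe_set_eq, Set.two_lt_ncard_iff (Set.toFinite _)]
        exact ⟨x, a, d, hx, ha, hd, hne.1, hne.2, had⟩
      rcases key b hb with rfl | rfl
      · rcases key c hc with rfl | rfl
        · exact hcd
        · exact hbc
      · exact hab

theorem numVertSurj_cast [Fintype V] [Finite W] {R : Type} [CommRing R] (G : LoopGraph W)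
    (H : LoopGraph V) : (G.numVertSurj H : R) = ∑ E ∈ (Finset.univ : Finset V).powerset,
      (-1) ^ E.card * (Nat.card {σ : G.Hom H // ∀ a, σ a ∈ (E : Set V)ᶜ} : R) := by
  have : Finite (G.Hom H) := DFunLike.finite _
  have key := sum_powerset_neg_one_pow_mul_card (R := R) (Finset.univ : Finset V)
    (fun _ : G.Hom H => True) (fun v σ => v ∉ Set.range σ)
  simp only [true_and, Finset.mem_univ, true_imp_iff, not_not] at key
  have e : ∀ (σ : G.Hom H) (E : Finset V),
      (∀ v ∈ E, v ∉ Set.range σ) ↔ ∀ a, σ a ∈ (E : Set V)ᶜ := by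
    intro σ E
    constructor
    · exact fun h a ha => h _ ha ⟨a, rfl⟩
    · rintro h _ hv ⟨a, rfl⟩
      exact h a hv
  simp only [e] at key
  rw [key]
  rfl

/-- The sieve runs over missed vertices and missed edges. A non-loop edge occurs in both
orientations, which give the same event; inclusion–exclusion is indifferent to repeated events. -/
theorem numCompaction_cast [Fintype V] [Finite W] {R : Type} [CommRing R] (G : LoopGraph W)
    (H : LoopGraph V) [Fintype {e : V × V // e.1 ≠ e.2 ∧ H.Adj e.1 e.2}] : (G.numCompaction H : R) =
      ∑ E ∈ (Finset.univ : Finset (V ⊕ {e : V × V // e.1 ≠ e.2 ∧ H.Adj e.1 e.2})).powerset,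
      (-1) ^ E.card * (Nat.card {σ : G.Hom (H.deleteEdges {e | ∃ h, .inr ⟨e, h⟩ ∈ E}) //
        ∀ a, σ a ∈ {v | .inl v ∉ E}} : R) := by
  have : Finite (G.Hom H) := DFunLike.finite _
  have key := sum_powerset_neg_one_pow_mul_card (R := R)
    (Finset.univ : Finset (V ⊕ {e : V × V // e.1 ≠ e.2 ∧ H.Adj e.1 e.2}))
    (fun _ : G.Hom H => True)
    (fun d σ => d.elim (fun v => v ∉ Set.range σ) fun e => e.1 ∉ edgeImage σ)
  simp only [true_and] at key
  refine Eq.trans ?_ (key.symm.trans (Finset.sum_congr rfl fun E _ => ?_))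
  · refine congrArg _ (Nat.card_congr (Equiv.subtypeEquivRight fun σ => ?_))
    constructor
    · rintro ⟨h₁, h₂⟩ (v | e) -
      · exact not_not.2 (h₁ v)
      · exact not_not.2 (h₂ _ _ e.2.2 e.2.1)
    · intro h
      exact ⟨fun v => not_not.1 (h (.inl v) (Finset.mem_univ _)),
        fun u v huv hne => not_not.1 (h (.inr ⟨(u, v), hne, huv⟩) (Finset.mem_univ _))⟩
  · refine congrArg _ (congrArg _ (Nat.card_congr
      ⟨fun σ => ⟨⟨σ.1, fun {a b} h => ⟨σ.1.map_rel h, ?_, ?_⟩⟩, fun a ha => ?_⟩,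
        fun σ => ⟨⟨σ.1, fun h => (σ.1.map_rel h).1⟩, ?_⟩, fun _ => rfl, fun _ => rfl⟩))
    · rintro ⟨he, hE⟩
      exact σ.2 _ hE ⟨a, b, h, rfl, rfl⟩
    · rintro ⟨he, hE⟩
      exact σ.2 _ hE ⟨b, a, G.symm _ _ h, rfl, rfl⟩
    · exact σ.2 _ ha ⟨a, rfl⟩
    · rintro (v | ⟨⟨u, v⟩, he⟩) hd
      · rintro ⟨a, rfl⟩
        exact σ.2 a hd
      · rintro ⟨a, b, h, rfl, rfl⟩
        exact (σ.1.map_rel h).2.1 ⟨he, hd⟩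

end LoopGraph

open LoopGraph

/-! ### Array programs with one mark for every vertex -/

namespace ArrayProg

/-- The mark of a vertex: whether it is finished, and the parities of the walks by which it has been
reached. -/
abbrev Mark : Type := Bool × (Bool → Bool)

/-- The entry of the adjacency matrix in the code `w`. -/
def bit (w : List Bool) (i j : Fin (codeSize w)) : Bool :=
  (w.drop (codeSize w + 1)).getD (i * codeSize w + j) false

/-- The cells that hold the code `w`, and the marks of the vertices on the diagonal. -/
def memory (w : List Bool) (m : Fin (codeSize w) → Mark) : List (Bool × Mark) :=
  (List.range (codeSize w * codeSize w)).map fun k =>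
    ((w.drop (codeSize w + 1)).getD k false,
      if h : k / codeSize w = k % codeSize w ∧ k / codeSize w < codeSize w then
        m ⟨k / codeSize w, h.2⟩ else (false, fun _ => false))

variable {w : List Bool}

theorem index_lt (i j : Fin (codeSize w)) : i * codeSize w + j < codeSize w * codeSize w := by
  have hi := i.2
  have hj := j.2
  nlinarith

theorem index_div (i j : Fin (codeSize w)) : (i * codeSize w + j) / codeSize w = (i : ℕ) := by
  rw [mul_comm, Nat.mul_add_div (by have := i.2; omega), Nat.div_eq_of_lt j.2, add_zero]

theorem index_mod (i j : Fin (codeSize w)) : (i * codeSize w + j) % codeSize w = (j : ℕ) := by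
  rw [mul_comm, Nat.mul_add_mod, Nat.mod_eq_of_lt j.2]

theorem getElem?_memory (m : Fin (codeSize w) → Mark) (i j : Fin (codeSize w)) :
    (memory w m)[i * codeSize w + j]? =
      some (bit w i j, if i = j then m i else (false, fun _ => false)) := by
  rw [memory, List.getElem?_map, List.getElem?_range (index_lt i j)]
  simp only [Option.map_some, index_div, index_mod, bit, Fin.val_inj, Fin.is_lt, and_true,
    Fin.eta, dite_eq_ite]

theorem set_memory_self (m : Fin (codeSize w) → Mark) (i j : Fin (codeSize w)) :
    (memory w m).set (i * codeSize w + j)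
      (bit w i j, if i = j then m i else (false, fun _ => false)) = memory w m := by
  obtain ⟨h, e⟩ := List.getElem?_eq_some_iff.1 (getElem?_memory m i j)
  rw [← e, List.set_getElem_self]

theorem set_memory (m : Fin (codeSize w) → Mark) (i : Fin (codeSize w)) (x : Mark) :
    (memory w m).set (i * codeSize w + i) (bit w i i, x) =
      memory w (Function.update m i x) := by
  refine List.ext_getElem? fun k => ?_
  by_cases hk : i * codeSize w + i = k
  · subst hk
    rw [getElem?_memory, List.getElem?_set_self (by simpa [memory] using index_lt i i)]
    simp
  · rw [List.getElem?_set_ne hk, memory, memory, List.getElem?_map, List.getElem?_map]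
    by_cases hlt : k < codeSize w * codeSize w
    · rw [List.getElem?_range hlt, Option.map_some, Option.map_some]
      split_ifs with h
      · rw [Function.update_of_ne]
        rintro rfl
        refine hk ?_
        have := Nat.div_add_mod k (codeSize w)
        rw [mul_comm, ← h.1] at this
        exact this
      · rfl
    · rw [List.getElem?_eq_none (by simpa using hlt)]
      rfl

theorem cells_eq_memory (w : List Bool) :
    Mem.cells (fun b => (b, false, fun _ => false)) w =
      memory w fun _ => (false, fun _ => false) := by
  rw [Mem.cells, Mem.padded, memory]
  refine List.map_congr_left fun k _ => ?_
  simp only [List.getElem?_map, List.getD_eq_getElem?_getD, dite_eq_ite, ite_self]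
  cases (w.drop (codeSize w + 1))[k]? <;> rfl

variable {σ : Type}

/-- The program `P` acts as the function `Φ` on the register and the marks. -/
def Sim (w : List Bool) (P : ArrayProg σ (Bool × Mark)) (u : Fin 5 → ℕ)
    (Φ : σ × (Fin (codeSize w) → Mark) → σ × (Fin (codeSize w) → Mark)) : Prop :=
  ∀ s, P.den (codeSize w) u (s.1, memory w s.2, []) = ((Φ s).1, memory w (Φ s).2, [])

/-- Read an entry of the adjacency matrix. -/
def readBit (i j : Fin 5) (f : σ → Bool → σ) : ArrayProg σ (Bool × Mark) :=
  upd i j fun q c => (f q c.1, c)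

/-- Read and write the mark of a vertex. -/
def visit (i : Fin 5) (f : σ → Mark → σ × Mark) : ArrayProg σ (Bool × Mark) :=
  upd i i fun q c => ((f q c.2).1, c.1, (f q c.2).2)

variable {u : Fin 5 → ℕ} {P Q : ArrayProg σ (Bool × Mark)}
  {Φ Ψ : σ × (Fin (codeSize w) → Mark) → σ × (Fin (codeSize w) → Mark)}

theorem sim_readBit {i j : Fin 5} {a b : Fin (codeSize w)} (hi : u i = a) (hj : u j = b)
    (f : σ → Bool → σ) : Sim w (readBit i j f) u fun s => (f s.1 (bit w a b), s.2) := by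
  intro s
  rw [readBit, den, hi, hj]
  simp only [getElem?_memory, Option.elim_some, set_memory_self]

theorem sim_visit {i : Fin 5} {a : Fin (codeSize w)} (hi : u i = a) (f : σ → Mark → σ × Mark) :
    Sim w (visit i f) u fun s =>
      ((f s.1 (s.2 a)).1, Function.update s.2 a (f s.1 (s.2 a)).2) := by
  intro s
  rw [visit, den, hi]
  simp only [getElem?_memory, Option.elim_some, set_memory, if_true]

theorem sim_load (f : σ → σ) : Sim w (load f) u fun s => (f s.1, s.2) := fun _ => rfl

theorem Sim.seq (hP : Sim w P u Φ) (hQ : Sim w Q u Ψ) : Sim w (.seq P Q) u fun s => Ψ (Φ s) := by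
  intro s
  rw [den, hP, hQ]

theorem Sim.ite (c : σ → Bool) (hP : Sim w P u Φ) (hQ : Sim w Q u Ψ) :
    Sim w (.ite c P Q) u fun s => if c s.1 then Φ s else Ψ s := by
  intro s
  rw [den]
  dsimp only
  split_ifs
  · exact hP s
  · exact hQ s

theorem Sim.all {i : Fin 5} {Φ : Fin (codeSize w) → σ × (Fin (codeSize w) → Mark) →
    σ × (Fin (codeSize w) → Mark)} (hP : ∀ k : Fin (codeSize w), Sim w P (Function.update u i k) (Φ k)) :
    Sim w (.all i P) u fun s => (List.finRange (codeSize w)).foldl (fun s k => Φ k s) s := by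
  intro s
  rw [den, ← List.map_coe_finRange_eq_range, List.foldl_map]
  induction List.finRange (codeSize w) generalizing s with
  | nil => rfl
  | cons k l ih =>
    rw [List.foldl_cons, hP]
    exact ih (Φ k s)

end ArrayProg

/-! ### Counting homomorphisms to rectangular graphs -/

namespace HomCount

open ArrayProg

/-- The register: for every target a product over the finished components, for every target and
every image of the root a product over the current component, the bit that was read last, and the
marks that were read last. -/
abbrev Reg (T V R : Type) : Type := (T → R) × (T → V → R) × Bool × (Bool → Bool)

variable {T V R : Type}

/-- Pass the marks of a vertex to its neighbours. -/
def edge : ArrayProg (Reg T V R) (Bool × Mark) :=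
  .seq (readBit 3 4 fun q b => (q.1, q.2.1, b, q.2.2.2))
  (.seq (readBit 4 3 fun q b => (q.1, q.2.1, q.2.2.1 || b, q.2.2.2))
  (.seq (visit 3 fun q m => ((q.1, q.2.1, q.2.2.1, m.2), m))
    (visit 4 fun q m => (q, m.1, fun s => m.2 s || (q.2.2.1 && q.2.2.2 !s)))))

/-- Pass marks until they are closed under adjacency. -/
def spread : ArrayProg (Reg T V R) (Bool × Mark) :=
  .all 1 (.all 2 (.all 3 (.all 4 edge)))

/-- Mark a vertex as the root of a component if it is not finished. -/
def start : ArrayProg (Reg T V R) (Bool × Mark) :=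
  visit 0 fun q m => if m.1 then ((q.1, q.2.1, false, q.2.2.2), m) else
    ((q.1, q.2.1, true, q.2.2.2), m.1, fun s => !s)

section

variable [CommRing R] (f g : T → V → (Bool → Bool) → R)

/-- Start the products with the factors for the root. -/
def visitRoot : ArrayProg (Reg T V R) (Bool × Mark) :=
  visit 0 fun q m => ((q.1, fun t x => f t x m.2, q.2.2), true, fun _ => false)

/-- Multiply the products with the factors for the marked vertices. -/
def collect : ArrayProg (Reg T V R) (Bool × Mark) :=
  .all 3 (visit 3 fun q m => if m.2 false || m.2 true then
    ((q.1, fun t x => q.2.1 t x * g t x m.2, q.2.2), true, fun _ => false) else (q, m))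

variable [Fintype V]

/-- Process the component of a vertex, unless it is finished. -/
def processComponent : ArrayProg (Reg T V R) (Bool × Mark) :=
  .seq start (.ite (fun q => q.2.2.1)
    (.seq spread (.seq (visitRoot f) (.seq (collect g)
      (.load fun q => (fun t => q.1 t * ∑ x, q.2.1 t x, q.2)))))
    (.load id))

/-- Process all components. -/
def countHoms : ArrayProg (Reg T V R) (Bool × Mark) := .all 0 (processComponent f g)

end

/-- States of the register and the marks. -/
abbrev State (w : List Bool) (T V R : Type) : Type := Reg T V R × (Fin (codeSize w) → Mark)

variable {w : List Bool}

/-- The function computed by `edge`. -/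
def edgeFun (i j : Fin (codeSize w)) (s : State w T V R) : State w T V R :=
  ((s.1.1, s.1.2.1, bit w i j || bit w j i, (s.2 i).2),
    Function.update s.2 j ((s.2 j).1,
      fun b => (s.2 j).2 b || ((bit w i j || bit w j i) && (s.2 i).2 !b)))

theorem sim_edge {u : Fin 5 → ℕ} {i j : Fin (codeSize w)} (hi : u 3 = i) (hj : u 4 = j) :
    Sim w (edge : ArrayProg (Reg T V R) (Bool × Mark)) u (edgeFun i j) := by
  have h := (sim_readBit (σ := Reg T V R) hi hj fun q b => (q.1, q.2.1, b, q.2.2.2)).seq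
    ((sim_readBit hj hi fun q b => (q.1, q.2.1, q.2.2.1 || b, q.2.2.2)).seq
    ((sim_visit hi fun q m => ((q.1, q.2.1, q.2.2.1, m.2), m)).seq
    (sim_visit hj fun q m => (q, m.1, fun s => m.2 s || (q.2.2.1 && q.2.2.2 !s)))))
  intro s
  refine (h s).trans ?_
  simp only [Function.update_eq_self, edgeFun]

/-- One round of `spread`. -/
def roundFun (s : State w T V R) : State w T V R :=
  (List.finRange (codeSize w)).foldl
    (fun s i => (List.finRange (codeSize w)).foldl (fun s j => edgeFun i j s) s) s

theorem sim_spread {u : Fin 5 → ℕ} :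
    Sim w (spread : ArrayProg (Reg T V R) (Bool × Mark)) u
      fun s => roundFun^[codeSize w * codeSize w] s := by
  have h := Sim.all (u := u) (i := 1) fun k => Sim.all (u := Function.update u 1 ↑k) (i := 2)
    fun l => Sim.all (u := Function.update (Function.update u 1 ↑k) 2 ↑l) (i := 3)
    fun i => Sim.all
      (u := Function.update (Function.update (Function.update u 1 ↑k) 2 ↑l) 3 ↑i) (i := 4)
    fun j => sim_edge (T := T) (V := V) (R := R) (w := w) (i := i) (j := j) (by simp) (by simp)
  intro s
  refine (h s).trans ?_
  have e : ∀ s : State w T V R, (List.finRange (codeSize w)).foldl (fun s _ =>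
      (List.finRange (codeSize w)).foldl (fun s _ => roundFun s) s) s =
        roundFun^[codeSize w * codeSize w] s := by
    intro s
    simp only [List.foldl_const, List.length_finRange, ← Function.iterate_mul]
  have := e s
  simp only [roundFun] at this ⊢
  rw [this]

/-- The marked pairs of vertices and parities. -/
def marked (s : State w T V R) : Set (Fin (codeSize w) × Bool) := {a | (s.2 a.1).2 a.2 = true}

/-- The state `s'` results from `s` by passing marks along edges. -/
structure Spreads (s s' : State w T V R) : Prop where
  total : s'.1.1 = s.1.1
  finished : ∀ v, (s'.2 v).1 = (s.2 v).1
  subset : marked s ⊆ marked s'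
  reach : ∀ a ∈ marked s', ∃ b ∈ marked s, Relation.ReflTransGen (ofCode w).ParityStep b a

theorem Spreads.refl (s : State w T V R) : Spreads s s :=
  ⟨rfl, fun _ => rfl, subset_rfl, fun a ha => ⟨a, ha, .refl⟩⟩

theorem Spreads.trans {s s' s'' : State w T V R} (h : Spreads s s') (h' : Spreads s' s'') :
    Spreads s s'' :=
  ⟨h'.total.trans h.total, fun v => (h'.finished v).trans (h.finished v), h.subset.trans h'.subset,
    fun a ha => by
      obtain ⟨b, hb, hab⟩ := h'.reach a ha
      obtain ⟨c, hc, hbc⟩ := h.reach b hb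
      exact ⟨c, hc, hbc.trans hab⟩⟩

theorem adj_iff {i j : Fin (codeSize w)} :
    (ofCode w).Adj i j ↔ (bit w i j || bit w j i) = true := by
  simp [ofCode, bit]

theorem mem_marked_edgeFun {i j : Fin (codeSize w)} {s : State w T V R}
    {a : Fin (codeSize w) × Bool} : a ∈ marked (edgeFun i j s) ↔
      a ∈ marked s ∨ a.1 = j ∧ (i, !a.2) ∈ marked s ∧ (ofCode w).Adj i j := by
  by_cases h : a.1 = j
  · subst h
    simp [marked, edgeFun, adj_iff, and_comm]
  · simp [marked, edgeFun, h]

theorem spreads_edgeFun (i j : Fin (codeSize w)) (s : State w T V R) :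
    Spreads s (edgeFun i j s) where
  total := rfl
  finished v := by
    by_cases h : v = j
    · subst h
      simp [edgeFun]
    · simp [edgeFun, h]
  subset a ha := mem_marked_edgeFun.2 (.inl ha)
  reach a ha := by
    rcases mem_marked_edgeFun.1 ha with h | ⟨h₁, h₂, h₃⟩
    · exact ⟨a, h, .refl⟩
    · exact ⟨_, h₂, .single ⟨h₁ ▸ h₃, by simp⟩⟩

theorem spreads_foldl {ι : Type} {Φ : ι → State w T V R → State w T V R}
    (h : ∀ i s, Spreads s (Φ i s)) (l : List ι) (s : State w T V R) :
    Spreads s (l.foldl (fun s i => Φ i s) s) := by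
  induction l generalizing s with
  | nil => exact .refl s
  | cons i l ih => exact (h i s).trans (ih _)

/-- Splits the fold at `i`: marks present before are still there when `Φ i` acts, and what `Φ i`
adds survives to the end. -/
theorem spreads_foldl_of_mem {ι : Type} {Φ : ι → State w T V R → State w T V R}
    (h : ∀ i s, Spreads s (Φ i s)) {l : List ι} {i : ι} (hi : i ∈ l) (s : State w T V R) :
    ∃ s', Spreads s s' ∧ Spreads (Φ i s') (l.foldl (fun s i => Φ i s) s) := by
  induction l generalizing s with
  | nil => simp at hi
  | cons k l ih =>
    rcases List.mem_cons.1 hi with rfl | hi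
    · exact ⟨s, .refl s, spreads_foldl h l _⟩
    · obtain ⟨s', h₁, h₂⟩ := ih hi (Φ k s)
      exact ⟨s', (h k s).trans h₁, h₂⟩

theorem spreads_roundFun (s : State w T V R) : Spreads s (roundFun s) :=
  spreads_foldl (fun i s => spreads_foldl (fun j s => spreads_edgeFun i j s) _ s) _ s

/-- A round treats every ordered pair of vertices, in particular the one that carries this step. -/
theorem mem_marked_roundFun {s : State w T V R} {a b : Fin (codeSize w) × Bool}
    (ha : a ∈ marked s) (hab : (ofCode w).ParityStep a b) : b ∈ marked (roundFun s) := by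
  obtain ⟨s₁, h₁, h₁'⟩ := spreads_foldl_of_mem
    (fun i s => spreads_foldl (fun j s => spreads_edgeFun i j s) (List.finRange (codeSize w)) s)
    (List.mem_finRange a.1) s
  obtain ⟨s₂, h₂, h₂'⟩ := spreads_foldl_of_mem
    (fun j s => spreads_edgeFun a.1 j s) (List.mem_finRange b.1) s₁
  refine h₁'.subset (h₂'.subset (mem_marked_edgeFun.2 (.inr ⟨rfl, ?_, hab.1⟩)))
  rw [hab.2, Bool.not_not]
  exact h₂.subset (h₁.subset ha)

theorem spreads_iterate (k : ℕ) (s : State w T V R) : Spreads s (roundFun^[k] s) := by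
  induction k generalizing s with
  | zero => exact .refl s
  | succ k ih => exact (spreads_roundFun s).trans (ih _)

/-- After sufficiently many rounds, the marks are closed under adjacency. -/
theorem marked_iterate_closed {s : State w T V R} (hs : (marked s).Nonempty)
    {a b : Fin (codeSize w) × Bool} (ha : a ∈ marked (roundFun^[codeSize w * codeSize w] s))
    (hab : (ofCode w).ParityStep a b) :
    b ∈ marked (roundFun^[codeSize w * codeSize w] s) := by
  -- Each round either finds the marks already closed or adds at least one pair to them.
  have key : ∀ k, (∀ a b, a ∈ marked (roundFun^[k] s) → (ofCode w).ParityStep a b →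
      b ∈ marked (roundFun^[k] s)) ∨ k + 1 ≤ (marked (roundFun^[k] s)).ncard := by
    intro k
    induction k with
    | zero => exact .inr ((Set.ncard_pos (Set.toFinite _)).2 hs)
    | succ k ih =>
      rw [Function.iterate_succ_apply']
      set s' := roundFun^[k] s with hs'
      by_cases hc : ∀ a b, a ∈ marked s' → (ofCode w).ParityStep a b → b ∈ marked s'
      · left
        have hsub : marked (roundFun s') ⊆ marked s' := by
          intro a ha
          obtain ⟨b, hb, hba⟩ := (spreads_roundFun s').reach a ha
          clear ha
          induction hba with
          | refl => exact hb
          | tail _ h ih => exact hc _ _ ih h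
        exact fun a b ha hab => (spreads_roundFun s').subset (hc a b (hsub ha) hab)
      · right
        have ih := ih.resolve_left hc
        push Not at hc
        obtain ⟨a, b, ha, hab, hb⟩ := hc
        exact Nat.succ_le_of_lt (ih.trans_lt (Set.ncard_lt_ncard
          ((Set.ssubset_iff_of_subset (spreads_roundFun s').subset).2
            ⟨b, mem_marked_roundFun ha hab, hb⟩) (Set.toFinite _)))
  rcases key (codeSize w * codeSize w) with h | h
  · exact h a b ha hab
  · have hle := Set.ncard_le_card (marked (roundFun^[codeSize w * codeSize w] s))
    have hcard : Nat.card (Fin (codeSize w) × Bool) = codeSize w * 2 := by simp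
    have : marked (roundFun^[codeSize w * codeSize w] s) = Set.univ := by
      -- There are `2 * n` pairs, and `2 * n ≤ n * n + 1`, so all of them are marked.
      refine Set.eq_of_subset_of_ncard_le (Set.subset_univ _) ?_
      rw [Set.ncard_univ, hcard]
      nlinarith [sq_nonneg ((codeSize w : ℤ) - 1), h, hle]
    rw [this]
    trivial

end HomCount

open LoopGraph

namespace HomCount

open ArrayProg

variable {T V R : Type} {w : List Bool}

/-- The function computed by `start`. -/
def startFun (r : Fin (codeSize w)) (s : State w T V R) : State w T V R :=
  if (s.2 r).1 then ((s.1.1, s.1.2.1, false, s.1.2.2.2), s.2) else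
    ((s.1.1, s.1.2.1, true, s.1.2.2.2), Function.update s.2 r ((s.2 r).1, fun b => !b))

theorem sim_start {u : Fin 5 → ℕ} {r : Fin (codeSize w)} (hr : u 0 = r) :
    Sim w (start : ArrayProg (Reg T V R) (Bool × Mark)) u (startFun r) := by
  intro s
  refine (sim_visit hr _ s).trans ?_
  rw [startFun]
  by_cases h : (s.2 r).1 = true
  · simp only [h, if_true, Function.update_eq_self]
  · simp only [h, if_false, Bool.false_eq_true]

/-- The function computed by `visitRoot`. -/
def rootFun (f : T → V → (Bool → Bool) → R) (r : Fin (codeSize w)) (s : State w T V R) : State w T V R :=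
  ((s.1.1, fun t x => f t x (s.2 r).2, s.1.2.2),
    Function.update s.2 r (true, fun _ => false))

theorem sim_visitRoot (f : T → V → (Bool → Bool) → R) {u : Fin 5 → ℕ} {r : Fin (codeSize w)} (hr : u 0 = r) :
    Sim w (visitRoot f) u (rootFun f r) := sim_visit hr _

variable [CommRing R] (f g : T → V → (Bool → Bool) → R)

/-- The function computed by one step of `collect`. -/
def collectStep (v : Fin (codeSize w)) (s : State w T V R) : State w T V R :=
  if (s.2 v).2 false || (s.2 v).2 true then
    ((s.1.1, fun t x => s.1.2.1 t x * g t x (s.2 v).2, s.1.2.2),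
      Function.update s.2 v (true, fun _ => false)) else s

theorem sim_collect {u : Fin 5 → ℕ} : Sim w (collect g) u
    fun s => (List.finRange (codeSize w)).foldl (fun s v => collectStep g v s) s := by
  refine Sim.all fun v s => (sim_visit (a := v) (by simp) _ s).trans ?_
  rw [collectStep]
  by_cases h : ((s.2 v).2 false || (s.2 v).2 true) = true
  · simp only [h, if_true]
  · simp only [h, if_false, Function.update_eq_self, Bool.false_eq_true]

/-- Every vertex is visited once and only its own mark changes, so each factor is determined by the
initial marks. -/
theorem foldl_collectStep (l : List (Fin (codeSize w))) (hl : l.Nodup) (s : State w T V R) :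
    (l.foldl (fun s v => collectStep g v s) s).1.1 = s.1.1 ∧
    (∀ v, (l.foldl (fun s v => collectStep g v s) s).2 v =
      if v ∈ l ∧ ((s.2 v).2 false || (s.2 v).2 true) then (true, fun _ => false) else s.2 v) ∧
    ∀ t x, (l.foldl (fun s v => collectStep g v s) s).1.2.1 t x = s.1.2.1 t x *
      (l.map fun v => if (s.2 v).2 false || (s.2 v).2 true then g t x (s.2 v).2 else 1).prod := by
  induction l generalizing s with
  | nil => simp
  | cons k l ih =>
    obtain ⟨hk, hl⟩ := List.nodup_cons.1 hl
    obtain ⟨h₁, h₂, h₃⟩ := ih hl (collectStep g k s)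
    have hne : ∀ v, v ≠ k → (collectStep g k s).2 v = s.2 v := by
      intro v hv
      rw [collectStep]
      split_ifs
      · exact Function.update_of_ne hv _ _
      · rfl
    refine ⟨h₁.trans ?_, fun v => (h₂ v).trans ?_, fun t x => (h₃ t x).trans ?_⟩
    · rw [collectStep]
      split_ifs <;> rfl
    · by_cases hv : v = k
      · subst hv
        rw [if_neg fun h => hk h.1, collectStep]
        split_ifs with ha hb hb
        · simp
        · simp [ha] at hb
        · simp [ha] at hb
        · rfl
      · rw [hne v hv]
        simp [hv]
    · rw [List.map_cons, List.prod_cons, ← mul_assoc]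
      refine congrArg₂ _ ?_ (congrArg _ (List.map_congr_left fun v hv => ?_))
      · rw [collectStep]
        split_ifs <;> simp
      · rw [hne v (ne_of_mem_of_not_mem hv hk)]

variable [Fintype V]

/-- The function computed by `processComponent`. -/
def processFun (r : Fin (codeSize w)) (s : State w T V R) : State w T V R :=
  if (startFun r s).1.2.2.1 then
    let s' := (List.finRange (codeSize w)).foldl (fun s v => collectStep g v s)
      (rootFun f r (roundFun^[codeSize w * codeSize w] (startFun r s)))
    ((fun t => s'.1.1 t * ∑ x, s'.1.2.1 t x, s'.1.2), s'.2)
  else startFun r s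

theorem sim_processComponent {u : Fin 5 → ℕ} {r : Fin (codeSize w)} (hr : u 0 = r) :
    Sim w (processComponent f g) u (processFun f g r) := by
  have h := (sim_start (T := T) (V := V) (R := R) hr).seq (Sim.ite (fun q => q.2.2.1)
    (sim_spread.seq ((sim_visitRoot f hr).seq ((sim_collect g).seq
      (sim_load fun q : Reg T V R => (fun t => q.1 t * ∑ x, q.2.1 t x, q.2))))) (sim_load id))
  exact fun s => h s

theorem sim_countHoms {u : Fin 5 → ℕ} : Sim w (countHoms f g) u
    fun s => (List.finRange (codeSize w)).foldl (fun s r => processFun f g r s) s :=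
  Sim.all fun r => sim_processComponent f g (by simp)

variable (F : T → LoopGraph V) (S : T → Set V)

/-- The number of possible images of the root. -/
noncomputable def rootFactor (R : Type) [CommRing R] (t : T) (x : V) (k : Bool → Bool) : R :=
  Nat.card {y | y ∈ S t ∧ y = x ∧ (k true = true → (F t).Adj x y)}

/-- The number of possible images of a vertex that is not the root. -/
noncomputable def factor (R : Type) [CommRing R] (t : T) (x : V) (k : Bool → Bool) : R :=
  Nat.card {y | y ∈ S t ∧ (k false = true → ∃ z, (F t).Adj x z ∧ (F t).Adj z y) ∧
    (k true = true → (F t).Adj x y)}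

open Classical in
/-- The state after the components in `D` have been processed. -/
structure Processed (D : Set (Fin (codeSize w))) (s : State w T V R) : Prop where
  total : ∀ t, s.1.1 t = (numHomOn (ofCode w) (F t) (S t) D : R)
  marks : ∀ v, s.2 v = (decide (v ∈ D), fun _ => false)
  closed : ∀ a ∈ D, ∀ b, (ofCode w).Adj a b → b ∈ D

variable {F S}

/-- `D` is closed under adjacency, so the component of an unfinished `r` is disjoint from it and no
edge joins the two: the counts multiply. The marks spread from the pair of `r` and even parity are
exactly those of the walks from `r`. -/
theorem Processed.processFun (hF : ∀ t, (F t).IsRectangular) {D : Set (Fin (codeSize w))}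
    {s : State w T V R} (h : Processed F S D s) (r : Fin (codeSize w)) :
    ∃ D', D ⊆ D' ∧ r ∈ D' ∧
      Processed F S D' (processFun (rootFactor F S R) (factor F S R) r s) := by
  classical
  by_cases hr : r ∈ D
  · refine ⟨D, subset_rfl, hr, ?_⟩
    have hs : startFun r s = ((s.1.1, s.1.2.1, false, s.1.2.2.2), s.2) := by
      rw [startFun, if_pos]
      simp [h.marks, hr]
    have : HomCount.processFun (rootFactor F S R) (factor F S R) r s = startFun r s := by
      rw [HomCount.processFun, if_neg]
      simp [hs]
    rw [this, hs]
    exact ⟨h.total, h.marks, h.closed⟩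
  set s₁ := startFun r s with hs₁
  have hs₁' : s₁ = ((s.1.1, s.1.2.1, true, s.1.2.2.2),
      Function.update s.2 r ((s.2 r).1, fun b => !b)) := by
    rw [hs₁, startFun, if_neg]
    simp [h.marks, hr]
  have hm₁ : marked s₁ = {(r, false)} := by
    ext ⟨v, b⟩
    by_cases hv : v = r
    · subst hv
      simp [marked, hs₁']
    · simp [marked, hs₁', hv, h.marks]
  set s₂ := roundFun^[codeSize w * codeSize w] s₁ with hs₂
  have hsp : Spreads s₁ s₂ := spreads_iterate _ _
  have hm₂ : ∀ a, a ∈ marked s₂ ↔ (ofCode w).ParityReach r a := by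
    intro a
    constructor
    · intro ha
      obtain ⟨b, hb, hba⟩ := hsp.reach a ha
      rw [hm₁, Set.mem_singleton_iff] at hb
      rwa [hb] at hba
    · intro ha
      induction ha with
      | refl => exact hsp.subset (by rw [hm₁]; rfl)
      | tail _ hab ih => exact marked_iterate_closed ⟨_, by rw [hm₁]; rfl⟩ ih hab
  have hk₂ : ∀ v b, (s₂.2 v).2 b = true ↔ (ofCode w).ParityReach r (v, b) := fun v b => hm₂ (v, b)
  have hd₂ : ∀ v, (s₂.2 v).1 = decide (v ∈ D) := by
    intro v
    rw [hsp.finished, hs₁']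
    by_cases hv : v = r
    · subst hv
      simp [h.marks]
    · simp [hv, h.marks]
  set s₃ := rootFun (rootFactor F S R) r s₂ with hs₃
  obtain ⟨h₁, h₂, h₃⟩ := foldl_collectStep (factor F S R) (List.finRange (codeSize w))
    (List.nodup_finRange _) s₃
  set s₄ := (List.finRange (codeSize w)).foldl (fun s v => collectStep (factor F S R) v s) s₃
  set C : Set (Fin (codeSize w)) := {v | ∃ b, (ofCode w).ParityReach r (v, b)} with hC
  have hmk : ∀ v, ((s₂.2 v).2 false || (s₂.2 v).2 true) = true ↔ v ∈ C := by
    intro v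
    rw [Bool.or_eq_true, hk₂, hk₂, hC]
    exact ⟨fun h => h.elim (fun h => ⟨_, h⟩) fun h => ⟨_, h⟩, fun ⟨b, h⟩ => by
      cases b
      · exact .inl h
      · exact .inr h⟩
  have hrC : r ∈ C := ⟨false, .refl⟩
  have hdisj : Disjoint D C := by
    rw [Set.disjoint_left]
    rintro v hv ⟨b, hb⟩
    have key : ∀ a, (ofCode w).ParityReach r a → a.1 ∉ D := by
      intro a ha
      induction ha with
      | refl => exact hr
      | tail _ hab ih => exact fun hb => ih (h.closed _ hb _ ((ofCode w).symm _ _ hab.1))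
    exact key _ hb hv
  refine ⟨D ∪ C, Set.subset_union_left, .inr hrC, ?_⟩
  have hres : HomCount.processFun (rootFactor F S R) (factor F S R) r s =
      ((fun t => s₄.1.1 t * ∑ x, s₄.1.2.1 t x, s₄.1.2), s₄.2) := by
    rw [HomCount.processFun, if_pos]
    rw [← hs₁, hs₁']
  rw [hres]
  refine ⟨fun t => ?_, fun v => ?_, ?_⟩
  · have hDC : ∀ a ∈ D, ∀ b ∈ C, ¬ (ofCode w).Adj a b := fun a ha b hb hab =>
      Set.disjoint_left.1 hdisj (h.closed a ha b hab) hb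
    rw [numHomOn_union _ _ _ hdisj hDC, numHomOn_component (hF t)]
    push_cast
    have e₁ : s₄.1.1 t = s.1.1 t := by
      rw [h₁]
      exact (congrFun hsp.total t).trans (by rw [hs₁'])
    refine congrArg₂ _ (e₁.trans (h.total t)) (Finset.sum_congr rfl fun x _ => ?_)
    refine (h₃ t x).trans ?_
    have e₂ : ∏ v : C, (Nat.card (allowed (ofCode w) (F t) (S t) r x v.1) : R) =
        ∏ v, if v ∈ C then (Nat.card (allowed (ofCode w) (F t) (S t) r x v) : R) else 1 := by
      rw [← Finset.prod_filter]
      exact (Finset.prod_subtype (p := (· ∈ C)) (Finset.univ.filter (· ∈ C)) (by simp)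
        fun v => (Nat.card (allowed (ofCode w) (F t) (S t) r x v) : R)).symm
    refine Eq.trans ?_ e₂.symm
    rw [← Fin.prod_univ_def, ← Finset.mul_prod_erase _ _ (Finset.mem_univ r),
      ← Finset.mul_prod_erase _ _ (Finset.mem_univ r), if_pos hrC]
    -- The mark of the root has been cleared, so `collect` skips it; its factor was already placed
    -- in the product by `visitRoot`.
    have e₃ : (s₃.2 r).2 = fun _ => false := by simp [hs₃, rootFun]
    rw [e₃, if_neg (by simp), one_mul]
    refine congrArg₂ _ ?_ (Finset.prod_congr rfl fun v hv => ?_)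
    · refine congrArg (fun A : Set V => (Nat.card A : R)) (Set.ext fun y => ?_)
      simp [allowed, hk₂]
    · have hvr : v ≠ r := Finset.ne_of_mem_erase hv
      have e₄ : s₃.2 v = s₂.2 v := by simp [hs₃, rootFun, hvr]
      rw [e₄]
      refine if_congr (hmk v) ?_ rfl
      refine congrArg (fun A : Set V => (Nat.card A : R)) (Set.ext fun y => ?_)
      simp [allowed, hk₂, hvr]
  · refine (h₂ v).trans ?_
    by_cases hvr : v = r
    · subst hvr
      simp [hs₃, rootFun, hrC]
    · have e₄ : s₃.2 v = s₂.2 v := by simp [hs₃, rootFun, hvr]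
      rw [e₄]
      by_cases hv : v ∈ C
      · rw [if_pos ⟨List.mem_finRange v, (hmk v).2 hv⟩]
        simp [hv]
      · have hf : ∀ b, (s₂.2 v).2 b = false := fun b => by
          rw [← Bool.not_eq_true, hk₂]
          exact fun h => hv ⟨b, h⟩
        rw [if_neg fun h => hv ((hmk v).1 h.2)]
        refine Prod.ext ?_ (funext hf)
        simp [hd₂, hv]
  · rintro a (ha | ⟨b, hb⟩) c hac
    · exact .inl (h.closed a ha c hac)
    · exact .inr ⟨!b, hb.tail ⟨hac, rfl⟩⟩

theorem processed_foldl (hF : ∀ t, (F t).IsRectangular) (l : List (Fin (codeSize w)))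
    {D : Set (Fin (codeSize w))} {s : State w T V R} (h : Processed F S D s) :
    ∃ D', D ⊆ D' ∧ (∀ r ∈ l, r ∈ D') ∧ Processed F S D' (l.foldl
      (fun s r => HomCount.processFun (rootFactor F S R) (factor F S R) r s) s) := by
  induction l generalizing D s with
  | nil => exact ⟨D, subset_rfl, by simp, h⟩
  | cons r l ih =>
    obtain ⟨D₁, h₁, hr, h'⟩ := h.processFun hF r
    obtain ⟨D₂, h₂, hl, h''⟩ := ih h'
    refine ⟨D₂, h₁.trans h₂, fun a ha => ?_, h''⟩
    rcases List.mem_cons.1 ha with rfl | ha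
    · exact h₂ hr
    · exact hl a ha

end HomCount

open ArrayProg HomCount in
/-- A linear combination modulo `p` of numbers of homomorphisms to rectangular graphs, with
restricted images, can be computed in polynomial time. -/
theorem polyTime_of_sum_homs {p : ℕ} [NeZero p] {T V : Type} [Finite T] [Finite V] (s : Finset T)
    (c : T → ZMod p) (F : T → LoopGraph V) (S : T → Set V) (hF : ∀ t, (F t).IsRectangular)
    {g : List Bool → ℕ} (hg : ∀ w, g w =
      (∑ t ∈ s, c t * (Nat.card {σ : (ofCode w).Hom (F t) // ∀ a, σ a ∈ S t} : ZMod p)).val) :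
    PolyTime g := by
  classical
  have := Fintype.ofFinite V
  have := Fintype.ofFinite T
  have : Fintype (ZMod p) := ZMod.fintype p
  refine polyTime_of_arrayProg (σ := Reg T V (ZMod p)) (α := Bool × Mark)
    (fun b => (b, false, fun _ => false))
    (countHoms (rootFactor F S (ZMod p)) (factor F S (ZMod p))) ?_ ?_
    (fun _ => 1, fun _ _ => 1, false, fun _ => false) (fun q => (∑ t ∈ s, c t * q.1 t).val) g
    fun w => ?_
  · simp [countHoms, processComponent, start, spread, edge, visitRoot, collect, visit, readBit,
      ArrayProg.WF]
  · simp [countHoms, processComponent, start, spread, edge, visitRoot, collect, visit, readBit,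
      ArrayProg.EmitFree]
  · rw [hg, cells_eq_memory]
    have h₀ : Processed F S (∅ : Set (Fin (codeSize w)))
        (((fun _ => 1, fun _ _ => 1, false, fun _ => false), fun _ => (false, fun _ => false)) :
          State w T V (ZMod p)) :=
      ⟨fun t => by simp [numHomOn_empty], fun v => by simp, by simp⟩
    obtain ⟨D, -, hD, h⟩ := processed_foldl hF (List.finRange (codeSize w)) h₀
    have hsim := sim_countHoms (w := w) (u := fun _ => 0) (rootFactor F S (ZMod p))
      (factor F S (ZMod p))
      ((fun _ => 1, fun _ _ => 1, false, fun _ => false), fun _ => (false, fun _ => false))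
    have hD : D = Set.univ := Set.eq_univ_of_forall fun v => hD v (List.mem_finRange v)
    rw [hsim]
    refine congrArg ZMod.val (Finset.sum_congr rfl fun t _ => ?_)
    rw [← numHomOn_univ, ← hD, h.total t]

/-! ### Tractable cases and the corollary -/

open LoopGraph

theorem polyTime_zero : PolyTime fun _ => 0 :=
  polyTime_of_arrayProg (σ := Unit) (α := Bool) id (.load id) trivial trivial () (fun _ => 0) _
    fun _ => rfl

theorem polyTime_vertSurjProblem {p : ℕ} [NeZero p] {V : Type} [Finite V] {H : LoopGraph V}
    (hH : H.ComponentsBicliqueOrReflexive) : PolyTime (vertSurjProblem H p) := by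
  classical
  have := Fintype.ofFinite V
  refine polyTime_of_sum_homs (p := p) (Finset.univ : Finset V).powerset
    (fun E => (-1) ^ E.card) (fun _ => H) (fun E => (E : Set V)ᶜ) (fun _ => hH.isRectangular)
    fun w => ?_
  rw [vertSurjProblem, ← numVertSurj_cast, ZMod.val_natCast]

theorem polyTime_compactionProblem {p : ℕ} [NeZero p] {V : Type} [Finite V] {H : LoopGraph V}
    (hH : H.ComponentsStarOrSmallReflexive) : PolyTime (compactionProblem H p) := by
  classical
  have := Fintype.ofFinite V
  refine polyTime_of_sum_homs (p := p)
    (Finset.univ : Finset (V ⊕ {e : V × V // e.1 ≠ e.2 ∧ H.Adj e.1 e.2})).powerset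
    (fun E => (-1) ^ E.card) (fun E => H.deleteEdges {e | ∃ h, .inr ⟨e, h⟩ ∈ E})
    (fun E => {v | .inl v ∉ E}) (fun E => hH.isRectangular_deleteEdges fun a ⟨h, _⟩ => h.1 rfl)
    fun w => ?_
  rw [compactionProblem, ← numCompaction_cast, ZMod.val_natCast]

theorem mainTheorem11 (p : ℕ) (hp : p.Prime) (V : Type) [Finite V] (H : LoopGraph V) :
    (H.HasAutOfOrder p ∨ H.ComponentsBicliqueOrReflexive → PolyTime (vertSurjProblem H p)) ∧
    (H.HasAutOfOrder p ∨ H.ComponentsStarOrSmallReflexive → PolyTime (compactionProblem H p)) ∧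
    (FabenJerrumConjecture →
      (¬ (H.HasAutOfOrder p ∨ H.ComponentsBicliqueOrReflexive) →
        SharpModPHard p (vertSurjProblem H p)) ∧
      (¬ (H.HasAutOfOrder p ∨ H.ComponentsStarOrSmallReflexive) →
        SharpModPHard p (compactionProblem H p))) := by
  have : NeZero p := ⟨hp.ne_zero⟩
  refine ⟨?_, ?_, fun h => ⟨fun hH => ?_, fun hH => ?_⟩⟩
  · rintro (h | h)
    · have : vertSurjProblem H p = fun _ => 0 :=
        funext fun w => Nat.mod_eq_zero_of_dvd (h.dvd_numVertSurj hp _)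
      exact this ▸ polyTime_zero
    · exact polyTime_vertSurjProblem h
  · rintro (h | h)
    · have : compactionProblem H p = fun _ => 0 :=
        funext fun w => Nat.mod_eq_zero_of_dvd (h.dvd_numCompaction hp _)
      exact this ▸ polyTime_zero
    · exact polyTime_compactionProblem h
  · exact h.sharpModPHard_vertSurj hp (fun h => hH (.inl h)) fun h => hH (.inr h)
  · exact h.sharpModPHard_compaction hp (fun h => hH (.inl h)) fun h => hH (.inr h)
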